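/- Let $\Omega\subset\mathbb{R}^2$ be open, let $r,m\in\mathbb{N}$ and $k\ge 1$, and let $F\in C^k(\mathbb{R}^{r\times 2};\mathbb{R}^{m\times 2})$. Put $$C=\left\{Y\in\mathbb{R}^{(r+m)\times 2}:\ Y=\begin{pmatrix}X\\ F(X)\end{pmatrix}\text{ for some }X\in\mathbb{R}^{r\times 2}\right\}.$$ For a matrix $M$ with $r+m$ rows and two columns, let $M^{ab}$ be the $2\times 2$ matrix whose rows are the $a$-th and the $b$-th row of $M$, and let $\|\cdot\|$ be the Euclidean (Frobenius) norm of matrices. Suppose there are constants $c_{ab}\in\mathbb{R}$ such that $$\|X-Y\|^2\le\sum_{1\le a\le b\le r+m}c_{ab}\det\left(M^{ab}-N^{ab}\right)$$ for all $M=\begin{pmatrix}X\\F(X)\end{pmatrix}$ and $N=\begin{pmatrix}Y\\F(Y)\end{pmatrix}$ in $C$. Let $\mathcal V=\begin{pmatrix}u\\v\end{pmatrix}\in W^{1,\infty}_{\mathrm{loc}}(\Omega;\mathbb{R}^{r+m})$, with $u:\Omega\to\mathbb{R}^r$ and $v:\Omega\to\mathbb{R}^m$, satisfy $D\mathcal V(x)\in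 C$ for almost every $x\in\Omega$. Then there is $\rho>0$ such that $u\in W^{2,2+\rho}_{\mathrm{loc}}(\Omega;\mathbb{R}^r)$. -/

import Mathlib

open MeasureTheory
open scoped ENNReal ContDiff

attribute [local instance] Matrix.frobeniusNormedAddCommGroup Matrix.frobeniusNormedSpace

/-- `f ∈ L^p_loc(Ω)`: `f` is in `L^p` of every compact subset of `Ω` (Lebesgue measure). -/
def MemLpLoc (Ω : Set (EuclideanSpace ℝ (Fin 2))) (p : ℝ≥0∞)
    (f : EuclideanSpace ℝ (Fin 2) → ℝ) : Prop :=
  ∀ K : Set (EuclideanSpace ℝ (Fin 2)), IsCompact K → K ⊆ Ω → MemLp f p (volume.restrict K)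

/-- `g` is the weak (distributional) partial derivative `∂_i f` in `Ω`. -/
def HasWeakPartialDeriv (Ω : Set (EuclideanSpace ℝ (Fin 2))) (i : Fin 2)
    (f g : EuclideanSpace ℝ (Fin 2) → ℝ) : Prop :=
  MemLpLoc Ω 1 f ∧ MemLpLoc Ω 1 g ∧
    ∀ φ : EuclideanSpace ℝ (Fin 2) → ℝ,
      ContDiff ℝ ∞ φ → HasCompactSupport φ → tsupport φ ⊆ Ω →
        ∫ x in Ω, f x * fderiv ℝ φ x (EuclideanSpace.single i 1) = -∫ x in Ω, g x * φ x

/-- `f ∈ W^{k,p}_loc(Ω)` for a scalar function `f`: all weak partial derivatives of order at most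
`k` exist in `Ω` and lie in `L^p_loc(Ω)`. -/
def MemSobolevLoc (Ω : Set (EuclideanSpace ℝ (Fin 2))) (p : ℝ≥0∞) :
    ℕ → (EuclideanSpace ℝ (Fin 2) → ℝ) → Prop
  | 0, f => MemLpLoc Ω p f
  | k + 1, f => MemLpLoc Ω p f ∧
      ∀ i : Fin 2, ∃ g : EuclideanSpace ℝ (Fin 2) → ℝ,
        HasWeakPartialDeriv Ω i f g ∧ MemSobolevLoc Ω p k g

/-- `V ∈ W^{k,p}_loc(Ω; ℝ^N)`. -/
def MemSobolevLocVec {N : ℕ} (Ω : Set (EuclideanSpace ℝ (Fin 2))) (p : ℝ≥0∞) (k : ℕ)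
    (V : EuclideanSpace ℝ (Fin 2) → EuclideanSpace ℝ (Fin N)) : Prop :=
  ∀ a : Fin N, MemSobolevLoc Ω p k (fun x => V x a)

/-- `DV` is (a representative of) the weak differential of `V` in `Ω`; the entry `(a, i)` is
`∂_i V_a`. -/
def IsWeakDifferential {N : ℕ} (Ω : Set (EuclideanSpace ℝ (Fin 2)))
    (V : EuclideanSpace ℝ (Fin 2) → EuclideanSpace ℝ (Fin N))
    (DV : EuclideanSpace ℝ (Fin 2) → Matrix (Fin N) (Fin 2) ℝ) : Prop :=
  ∀ (a : Fin N) (i : Fin 2), HasWeakPartialDeriv Ω i (fun x => V x a) (fun x => DV x a i)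

/-- The block matrix with `X` on top of `Z`. -/
def stackRows {r m : ℕ} (X : Matrix (Fin r) (Fin 2) ℝ) (Z : Matrix (Fin m) (Fin 2) ℝ) :
    Matrix (Fin (r + m)) (Fin 2) ℝ :=
  Matrix.of (Fin.append (fun a => X a) (fun b => Z b))

/-- The set `C = {(X, F(X))}` of the differential inclusion. -/
def graphSet {r m : ℕ} (F : Matrix (Fin r) (Fin 2) ℝ → Matrix (Fin m) (Fin 2) ℝ) :
    Set (Matrix (Fin (r + m)) (Fin 2) ℝ) :=
  {Y | ∃ X : Matrix (Fin r) (Fin 2) ℝ, Y = stackRows X (F X)}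

/-- `M^{ab}`: the `2 × 2` matrix consisting of the rows `a` and `b` of `M`. -/
def rowPair {N : ℕ} (M : Matrix (Fin N) (Fin 2) ℝ) (a b : Fin N) : Matrix (Fin 2) (Fin 2) ℝ :=
  M.submatrix ![a, b] id

/-- The first `r` components `u` of a map `V = (u, v)` with values in `ℝ^{r+m}`. -/
def upperPart {r m : ℕ} (V : EuclideanSpace ℝ (Fin 2) → EuclideanSpace ℝ (Fin (r + m))) :
    EuclideanSpace ℝ (Fin 2) → EuclideanSpace ℝ (Fin r) :=
  fun x => WithLp.toLp 2 (fun a : Fin r => V x (Fin.castAdd m a))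

open Filter Topology

/-! The 2 × 2 minors of a gradient are null Lagrangians: the integral of a Jacobian determinant
vanishes as soon as one of its two entries has compact support (`integral_jacobian_eq_zero`). The
hypothesis says that a fixed combination of minors controls the distance of the upper blocks of two
points of the graph. Inserting a cutoff times a solution into this quadratic form leaves only cross
terms with the gradient of the cutoff, because the quadratic contribution of a rank-one matrix to a
minor is zero. This is the Caccioppoli inequality `caccioppoli`, and everything elliptic in the
proof comes from it.

Applied to difference quotients of `V`, it gives second derivatives in L² locally. The inclusion may
then be differentiated: each `∂_k V` has gradient `(X, DF(Du) X)` almost everywhere, and dividing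
the monotonicity condition by `t²` and letting `t → 0` shows that the same quadratic form bounds
`|X|²` from above on these tangent matrices (`exists_weakDeriv_stackDeriv`,
`IsCoerciveGraph.sum_sq_le_stackDeriv`).

For this linear system Caccioppoli and Poincaré combine into a hole-filling inequality, so the
energy on balls decays like a power of the radius. In two dimensions this forces `∂_k V` to have an
essential limit at every point (`exists_hole_filling`, `exists_essential_limit`). Since `F` is at
least C¹, the coefficients `DF(Du)` oscillate arbitrarily little on small balls.

The gain of integrability is therefore a perturbation from constant coefficients `B = DF(Du(x₀))`.
On the Fourier side a curl eliminates the lower rows and leaves a matrix symbol that is quadratic in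
the frequency. It is injective away from zero, since a rank-one matrix has no minors and coercivity
leaves it no room to be nonzero. Hence the gradient of the upper rows is obtained from the defect `H
= Db - B Da` by multipliers that are homogeneous of degree zero
(`fourierInv_eq_sum_recoverySymbol`). Such multipliers are bounded on L⁴: for a half plane, the
squares of the two frequency pieces have disjoint spectra and are orthogonal
(`IsL4MultiplierWith.halfplane`), and a general symbol is a limit of step functions of the angle
with uniformly bounded variation (`exists_isL4MultiplierWith_of_homogeneous`). The defect is a small
multiple of the gradient plus bounded terms, so a contraction that is bounded in L⁴ along its
iterates places the second derivatives in L⁴ (`exists_memLp_four_of_fixedPoint`,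
`exists_memLp_four_restrict`). Gluing over points gives the theorem with `ρ = 2`; no reverse Hölder
inequality is needed. -/

/-- The Euclidean plane. -/
abbrev Plane := EuclideanSpace ℝ (Fin 2)

/-- The `i`-th coordinate vector of the plane. -/
noncomputable abbrev coordVec (i : Fin 2) : Plane := EuclideanSpace.single i 1

/-! ### Mollification and its convergence in L^p. -/

section Mollification

open scoped Convolution

/-- A sequence of bump functions concentrating at the origin. -/
noncomputable def mollBump (n : ℕ) : ContDiffBump (0 : Plane) where
  rIn := 1 / ((n : ℝ) + 1)
  rOut := 2 / ((n : ℝ) + 1)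
  rIn_pos := by positivity
  rIn_lt_rOut := by gcongr; norm_num

/-- The mollification of `f` at scale `1 / (n + 1)`. -/
noncomputable def mollify {F : Type*} [NormedAddCommGroup F] [NormedSpace ℝ F] (n : ℕ)
    (f : Plane → F) : Plane → F :=
  (mollBump n).normed volume ⋆[ContinuousLinearMap.lsmul ℝ ℝ, volume] f

variable {F : Type*} [NormedAddCommGroup F] [NormedSpace ℝ F]

theorem mollify_apply (n : ℕ) (f : Plane → F) (x : Plane) :
    mollify n f x = ∫ t, (mollBump n).normed volume t • f (x - t) := rfl

theorem tendsto_mollBump_rOut : Tendsto (fun n => (mollBump n).rOut) atTop (𝓝 0) := by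
  have := (tendsto_one_div_add_atTop_nhds_zero_nat (𝕜 := ℝ)).const_mul 2
  simpa [mollBump, div_eq_mul_inv] using this

theorem mollBump_rOut_le (n : ℕ) : (mollBump n).rOut ≤ 2 := by
  simp only [mollBump]
  rw [div_le_iff₀ (by positivity)]
  nlinarith [(Nat.cast_nonneg n : (0 : ℝ) ≤ n)]

theorem mollify_congr {f g : Plane → F} (h : f =ᵐ[volume] g) (n : ℕ) :
    mollify n f = mollify n g :=
  convolution_congr _ EventuallyEq.rfl h

theorem mollify_contDiff [CompleteSpace F] {f : Plane → F} (hf : LocallyIntegrable f) (n : ℕ) :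
    ContDiff ℝ ∞ (mollify n f) :=
  (mollBump n).hasCompactSupport_normed.contDiff_convolution_left _
    (mollBump n).contDiff_normed hf

theorem mollify_hasCompactSupport {f : Plane → F} (hf : HasCompactSupport f) (n : ℕ) :
    HasCompactSupport (mollify n f) :=
  (mollBump n).hasCompactSupport_normed.convolution _ hf

theorem mollify_eq_zero_of_dist {f : Plane → F} {n : ℕ} {x : Plane}
    (h : ∀ y, dist y x ≤ 2 → f y = 0) : mollify n f x = 0 := by
  rw [mollify_apply]
  refine integral_eq_zero_of_ae (Eventually.of_forall fun t => ?_)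
  by_cases ht : ‖t‖ < (mollBump n).rOut
  · have : f (x - t) = 0 := h _ (by
      rw [dist_eq_norm]; simpa using ht.le.trans (mollBump_rOut_le n))
    simp [this]
  · have : (mollBump n).normed volume t = 0 := by
      have := (mollBump n).support_normed_eq (μ := (volume : Measure Plane))
      by_contra hne
      have h2 : t ∈ Function.support ((mollBump n).normed (volume : Measure Plane)) := hne
      rw [this] at h2
      exact ht (by simpa using h2)
    simp [this]

theorem ae_tendsto_mollify [CompleteSpace F] {f : Plane → F} (hf : LocallyIntegrable f) :
    ∀ᵐ x, Tendsto (fun n => mollify n f x) atTop (𝓝 (f x)) :=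
  -- The constant 2 is the fixed ratio of outer to inner radius, which keeps the bumps comparable to
  -- averages over balls.
  ContDiffBump.ae_convolution_tendsto_right_of_locallyIntegrable (K := 2)
    tendsto_mollBump_rOut (Eventually.of_forall fun n => by
      simp only [mollBump]; apply le_of_eq; ring) hf

theorem norm_mollify_le {f : Plane → F} {C : ℝ} (hf : ∀ᵐ x, ‖f x‖ ≤ C) (n : ℕ) (x : Plane) :
    ‖mollify n f x‖ ≤ C := by
  rw [mollify_apply]
  have hq := (quasiMeasurePreserving_sub_left_of_right_invariant (volume : Measure Plane) x).ae hf
  calc ‖∫ t, (mollBump n).normed volume t • f (x - t)‖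
      ≤ ∫ t, (mollBump n).normed volume t * C := by
        refine norm_integral_le_of_norm_le
          ((mollBump n).integrable_normed.mul_const C) ?_
        filter_upwards [hq] with t ht
        rw [norm_smul, Real.norm_of_nonneg ((mollBump n).nonneg_normed t)]
        exact mul_le_mul_of_nonneg_left ht ((mollBump n).nonneg_normed t)
    _ = C := by rw [integral_mul_const, (mollBump n).integral_normed, one_mul]

/-- Pointwise, mollification is an average of translates against a probability measure, so Jensen
bounds its p-th power by the average of p-th powers. Tonelli and translation invariance then finish.
-/
theorem eLpNorm_mollify_le {f : Plane → F} {p : ℝ≥0∞} (hp1 : 1 ≤ p) (hp : p ≠ ⊤)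
    (hf : AEStronglyMeasurable f volume) (n : ℕ) :
    eLpNorm (mollify n f) p volume ≤ eLpNorm f p volume := by
  -- A strongly measurable representative makes the integrand measurable on the product, as Tonelli
  -- requires.
  obtain ⟨f', hf', hff'⟩ := hf
  rw [mollify_congr hff', eLpNorm_congr_ae hff']
  clear hff' f
  set φ := (mollBump n).normed (volume : Measure Plane)
  have hφm : Measurable fun t => ‖φ t‖ₑ := ((mollBump n).continuous_normed.measurable).enorm
  set ν := (volume : Measure Plane).withDensity fun t => ‖φ t‖ₑ with hν
  have hprob : IsProbabilityMeasure ν := ⟨by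
    rw [hν, withDensity_apply _ MeasurableSet.univ, Measure.restrict_univ]
    have : ∀ t, ‖φ t‖ₑ = ENNReal.ofReal (φ t) := fun t =>
      Real.enorm_eq_ofReal ((mollBump n).nonneg_normed t)
    simp_rw [this]
    rw [← ofReal_integral_eq_lintegral_ofReal (mollBump n).integrable_normed
      (Eventually.of_forall fun t => (mollBump n).nonneg_normed t), (mollBump n).integral_normed]
    simp⟩
  have hq0 : p ≠ 0 := (zero_lt_one.trans_le hp1).ne'
  set q := p.toReal
  have hqpos : 0 < q := ENNReal.toReal_pos hq0 hp
  have hpt : ∀ x, ‖mollify n f' x‖ₑ ^ q ≤ ∫⁻ t, ‖φ t‖ₑ * ‖f' (x - t)‖ₑ ^ q := by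
    intro x
    have hm : StronglyMeasurable fun t => f' (x - t) :=
      hf'.comp_measurable (measurable_const.sub measurable_id)
    have h1 : ‖mollify n f' x‖ₑ ≤ eLpNorm (fun t => f' (x - t)) 1 ν := by
      rw [eLpNorm_one_eq_lintegral_enorm, hν, lintegral_withDensity_eq_lintegral_mul _ hφm hm.enorm]
      refine (enorm_integral_le_lintegral_enorm _).trans (le_of_eq ?_)
      refine lintegral_congr fun t => ?_
      simp [enorm_smul, φ]
    have h2 := h1.trans (eLpNorm_le_eLpNorm_of_exponent_le hp1 hm.aestronglyMeasurable)
    rw [eLpNorm_eq_lintegral_rpow_enorm_toReal hq0 hp] at h2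
    calc ‖mollify n f' x‖ₑ ^ q ≤ _ := ENNReal.rpow_le_rpow h2 hqpos.le
      _ = ∫⁻ t, ‖f' (x - t)‖ₑ ^ q ∂ν := by
        rw [← ENNReal.rpow_mul, one_div_mul_cancel hqpos.ne', ENNReal.rpow_one]
      _ = _ := by
        rw [hν, lintegral_withDensity_eq_lintegral_mul _ hφm (hm.enorm.pow_const q)]
        rfl
  rw [eLpNorm_eq_lintegral_rpow_enorm_toReal hq0 hp, eLpNorm_eq_lintegral_rpow_enorm_toReal hq0 hp]
  refine ENNReal.rpow_le_rpow ?_ (by positivity)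
  calc ∫⁻ x, ‖mollify n f' x‖ₑ ^ q ≤ ∫⁻ x, ∫⁻ t, ‖φ t‖ₑ * ‖f' (x - t)‖ₑ ^ q :=
        lintegral_mono hpt
    _ = ∫⁻ t, ∫⁻ x, ‖φ t‖ₑ * ‖f' (x - t)‖ₑ ^ q := by
        refine lintegral_lintegral_swap (Measurable.aemeasurable ?_)
        refine (hφm.comp measurable_snd).mul ?_
        exact ((hf'.comp_measurable (measurable_fst.sub measurable_snd)).enorm).pow_const q
    _ = ∫⁻ t, ‖φ t‖ₑ * ∫⁻ x, ‖f' x‖ₑ ^ q := by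
        refine lintegral_congr fun t => ?_
        rw [lintegral_const_mul' _ _ enorm_ne_top,
          lintegral_sub_right_eq_self (fun x => ‖f' x‖ₑ ^ q) t]
    _ = ∫⁻ x, ‖f' x‖ₑ ^ q := by
        rw [lintegral_mul_const _ hφm]
        have : ∫⁻ t, ‖φ t‖ₑ = 1 := by
          have := hprob.measure_univ
          rwa [hν, withDensity_apply _ MeasurableSet.univ, Measure.restrict_univ] at this
        rw [this, one_mul]

theorem mollify_memLp [CompleteSpace F] {f : Plane → F} {p : ℝ≥0∞} (hp1 : 1 ≤ p) (hp : p ≠ ⊤)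
    (hf : MemLp f p volume) (n : ℕ) : MemLp (mollify n f) p volume :=
  ⟨(mollify_contDiff (hf.locallyIntegrable hp1) n).continuous.aestronglyMeasurable,
    (eLpNorm_mollify_le hp1 hp hf.1 n).trans_lt hf.2⟩

theorem mollify_sub [CompleteSpace F] {f g : Plane → F} (hf : LocallyIntegrable f)
    (hg : LocallyIntegrable g) (n : ℕ) : mollify n (f - g) = mollify n f - mollify n g := by
  ext x
  have h1 := ((mollBump n).hasCompactSupport_normed
    (μ := (volume : Measure Plane))).convolutionExists_left
    (ContinuousLinearMap.lsmul ℝ ℝ : ℝ →L[ℝ] F →L[ℝ] F) (mollBump n).continuous_normed hf x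
  have h2 := ((mollBump n).hasCompactSupport_normed
    (μ := (volume : Measure Plane))).convolutionExists_left
    (ContinuousLinearMap.lsmul ℝ ℝ : ℝ →L[ℝ] F →L[ℝ] F) (mollBump n).continuous_normed hg x
  simp only [Pi.sub_apply, mollify_apply, smul_sub]
  exact integral_sub h1 h2

/-- For smooth compactly supported functions convergence is uniform and takes place inside one
compact set; the general case follows by density, since mollification contracts L^p. -/
theorem tendsto_eLpNorm_mollify_sub [CompleteSpace F] {f : Plane → F} {p : ℝ≥0∞} (hp1 : 1 ≤ p)
    (hp : p ≠ ⊤) (hf : MemLp f p volume) :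
    Tendsto (fun n => eLpNorm (mollify n f - f) p volume) atTop (𝓝 0) := by
  have hcont : ∀ g : Plane → F, HasCompactSupport g → ContDiff ℝ ∞ g →
      Tendsto (fun n => eLpNorm (mollify n g - g) p volume) atTop (𝓝 0) := by
    intro g hgc hgd
    set K := Metric.cthickening 2 (tsupport g)
    have hK : IsCompact K := hgc.cthickening
    have huc := hgc.uniformContinuous_of_continuous hgd.continuous
    have hz : ∀ n, ∀ x ∉ K, (mollify n g - g) x = 0 := by
      intro n x hx
      have hfar : ∀ y, dist y x ≤ 2 → g y = 0 := by
        intro y hy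
        by_contra hne
        exact hx (Metric.mem_cthickening_of_dist_le x y 2 _
          (subset_tsupport _ hne) (by rwa [dist_comm]))
      simp [mollify_eq_zero_of_dist hfar, hfar x (by simp)]
    have hvol : volume K ^ (1 / p.toReal) ≠ ⊤ :=
      ENNReal.rpow_ne_top_of_nonneg (by positivity) hK.measure_lt_top.ne
    rw [ENNReal.tendsto_nhds_zero]
    intro ε hε
    obtain ⟨δ, hδ, hδε⟩ : ∃ δ : ℝ, 0 < δ ∧ volume K ^ (1 / p.toReal) * ENNReal.ofReal δ ≤ ε := by
      rcases eq_or_ne ε ⊤ with rfl | hεt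
      · exact ⟨1, one_pos, le_top⟩
      set A := (volume K ^ (1 / p.toReal)).toReal
      have hA : 0 ≤ A := ENNReal.toReal_nonneg
      refine ⟨ε.toReal / (A + 1), div_pos (ENNReal.toReal_pos hε.ne' hεt) (by positivity), ?_⟩
      rw [← ENNReal.ofReal_toReal hvol, ← ENNReal.ofReal_mul hA]
      refine ENNReal.ofReal_le_of_le_toReal ?_
      rw [mul_div_assoc', div_le_iff₀ (by positivity)]
      nlinarith [ENNReal.toReal_nonneg (a := ε)]
    obtain ⟨r, hr, hru⟩ := Metric.uniformContinuous_iff.1 huc δ hδ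
    filter_upwards [tendsto_mollBump_rOut.eventually (gt_mem_nhds hr)] with n hn
    have hb : ∀ x, ‖(mollify n g - g) x‖ ≤ δ := by
      intro x
      rw [Pi.sub_apply, ← dist_eq_norm]
      exact (mollBump n).dist_normed_convolution_le hgd.continuous.aestronglyMeasurable
        fun y hy => (hru (lt_trans (by simpa using hy) hn)).le
    have : mollify n g - g = K.indicator (mollify n g - g) := by
      ext x
      by_cases hx : x ∈ K
      · rw [Set.indicator_of_mem hx]
      · rw [Set.indicator_of_notMem hx, hz n x hx]
    rw [this, eLpNorm_indicator_eq_eLpNorm_restrict hK.measurableSet]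
    refine (eLpNorm_le_of_ae_bound (Eventually.of_forall hb)).trans ?_
    rwa [Measure.restrict_apply_univ, ← one_div]
  rw [ENNReal.tendsto_nhds_zero]
  intro ε hε
  obtain ⟨δ, hδ, hδε⟩ : ∃ δ : ℝ, 0 < δ ∧ ENNReal.ofReal δ ≤ ε / 3 := by
    rcases eq_or_ne ε ⊤ with rfl | hεt
    · exact ⟨1, one_pos, by simp [ENNReal.top_div_of_ne_top]⟩
    have h3 : ε / 3 ≠ ⊤ := ENNReal.div_ne_top hεt (by norm_num)
    exact ⟨(ε / 3).toReal, ENNReal.toReal_pos (ENNReal.div_pos hε.ne' (by norm_num)).ne' h3,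
      by rw [ENNReal.ofReal_toReal h3]⟩
  obtain ⟨g, hgc, hgd, hg⟩ := hf.exist_eLpNorm_sub_le hp hp1 hδ
  have hgL : MemLp g p volume := hgd.continuous.memLp_of_hasCompactSupport hgc
  have hfg := hf.sub hgL
  filter_upwards [(ENNReal.tendsto_nhds_zero.1 (hcont g hgc hgd)) (ε / 3)
    (ENNReal.div_pos hε.ne' (by norm_num))] with n hn
  have hdec : mollify n f - f = mollify n (f - g) + (mollify n g - g) + (g - f) := by
    rw [mollify_sub (hf.locallyIntegrable hp1) (hgL.locallyIntegrable hp1)]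
    abel
  rw [hdec]
  have m1 := mollify_memLp hp1 hp hfg n
  have m2 := (mollify_memLp hp1 hp hgL n).sub hgL
  calc _ ≤ eLpNorm (mollify n (f - g) + (mollify n g - g)) p volume + eLpNorm (g - f) p volume :=
        eLpNorm_add_le (m1.add m2).1 (hgL.sub hf).1 hp1
    _ ≤ (eLpNorm (mollify n (f - g)) p volume + eLpNorm (mollify n g - g) p volume) +
        eLpNorm (g - f) p volume := by gcongr; exact eLpNorm_add_le m1.1 m2.1 hp1
    _ ≤ (ε / 3 + ε / 3) + ε / 3 := by
        gcongr
        · exact (eLpNorm_mollify_le hp1 hp hfg.1 n).trans (hg.trans hδε)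
        · rw [eLpNorm_sub_comm]; exact hg.trans hδε
    _ = ε := ENNReal.add_thirds ε

end Mollification

/-! ### Calculus of weak partial derivatives. -/

section WeakDerivatives

variable {U : Set Plane} {i : Fin 2} {f g : Plane → ℝ}

theorem memLpLoc_one_iff (hU : IsOpen U) : MemLpLoc U 1 f ↔ LocallyIntegrableOn f U := by
  rw [locallyIntegrableOn_iff hU.isLocallyClosed]
  refine ⟨fun h K hKU hK => memLp_one_iff_integrable.1 (h K hK hKU),
    fun h K hK hKU => memLp_one_iff_integrable.2 (h K hKU hK)⟩

theorem memLpLoc_one_univ_iff : MemLpLoc Set.univ 1 f ↔ LocallyIntegrable f := by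
  rw [memLpLoc_one_iff isOpen_univ, locallyIntegrableOn_univ]

theorem MemLpLoc.mono_exponent {p q : ℝ≥0∞} (hpq : p ≤ q) (h : MemLpLoc U q f) :
    MemLpLoc U p f := by
  intro K hK hKU
  have : IsFiniteMeasure (volume.restrict K) := ⟨by
    rw [Measure.restrict_apply_univ]; exact hK.measure_lt_top⟩
  exact (h K hK hKU).mono_exponent hpq

theorem LocallyIntegrableOn.integrable_mul_test (hf : MemLpLoc U 1 f) {ψ : Plane → ℝ}
    (hψ : Continuous ψ) (hc : HasCompactSupport ψ) (hs : tsupport ψ ⊆ U) :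
    Integrable fun x => f x * ψ x := by
  have h1 : IntegrableOn (fun x => f x * ψ x) (tsupport ψ) :=
    IntegrableOn.mul_continuousOn (memLp_one_iff_integrable.1 (hf _ hc hs))
      hψ.continuousOn hc
  refine (integrableOn_iff_integrable_of_support_subset fun x hx => ?_).1 h1
  refine subset_tsupport _ fun h0 => hx ?_
  simp [h0]

theorem continuous_fderiv_coord {φ : Plane → ℝ} (hφ : ContDiff ℝ ∞ φ) (i : Fin 2) :
    Continuous fun x => fderiv ℝ φ x (coordVec i) :=
  (hφ.continuous_fderiv (by simp)).clm_apply continuous_const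

theorem contDiff_fderiv_coord {φ : Plane → ℝ} (hφ : ContDiff ℝ ∞ φ) (i : Fin 2) :
    ContDiff ℝ ∞ fun x => fderiv ℝ φ x (coordVec i) :=
  (hφ.fderiv_right (m := ∞) (by simp)).clm_apply contDiff_const

theorem tsupport_fderiv_coord_subset (φ : Plane → ℝ) (i : Fin 2) :
    tsupport (fun x => fderiv ℝ φ x (coordVec i)) ⊆ tsupport φ :=
  tsupport_fderiv_apply_subset ℝ _

theorem hasCompactSupport_fderiv_coord {φ : Plane → ℝ} (hφ : HasCompactSupport φ) (i : Fin 2) :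
    HasCompactSupport fun x => fderiv ℝ φ x (coordVec i) :=
  hφ.mono' ((subset_tsupport _).trans (tsupport_fderiv_coord_subset φ i))

/-- Test functions vanish outside `U`, so the domain of integration may be the whole plane; `U` then
matters only through the admissible test functions. -/
theorem HasWeakPartialDeriv.integral_eq (h : HasWeakPartialDeriv U i f g) {φ : Plane → ℝ}
    (hφ : ContDiff ℝ ∞ φ) (hc : HasCompactSupport φ) (hs : tsupport φ ⊆ U) :
    ∫ x, f x * fderiv ℝ φ x (coordVec i) = -∫ x, g x * φ x := by
  have h1 := h.2.2 φ hφ hc hs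
  rw [setIntegral_eq_integral_of_forall_compl_eq_zero,
    setIntegral_eq_integral_of_forall_compl_eq_zero] at h1
  · exact h1
  · intro x hx
    rw [image_eq_zero_of_notMem_tsupport fun hx' => hx (hs hx'), mul_zero]
  · intro x hx
    have : fderiv ℝ φ x (coordVec i) = 0 :=
      image_eq_zero_of_notMem_tsupport (f := fun x => fderiv ℝ φ x (coordVec i))
        fun hx' => hx (hs (tsupport_fderiv_coord_subset φ i hx'))
    rw [this, mul_zero]

theorem hasWeakPartialDeriv_of_integral_eq (hf : MemLpLoc U 1 f) (hg : MemLpLoc U 1 g)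
    (h : ∀ φ : Plane → ℝ, ContDiff ℝ ∞ φ → HasCompactSupport φ → tsupport φ ⊆ U →
      ∫ x, f x * fderiv ℝ φ x (coordVec i) = -∫ x, g x * φ x) :
    HasWeakPartialDeriv U i f g := by
  refine ⟨hf, hg, fun φ hφ hc hs => ?_⟩
  rw [setIntegral_eq_integral_of_forall_compl_eq_zero,
    setIntegral_eq_integral_of_forall_compl_eq_zero]
  · exact h φ hφ hc hs
  · intro x hx
    rw [image_eq_zero_of_notMem_tsupport fun hx' => hx (hs hx'), mul_zero]
  · intro x hx
    have : fderiv ℝ φ x (coordVec i) = 0 :=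
      image_eq_zero_of_notMem_tsupport (f := fun x => fderiv ℝ φ x (coordVec i))
        fun hx' => hx (hs (tsupport_fderiv_coord_subset φ i hx'))
    rw [this, mul_zero]

theorem MemLpLoc.mono_set {U' : Set Plane} {p : ℝ≥0∞} (h : MemLpLoc U p f) (hU : U' ⊆ U) :
    MemLpLoc U' p f := fun K hK hKU => h K hK (hKU.trans hU)

theorem HasWeakPartialDeriv.mono {U' : Set Plane} (h : HasWeakPartialDeriv U i f g)
    (hU : U' ⊆ U) : HasWeakPartialDeriv U' i f g :=
  hasWeakPartialDeriv_of_integral_eq (h.1.mono_set hU) (h.2.1.mono_set hU)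
    fun _ hφ hc hs => h.integral_eq hφ hc (hs.trans hU)

theorem MemLpLoc.congr_ae {f' : Plane → ℝ} {p : ℝ≥0∞} (h : MemLpLoc U p f)
    (hff' : ∀ᵐ x, x ∈ U → f x = f' x) : MemLpLoc U p f' := by
  intro K hK hKU
  refine (memLp_congr_ae ?_).1 (h K hK hKU)
  filter_upwards [ae_restrict_mem hK.measurableSet, ae_restrict_of_ae hff'] with x hx h
  exact h (hKU hx)

theorem integral_mul_congr_of_tsupport {f' ψ : Plane → ℝ} (hff' : ∀ᵐ x, x ∈ U → f x = f' x)
    (hs : tsupport ψ ⊆ U) : ∫ x, f x * ψ x = ∫ x, f' x * ψ x := by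
  refine integral_congr_ae ?_
  filter_upwards [hff'] with x hx
  by_cases h : x ∈ U
  · rw [hx h]
  · rw [image_eq_zero_of_notMem_tsupport fun hx' => h (hs hx'), mul_zero, mul_zero]

theorem HasWeakPartialDeriv.congr_ae {f' g' : Plane → ℝ} (h : HasWeakPartialDeriv U i f g)
    (hff' : ∀ᵐ x, x ∈ U → f x = f' x) (hgg' : ∀ᵐ x, x ∈ U → g x = g' x) :
    HasWeakPartialDeriv U i f' g' := by
  refine hasWeakPartialDeriv_of_integral_eq (h.1.congr_ae hff') (h.2.1.congr_ae hgg')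
    fun φ hφ hc hs => ?_
  rw [← integral_mul_congr_of_tsupport hgg' hs, ← h.integral_eq hφ hc hs]
  exact (integral_mul_congr_of_tsupport hff' ((tsupport_fderiv_coord_subset φ i).trans hs)).symm

theorem HasWeakPartialDeriv.unique (hU : IsOpen U) {g' : Plane → ℝ}
    (h : HasWeakPartialDeriv U i f g) (h' : HasWeakPartialDeriv U i f g') :
    ∀ᵐ x, x ∈ U → g x = g' x := by
  have hl := ((memLpLoc_one_iff hU).1 h.2.1).sub ((memLpLoc_one_iff hU).1 h'.2.1)
  have := hU.ae_eq_zero_of_integral_contDiff_smul_eq_zero hl fun φ hφ hc hs => by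
    have h1 := h.integral_eq hφ hc hs
    rw [h'.integral_eq hφ hc hs] at h1
    have e : ∀ x, φ x • (g - g') x = g x * φ x - g' x * φ x := fun x => by
      simp only [smul_eq_mul, Pi.sub_apply]; ring
    simp_rw [e]
    rw [integral_sub (LocallyIntegrableOn.integrable_mul_test h.2.1 hφ.continuous hc hs)
      (LocallyIntegrableOn.integrable_mul_test h'.2.1 hφ.continuous hc hs)]
    linarith
  filter_upwards [this] with x hx hxU
  exact sub_eq_zero.1 (hx hxU)

theorem fderiv_mul_coord {φ η : Plane → ℝ} (hφ : ContDiff ℝ ∞ φ) (hη : ContDiff ℝ ∞ η)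
    (x v : Plane) :
    fderiv ℝ (fun y => η y * φ y) x v = η x * fderiv ℝ φ x v + φ x * fderiv ℝ η x v := by
  rw [fderiv_fun_mul (hη.differentiable (by simp) x) (hφ.differentiable (by simp) x)]
  simp

theorem MemLpLoc.mul_cutoff (hf : MemLpLoc U 1 f) {η : Plane → ℝ} (hη : Continuous η)
    (hc : HasCompactSupport η) (hs : tsupport η ⊆ U) :
    Integrable fun x => η x * f x := by
  simpa only [mul_comm] using LocallyIntegrableOn.integrable_mul_test hf hη hc hs

/-- Multiplication by a cutoff function turns a local weak derivative into a global one. -/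
theorem HasWeakPartialDeriv.mul_cutoff (h : HasWeakPartialDeriv U i f g) {η : Plane → ℝ}
    (hη : ContDiff ℝ ∞ η) (hc : HasCompactSupport η) (hs : tsupport η ⊆ U) :
    HasWeakPartialDeriv Set.univ i (fun x => η x * f x)
      (fun x => η x * g x + f x * fderiv ℝ η x (coordVec i)) := by
  have hs' := (tsupport_fderiv_coord_subset η i).trans hs
  have i1 := h.1.mul_cutoff hη.continuous hc hs
  have i2 := h.2.1.mul_cutoff hη.continuous hc hs
  have i3 := LocallyIntegrableOn.integrable_mul_test h.1 (continuous_fderiv_coord hη i)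
    (hasCompactSupport_fderiv_coord hc i) hs'
  refine hasWeakPartialDeriv_of_integral_eq (memLpLoc_one_univ_iff.2 i1.locallyIntegrable)
    (memLpLoc_one_univ_iff.2 (i2.add i3).locallyIntegrable) fun φ hφ hφc _ => ?_
  have hmul : tsupport (fun y => η y * φ y) ⊆ tsupport η := tsupport_mul_subset_left
  have hmc : HasCompactSupport fun y => η y * φ y := hc.mul_right
  have key := h.integral_eq (hη.mul hφ) hmc (hmul.trans hs)
  have j1 : Integrable fun x => f x * fderiv ℝ (fun y => η y * φ y) x (coordVec i) :=
    LocallyIntegrableOn.integrable_mul_test h.1 (continuous_fderiv_coord (hη.mul hφ) i)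
      (hasCompactSupport_fderiv_coord hmc i)
      ((tsupport_fderiv_coord_subset _ i).trans (hmul.trans hs))
  have j2 : Integrable fun x => f x * (fderiv ℝ η x (coordVec i) * φ x) :=
    LocallyIntegrableOn.integrable_mul_test h.1
      ((continuous_fderiv_coord hη i).mul hφ.continuous)
      (hasCompactSupport_fderiv_coord hc i).mul_right (tsupport_mul_subset_left.trans hs')
  have j3 : Integrable fun x => g x * (η x * φ x) :=
    LocallyIntegrableOn.integrable_mul_test h.2.1 (hη.continuous.mul hφ.continuous) hmc
      (hmul.trans hs)
  have e1 : ∀ x, η x * f x * fderiv ℝ φ x (coordVec i) =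
      f x * fderiv ℝ (fun y => η y * φ y) x (coordVec i) -
        f x * (fderiv ℝ η x (coordVec i) * φ x) := fun x => by
    rw [fderiv_mul_coord hφ hη]; ring
  have e2 : ∀ x, (η x * g x + f x * fderiv ℝ η x (coordVec i)) * φ x =
      g x * (η x * φ x) + f x * (fderiv ℝ η x (coordVec i) * φ x) := fun x => by ring
  simp_rw [e1, e2]
  rw [integral_sub j1 j2, integral_add j3 j2, key]
  ring

theorem hasWeakPartialDeriv_of_contDiff {φ : Plane → ℝ} (hφ : ContDiff ℝ 1 φ) (U : Set Plane)
    (i : Fin 2) : HasWeakPartialDeriv U i φ (fun x => fderiv ℝ φ x (coordVec i)) := by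
  have hc : Continuous fun x => fderiv ℝ φ x (coordVec i) :=
    (hφ.continuous_fderiv (by simp)).clm_apply continuous_const
  refine hasWeakPartialDeriv_of_integral_eq
    ((memLpLoc_one_univ_iff.2 hφ.continuous.locallyIntegrable).mono_set (Set.subset_univ _))
    ((memLpLoc_one_univ_iff.2 hc.locallyIntegrable).mono_set (Set.subset_univ _))
    fun ψ hψ hψc _ => ?_
  refine integral_mul_fderiv_eq_neg_fderiv_mul_of_integrable ?_ ?_ ?_
    (fun x _ => hφ.differentiable (by simp) x) (fun x _ => hψ.differentiable (by simp) x)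
  · exact (hc.mul hψ.continuous).integrable_of_hasCompactSupport hψc.mul_left
  · exact (hφ.continuous.mul (continuous_fderiv_coord hψ i)).integrable_of_hasCompactSupport
      (hasCompactSupport_fderiv_coord hψc i).mul_left
  · exact (hφ.continuous.mul hψ.continuous).integrable_of_hasCompactSupport hψc.mul_left

theorem HasWeakPartialDeriv.sub {f' g' : Plane → ℝ} (h : HasWeakPartialDeriv U i f g)
    (h' : HasWeakPartialDeriv U i f' g') :
    HasWeakPartialDeriv U i (fun x => f x - f' x) (fun x => g x - g' x) := by
  refine hasWeakPartialDeriv_of_integral_eq (fun K hK hKU => (h.1 K hK hKU).sub (h'.1 K hK hKU))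
    (fun K hK hKU => (h.2.1 K hK hKU).sub (h'.2.1 K hK hKU)) fun φ hφ hc hs => ?_
  have hs' := (tsupport_fderiv_coord_subset φ i).trans hs
  have d1 := continuous_fderiv_coord hφ i
  have d2 := hasCompactSupport_fderiv_coord hc i
  simp_rw [sub_mul]
  rw [integral_sub (LocallyIntegrableOn.integrable_mul_test h.1 d1 d2 hs')
    (LocallyIntegrableOn.integrable_mul_test h'.1 d1 d2 hs'),
    integral_sub (LocallyIntegrableOn.integrable_mul_test h.2.1 hφ.continuous hc hs)
    (LocallyIntegrableOn.integrable_mul_test h'.2.1 hφ.continuous hc hs),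
    h.integral_eq hφ hc hs, h'.integral_eq hφ hc hs]
  ring

theorem HasWeakPartialDeriv.const_mul (h : HasWeakPartialDeriv U i f g) (c : ℝ) :
    HasWeakPartialDeriv U i (fun x => c * f x) (fun x => c * g x) := by
  refine hasWeakPartialDeriv_of_integral_eq (fun K hK hKU => (h.1 K hK hKU).const_mul c)
    (fun K hK hKU => (h.2.1 K hK hKU).const_mul c) fun φ hφ hc hs => ?_
  simp_rw [mul_assoc]
  rw [integral_const_mul, integral_const_mul, h.integral_eq hφ hc hs]
  ring

theorem HasWeakPartialDeriv.sub_const (h : HasWeakPartialDeriv U i f g) (c : ℝ) :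
    HasWeakPartialDeriv U i (fun x => f x - c) g := by
  simpa using h.sub (hasWeakPartialDeriv_of_contDiff (φ := fun _ => c) contDiff_const U i)

theorem MemLpLoc.comp_add {p : ℝ≥0∞} (h : MemLpLoc Set.univ p f) (v : Plane) :
    MemLpLoc Set.univ p (fun x => f (x + v)) := by
  intro K hK _
  have hmp := (measurePreserving_add_right (volume : Measure Plane) v).restrict_preimage
    (hK.image (continuous_add_const v)).measurableSet
  have hpre : (fun x => x + v) ⁻¹' ((fun x => x + v) '' K) = K :=
    Set.preimage_image_eq _ (add_left_injective v)
  have := (h _ (hK.image (continuous_add_const v)) (Set.subset_univ _)).comp_measurePreserving hmp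
  rwa [hpre] at this

theorem HasWeakPartialDeriv.comp_add (h : HasWeakPartialDeriv Set.univ i f g) (v : Plane) :
    HasWeakPartialDeriv Set.univ i (fun x => f (x + v)) (fun x => g (x + v)) := by
  refine hasWeakPartialDeriv_of_integral_eq (h.1.comp_add v) (h.2.1.comp_add v)
    fun φ hφ hc _ => ?_
  set ψ : Plane → ℝ := fun y => φ (y - v)
  have hψ : ContDiff ℝ ∞ ψ := hφ.comp (contDiff_id.sub contDiff_const)
  have hψc : HasCompactSupport ψ := hc.comp_homeomorph (Homeomorph.subRight v)
  have key := h.integral_eq hψ hψc (Set.subset_univ _)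
  have hψd : ∀ y, fderiv ℝ ψ y = fderiv ℝ φ (y - v) := fun y => fderiv_comp_sub v
  rw [← integral_add_right_eq_self _ v, ← integral_add_right_eq_self (fun x => g x * ψ x) v] at key
  simpa [hψd, ψ] using key

/-- Mollification commutes with weak differentiation. -/
theorem HasWeakPartialDeriv.fderiv_mollify (h : HasWeakPartialDeriv Set.univ i f g) (n : ℕ)
    (x : Plane) : fderiv ℝ (mollify n f) x (coordVec i) = mollify n g x := by
  have hf := memLpLoc_one_univ_iff.1 h.1
  set φ := (mollBump n).normed (volume : Measure Plane)
  have hφc : HasCompactSupport φ := (mollBump n).hasCompactSupport_normed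
  have hφ : ContDiff ℝ ∞ φ := (mollBump n).contDiff_normed
  have hd := hφc.hasFDerivAt_convolution_left (ContinuousLinearMap.lsmul ℝ ℝ)
    (hφ.of_le (by simp)) hf x (μ := volume)
  have hd2 : HasFDerivAt (mollify n f) _ x := hd
  rw [hd2.fderiv, mollify_apply]
  have hce : ConvolutionExistsAt (fderiv ℝ φ) f x
      ((ContinuousLinearMap.lsmul ℝ ℝ : ℝ →L[ℝ] ℝ →L[ℝ] ℝ).precompL Plane) volume :=
    (hφc.fderiv ℝ).convolutionExists_left _ (hφ.continuous_fderiv (by simp)) hf x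
  have e1 : (convolution (fderiv ℝ φ) f
      ((ContinuousLinearMap.lsmul ℝ ℝ : ℝ →L[ℝ] ℝ →L[ℝ] ℝ).precompL Plane) volume x)
        (coordVec i) = ∫ t, fderiv ℝ φ t (coordVec i) * f (x - t) := by
    unfold convolution
    rw [ContinuousLinearMap.integral_apply hce]
    rfl
  rw [e1]
  -- The reflected, translated kernel is the test function; its derivative carries a sign that
  -- cancels the one in the weak formulation.
  set ψ : Plane → ℝ := fun y => φ (x - y)
  have hψ : ContDiff ℝ ∞ ψ := hφ.comp (contDiff_const.sub contDiff_id)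
  have hψc : HasCompactSupport ψ := hφc.comp_homeomorph (Homeomorph.subLeft x)
  have hψd : ∀ y, fderiv ℝ ψ y (coordVec i) = -fderiv ℝ φ (x - y) (coordVec i) := by
    intro y
    have h1 : HasFDerivAt ψ ((fderiv ℝ φ (x - y)).comp (-ContinuousLinearMap.id ℝ Plane)) y :=
      ((hφ.differentiable (by simp) (x - y)).hasFDerivAt).comp y
        ((hasFDerivAt_id y).const_sub x)
    rw [h1.fderiv]; simp
  have key := h.integral_eq hψ hψc (Set.subset_univ _)
  simp_rw [hψd] at key
  rw [← integral_sub_left_eq_self _ volume x]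
  rw [← integral_sub_left_eq_self (fun t => φ t • g (x - t)) volume x]
  simp only [sub_sub_cancel, smul_eq_mul]
  simp only [mul_neg, integral_neg, neg_inj] at key
  simpa [mul_comm, ψ] using key

end WeakDerivatives

/-! ### Null Lagrangians and translation estimates in L². -/

section LTwo

theorem tendsto_integral_mul_of_tendsto_eLpNorm {α : Type*} [MeasurableSpace α] {μ : Measure α}
    {g h : α → ℝ} {H : ℕ → α → ℝ} (hg : MemLp g 2 μ) (hh : MemLp h 2 μ)
    (hH : ∀ n, MemLp (H n) 2 μ)
    (hlim : Tendsto (fun n => eLpNorm (H n - h) 2 μ) atTop (𝓝 0)) :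
    Tendsto (fun n => ∫ x, g x * H n x ∂μ) atTop (𝓝 (∫ x, g x * h x ∂μ)) := by
  refine tendsto_integral_of_L1' _ (hg.integrable_mul hh).1
    (Eventually.of_forall fun n => hg.integrable_mul (hH n)) ?_
  have hb : Tendsto (fun n => eLpNorm g 2 μ * eLpNorm (H n - h) 2 μ) atTop (𝓝 0) := by
    simpa using ENNReal.Tendsto.const_mul hlim (Or.inr hg.2.ne)
  refine tendsto_of_tendsto_of_tendsto_of_le_of_le tendsto_const_nhds hb (fun _ => zero_le) ?_
  intro n
  have e : (fun x => g x * H n x) - g * h = g • (H n - h) := by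
    ext x; simp [mul_sub]
  simp only
  rw [e]
  exact eLpNorm_smul_le_mul_eLpNorm ((hH n).sub hh).1 hg.1

variable {f : Plane → ℝ} {g : Fin 2 → Plane → ℝ}

theorem fderiv_fderiv_coord_comm {φ : Plane → ℝ} (hφ : ContDiff ℝ ∞ φ) (i j : Fin 2) (x : Plane) :
    fderiv ℝ (fun y => fderiv ℝ φ y (coordVec i)) x (coordVec j) =
      fderiv ℝ (fun y => fderiv ℝ φ y (coordVec j)) x (coordVec i) := by
  have hd : DifferentiableAt ℝ (fderiv ℝ φ) x :=
    ((hφ.fderiv_right (m := ∞) (by simp)).differentiable (by simp)) x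
  have h1 : ∀ i j, fderiv ℝ (fun y => fderiv ℝ φ y (coordVec i)) x (coordVec j) =
      fderiv ℝ (fderiv ℝ φ) x (coordVec j) (coordVec i) := by
    intro i j
    rw [fderiv_clm_apply hd (differentiableAt_const _)]
    simp
  rw [h1, h1]
  exact (hφ.contDiffAt.isSymmSndFDerivAt (by
    simp only [minSmoothness_of_isRCLikeNormedField]
    exact WithTop.coe_le_coe.2 (le_top : (2 : ℕ∞) ≤ ⊤))) _ _

/-- The Jacobian determinant of two `H¹` functions, one of them compactly supported, has zero
integral. -/
theorem integral_jacobian_eq_zero {f' : Plane → ℝ} {g' : Fin 2 → Plane → ℝ}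
    (hg : ∀ i, MemLp (g i) 2) (hfg : ∀ i, HasWeakPartialDeriv Set.univ i f (g i))
    (hf'c : HasCompactSupport f') (hg' : ∀ i, MemLp (g' i) 2)
    (hfg' : ∀ i, HasWeakPartialDeriv Set.univ i f' (g' i)) :
    ∫ x, (g 0 x * g' 1 x - g 1 x * g' 0 x) = 0 := by
  have hf' := memLpLoc_one_univ_iff.1 (hfg' 0).1
  have hsm : ∀ n, ContDiff ℝ ∞ (mollify n f') := fun n => mollify_contDiff hf' n
  have hcs : ∀ n, HasCompactSupport (mollify n f') := mollify_hasCompactSupport hf'c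
  have hm : ∀ n i, MemLp (mollify n (g' i)) 2 := fun n i =>
    mollify_memLp (by norm_num) (by norm_num) (hg' i) n
  -- Only the compactly supported factor is mollified: its first derivatives become test functions
  -- for `f`, and the two terms agree by symmetry of its second derivatives.
  have key : ∀ n, ∫ x, g 0 x * mollify n (g' 1) x = ∫ x, g 1 x * mollify n (g' 0) x := by
    intro n
    have e : ∀ i j, ∫ x, g i x * mollify n (g' j) x =
        -∫ x, f x * fderiv ℝ (fun y => fderiv ℝ (mollify n f') y (coordVec j)) x (coordVec i) := by
      intro i j
      rw [(hfg i).integral_eq (contDiff_fderiv_coord (hsm n) j)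
        (hasCompactSupport_fderiv_coord (hcs n) j) (Set.subset_univ _), neg_neg]
      simp_rw [(hfg' j).fderiv_mollify n]
    rw [e, e]
    simp_rw [fderiv_fderiv_coord_comm (hsm n) 1 0]
  have lim : ∀ i j, Tendsto (fun n => ∫ x, g i x * mollify n (g' j) x) atTop
      (𝓝 (∫ x, g i x * g' j x)) := fun i j =>
    tendsto_integral_mul_of_tendsto_eLpNorm (hg i) (hg' j) (fun n => hm n j)
      (tendsto_eLpNorm_mollify_sub (by norm_num) (by norm_num) (hg' j))
  have := tendsto_nhds_unique (lim 0 1) (by simpa only [key] using lim 1 0)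
  refine (integral_sub ((hg 0).integrable_mul (hg' 1)) ((hg 1).integrable_mul (hg' 0))).trans ?_
  exact sub_eq_zero.2 this

theorem fderiv_apply_eq_coord (φ : Plane → ℝ) (x v : Plane) :
    fderiv ℝ φ x v = v 0 * fderiv ℝ φ x (coordVec 0) + v 1 * fderiv ℝ φ x (coordVec 1) := by
  have : v = v 0 • coordVec 0 + v 1 • coordVec 1 := by
    ext i; fin_cases i <;> simp [coordVec]
  conv_lhs => rw [this]
  simp only [map_add, map_smul, smul_eq_mul]

/-- The increment is the integral of the directional derivative along a segment. Jensen on the unit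
interval and Tonelli reduce it to integrals over the sets `A + t v`, all contained in `B`. -/
theorem eLpNorm_translate_sub_le_of_contDiff {φ : Plane → ℝ} (hφ : ContDiff ℝ ∞ φ) (v : Plane)
    {A B : Set Plane} (hA : MeasurableSet A) (hB : MeasurableSet B)
    (hAB : ∀ x ∈ A, ∀ t ∈ Set.Icc (0 : ℝ) 1, x + t • v ∈ B) :
    eLpNorm (fun x => φ (x + v) - φ x) 2 (volume.restrict A) ≤
      eLpNorm (fun x => fderiv ℝ φ x v) 2 (volume.restrict B) := by
  have hDc : Continuous fun x => fderiv ℝ φ x v :=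
    (hφ.continuous_fderiv (by simp)).clm_apply continuous_const
  set I := (volume : Measure ℝ).restrict (Set.Ioc 0 1)
  have hI : IsProbabilityMeasure I := ⟨by simp [I]⟩
  have hpt : ∀ x, ‖φ (x + v) - φ x‖ₑ ^ (2 : ℝ) ≤
      ∫⁻ t, ‖fderiv ℝ φ (x + t • v) v‖ₑ ^ (2 : ℝ) ∂I := by
    intro x
    have hcont : Continuous fun t : ℝ => fderiv ℝ φ (x + t • v) v :=
      hDc.comp (by fun_prop)
    have hftc : φ (x + v) - φ x = ∫ t in (0 : ℝ)..1, fderiv ℝ φ (x + t • v) v := by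
      have hder : ∀ t ∈ Set.uIcc (0 : ℝ) 1,
          HasDerivAt (fun t : ℝ => φ (x + t • v)) (fderiv ℝ φ (x + t • v) v) t := by
        intro t _
        have h1 : HasDerivAt (fun t : ℝ => x + t • v) v t := by
          simpa using ((hasDerivAt_id t).smul_const v).const_add x
        exact (hφ.differentiable (by simp) _).hasFDerivAt.comp_hasDerivAt t h1
      rw [intervalIntegral.integral_eq_sub_of_hasDerivAt hder (hcont.intervalIntegrable _ _)]
      simp
    rw [hftc, intervalIntegral.integral_of_le zero_le_one]
    have h1 : ‖∫ t, fderiv ℝ φ (x + t • v) v ∂I‖ₑ ≤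
        eLpNorm (fun t : ℝ => fderiv ℝ φ (x + t • v) v) 2 I := by
      refine (enorm_integral_le_lintegral_enorm _).trans ?_
      rw [← eLpNorm_one_eq_lintegral_enorm]
      exact eLpNorm_le_eLpNorm_of_exponent_le (by norm_num) hcont.aestronglyMeasurable
    rw [eLpNorm_eq_lintegral_rpow_enorm_toReal (by norm_num) (by norm_num)] at h1
    refine (ENNReal.rpow_le_rpow h1 (by norm_num)).trans (le_of_eq ?_)
    rw [← ENNReal.rpow_mul]
    norm_num
  rw [eLpNorm_eq_lintegral_rpow_enorm_toReal (by norm_num) (by norm_num),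
    eLpNorm_eq_lintegral_rpow_enorm_toReal (by norm_num) (by norm_num)]
  refine ENNReal.rpow_le_rpow ?_ (by norm_num)
  simp only [ENNReal.toReal_ofNat]
  have hFm : Measurable fun x => ‖fderiv ℝ φ x v‖ₑ ^ (2 : ℝ) :=
    hDc.measurable.enorm.pow_const _
  calc ∫⁻ x in A, ‖φ (x + v) - φ x‖ₑ ^ (2 : ℝ)
      ≤ ∫⁻ x in A, ∫⁻ t, ‖fderiv ℝ φ (x + t • v) v‖ₑ ^ (2 : ℝ) ∂I := lintegral_mono hpt
    _ = ∫⁻ t, ∫⁻ x in A, ‖fderiv ℝ φ (x + t • v) v‖ₑ ^ (2 : ℝ) ∂volume ∂I := by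
        refine lintegral_lintegral_swap (Measurable.aemeasurable ?_)
        exact hFm.comp (by fun_prop)
    _ ≤ ∫⁻ _, ∫⁻ x in B, ‖fderiv ℝ φ x v‖ₑ ^ (2 : ℝ) ∂volume ∂I := by
        refine lintegral_mono_ae ?_
        filter_upwards [ae_restrict_mem measurableSet_Ioc] with t ht
        rw [← lintegral_indicator hA, ← lintegral_indicator hB,
          ← lintegral_add_right_eq_self (B.indicator _) (t • v)]
        refine lintegral_mono fun x => ?_
        by_cases hx : x ∈ A
        · rw [Set.indicator_of_mem hx, Set.indicator_of_mem (hAB x hx t ⟨ht.1.le, ht.2⟩)]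
        · rw [Set.indicator_of_notMem hx]; exact zero_le
    _ = _ := by simp

/-- The finite difference of an `H¹` function is controlled by its directional derivative. -/
theorem eLpNorm_translate_sub_le (hf : MemLp f 2) (hg : ∀ i, MemLp (g i) 2)
    (hfg : ∀ i, HasWeakPartialDeriv Set.univ i f (g i)) (v : Plane)
    {A B : Set Plane} (hA : MeasurableSet A) (hB : MeasurableSet B)
    (hAB : ∀ x ∈ A, ∀ t ∈ Set.Icc (0 : ℝ) 1, x + t • v ∈ B) :
    eLpNorm (fun x => f (x + v) - f x) 2 (volume.restrict A) ≤
      eLpNorm (fun x => v 0 * g 0 x + v 1 * g 1 x) 2 (volume.restrict B) := by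
  have hfl := hf.locallyIntegrable (by norm_num)
  set F : ℕ → Plane → ℝ := fun n => mollify n f
  have hF : ∀ n, MemLp (F n) 2 := fun n => mollify_memLp (by norm_num) (by norm_num) hf n
  have hG : ∀ n i, MemLp (mollify n (g i)) 2 := fun n i =>
    mollify_memLp (by norm_num) (by norm_num) (hg i) n
  have hFlim := tendsto_eLpNorm_mollify_sub (p := 2) (by norm_num) (by norm_num) hf
  have hGlim := fun i => tendsto_eLpNorm_mollify_sub (p := 2) (by norm_num) (by norm_num) (hg i)
  have htr : ∀ {k : Plane → ℝ}, MemLp k 2 → MemLp (fun x => k (x + v)) 2 ∧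
      eLpNorm (fun x => k (x + v)) 2 volume = eLpNorm k 2 volume := by
    intro k hk
    have hmp := measurePreserving_add_right (volume : Measure Plane) v
    exact ⟨hk.comp_measurePreserving hmp, eLpNorm_comp_measurePreserving hk.1 hmp⟩
  have hD : ∀ n, (fun x => fderiv ℝ (F n) x v) =
      fun x => v 0 * mollify n (g 0) x + v 1 * mollify n (g 1) x := by
    intro n; ext x
    rw [fderiv_apply_eq_coord, (hfg 0).fderiv_mollify, (hfg 1).fderiv_mollify]
  set T := eLpNorm (fun x => v 0 * g 0 x + v 1 * g 1 x) 2 (volume.restrict B)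
  -- The smooth inequality holds for the mollification; the errors made in replacing `f` and its
  -- gradient are global L² norms that tend to zero.
  have hbound : ∀ n, eLpNorm (fun x => f (x + v) - f x) 2 (volume.restrict A) ≤
      eLpNorm (F n - f) 2 volume + (T + (‖v 0‖ₑ * eLpNorm (mollify n (g 0) - g 0) 2 volume +
        ‖v 1‖ₑ * eLpNorm (mollify n (g 1) - g 1) 2 volume)) + eLpNorm (F n - f) 2 volume := by
    intro n
    have e : (fun x => f (x + v) - f x) = (fun x => (f - F n) (x + v)) +
        (fun x => F n (x + v) - F n x) + (F n - f) := by
      ext x; simp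
    have e2 : (fun x => v 0 * mollify n (g 0) x + v 1 * mollify n (g 1) x) =
        (fun x => v 0 * g 0 x + v 1 * g 1 x) +
        ((v 0 • (mollify n (g 0) - g 0)) + (v 1 • (mollify n (g 1) - g 1))) := by
      ext x; simp only [Pi.add_apply, Pi.smul_apply, Pi.sub_apply, smul_eq_mul]; ring
    have m1 := (htr (hf.sub (hF n))).1
    have m2 : MemLp (fun x => F n (x + v) - F n x) 2 := (htr (hF n)).1.sub (hF n)
    have m3 := (hF n).sub hf
    have m4 : MemLp (fun x => v 0 * g 0 x + v 1 * g 1 x) 2 :=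
      ((hg 0).const_mul _).add ((hg 1).const_mul _)
    have m5 := ((hG n 0).sub (hg 0)).const_smul (v 0)
    have m6 := ((hG n 1).sub (hg 1)).const_smul (v 1)
    rw [e]
    refine (eLpNorm_add_le (m1.add m2).1.restrict m3.1.restrict (by norm_num)).trans ?_
    refine add_le_add ?_ (eLpNorm_restrict_le _ _ _ _)
    · refine (eLpNorm_add_le m1.1.restrict m2.1.restrict (by norm_num)).trans ?_
      gcongr
      · refine (eLpNorm_restrict_le _ _ _ _).trans ?_
        rw [(htr (hf.sub (hF n))).2, eLpNorm_sub_comm]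
      · refine (eLpNorm_translate_sub_le_of_contDiff (mollify_contDiff hfl n) v hA hB hAB).trans ?_
        rw [hD n, e2]
        refine (eLpNorm_add_le m4.1.restrict (m5.add m6).1.restrict (by norm_num)).trans ?_
        gcongr
        refine (eLpNorm_restrict_le _ _ _ _).trans ?_
        refine (eLpNorm_add_le m5.1 m6.1 (by norm_num)).trans ?_
        rw [eLpNorm_const_smul, eLpNorm_const_smul]
  have c0 := ENNReal.Tendsto.const_mul (a := ‖v 0‖ₑ) (hGlim 0) (Or.inr (enorm_ne_top (x := v 0)))
  have c1 := ENNReal.Tendsto.const_mul (a := ‖v 1‖ₑ) (hGlim 1) (Or.inr (enorm_ne_top (x := v 1)))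
  have := (hFlim.add ((tendsto_const_nhds (x := T)).add (c0.add c1))).add hFlim
  simp only [mul_zero, add_zero, zero_add] at this
  exact ge_of_tendsto' this hbound

/-- The Dirichlet energy density. -/
def gradSq (g : Fin 2 → Plane → ℝ) (x : Plane) : ℝ := g 0 x ^ 2 + g 1 x ^ 2

theorem gradSq_nonneg (g : Fin 2 → Plane → ℝ) (x : Plane) : 0 ≤ gradSq g x := by
  unfold gradSq; positivity

theorem integrable_gradSq (hg : ∀ i, MemLp (g i) 2) : Integrable (gradSq g) :=
  (hg 0).integrable_sq.add (hg 1).integrable_sq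

theorem setIntegral_translate_sub_sq_le (hf : MemLp f 2) (hg : ∀ i, MemLp (g i) 2)
    (hfg : ∀ i, HasWeakPartialDeriv Set.univ i f (g i)) (v : Plane)
    {A B : Set Plane} (hA : MeasurableSet A) (hB : MeasurableSet B)
    (hAB : ∀ x ∈ A, ∀ t ∈ Set.Icc (0 : ℝ) 1, x + t • v ∈ B) :
    ∫ x in A, (f (x + v) - f x) ^ 2 ≤ ‖v‖ ^ 2 * ∫ x in B, gradSq g x := by
  have htr : MemLp (fun x => f (x + v)) 2 :=
    hf.comp_measurePreserving (measurePreserving_add_right (volume : Measure Plane) v)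
  have m1 : MemLp (fun x => f (x + v) - f x) 2 (volume.restrict A) := (htr.sub hf).restrict A
  have m2 : MemLp (fun x => v 0 * g 0 x + v 1 * g 1 x) 2 (volume.restrict B) :=
    (((hg 0).const_mul _).add ((hg 1).const_mul _)).restrict B
  have h := eLpNorm_translate_sub_le hf hg hfg v hA hB hAB
  have hconv : ∀ {k : Plane → ℝ} {μ : Measure Plane}, MemLp k 2 μ →
      ∫ x, k x ^ 2 ∂μ = (eLpNorm k 2 μ).toReal ^ 2 := by
    intro k μ hk
    rw [hk.eLpNorm_eq_integral_rpow_norm (by norm_num) (by norm_num)]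
    simp only [ENNReal.toReal_ofNat, Real.rpow_ofNat, Real.norm_eq_abs, sq_abs]
    have hnn : 0 ≤ ∫ x, k x ^ 2 ∂μ := integral_nonneg fun x => sq_nonneg _
    rw [ENNReal.toReal_ofReal (by positivity), ← Real.rpow_natCast, ← Real.rpow_mul hnn]
    norm_num
  have hv : ‖v‖ ^ 2 = v 0 ^ 2 + v 1 ^ 2 := by
    rw [EuclideanSpace.norm_sq_eq]; simp [Fin.sum_univ_two]
  calc ∫ x in A, (f (x + v) - f x) ^ 2
      ≤ ∫ x in B, (v 0 * g 0 x + v 1 * g 1 x) ^ 2 := by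
        rw [hconv m1, hconv m2]
        exact pow_le_pow_left₀ ENNReal.toReal_nonneg (ENNReal.toReal_mono m2.2.ne h) 2
    _ ≤ ∫ x in B, ‖v‖ ^ 2 * gradSq g x := by
        refine integral_mono m2.integrable_sq
          ((integrable_gradSq hg).integrableOn.const_mul _) fun x => ?_
        simp only [gradSq, hv]
        nlinarith [sq_nonneg (v 0 * g 1 x - v 1 * g 0 x)]
    _ = _ := integral_const_mul _ _

end LTwo

/-! ### A Poincaré inequality on balls. -/

section Poincare

variable {f : Plane → ℝ} {g : Fin 2 → Plane → ℝ}

theorem volume_ball_two_mul (y : Plane) {R : ℝ} (hR : 0 < R) :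
    volume (Metric.ball (0 : Plane) (2 * R)) = 4 * volume (Metric.ball y R) := by
  rw [Measure.addHaar_ball volume (0 : Plane) (by positivity),
    Measure.addHaar_ball volume y hR.le, ← mul_assoc]
  congr 1
  rw [finrank_euclideanSpace, Fintype.card_fin, mul_pow, ENNReal.ofReal_mul (by positivity)]
  norm_num

/-- The constant is a value `f z` at a point that does no worse than average. Substituting `z = x +
h` in the double integral over the ball leaves translations with `|h| < 2R`, each costing at most
`4R²` times the energy; the volume ratio between the balls of radii `2R` and `R` contributes the
other factor 4. -/
theorem exists_setLIntegral_sub_sq_le (hfm : Measurable f) (hf : MemLp f 2)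
    (hg : ∀ i, MemLp (g i) 2) (hfg : ∀ i, HasWeakPartialDeriv Set.univ i f (g i)) (y : Plane)
    {R : ℝ} (hR : 0 < R) :
    ∃ c, ∫⁻ x in Metric.ball y R, ENNReal.ofReal ((f x - c) ^ 2) ≤
      ENNReal.ofReal (16 * R ^ 2 * ∫ x in Metric.ball y (3 * R), gradSq g x) := by
  set B := Metric.ball y R
  have hBm : MeasurableSet B := Metric.isOpen_ball.measurableSet
  set D := ∫ x in Metric.ball y (3 * R), gradSq g x
  have hD : 0 ≤ D := integral_nonneg (gradSq_nonneg g)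
  set Ψ : Plane → ℝ≥0∞ := fun z => ∫⁻ x in B, ENNReal.ofReal ((f x - f z) ^ 2)
  have hjm : Measurable fun p : Plane × Plane => ENNReal.ofReal ((f p.1 - f p.2) ^ 2) :=
    (((hfm.comp measurable_fst).sub (hfm.comp measurable_snd)).pow_const 2).ennreal_ofReal
  have hΨm : Measurable Ψ := Measurable.lintegral_prod_left' (μ := volume.restrict B) hjm
  have hjm2 : Measurable fun p : Plane × Plane => ENNReal.ofReal ((f p.1 - f (p.1 + p.2)) ^ 2) :=
    (((hfm.comp measurable_fst).sub (hfm.comp (measurable_fst.add measurable_snd))).pow_const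
      2).ennreal_ofReal
  have h1 : ∫⁻ z in B, Ψ z ≤
      ∫⁻ h in Metric.ball (0 : Plane) (2 * R), ∫⁻ x in B,
        ENNReal.ofReal ((f x - f (x + h)) ^ 2) := by
    calc ∫⁻ z in B, Ψ z = ∫⁻ x in B, ∫⁻ z in B, ENNReal.ofReal ((f x - f z) ^ 2) :=
          (lintegral_lintegral_swap hjm.aemeasurable).symm
      _ ≤ ∫⁻ x in B, ∫⁻ h in Metric.ball (0 : Plane) (2 * R),
            ENNReal.ofReal ((f x - f (x + h)) ^ 2) := by
          refine lintegral_mono_ae ?_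
          filter_upwards [ae_restrict_mem hBm] with x hx
          rw [← lintegral_indicator hBm, ← lintegral_indicator Metric.isOpen_ball.measurableSet,
            ← lintegral_add_left_eq_self (B.indicator _) x]
          refine lintegral_mono fun h => ?_
          by_cases hxh : x + h ∈ B
          · have : h ∈ Metric.ball (0 : Plane) (2 * R) := by
              have e : h = (x + h) - x := by abel
              rw [mem_ball_zero_iff, e, ← dist_eq_norm]
              calc dist (x + h) x ≤ dist (x + h) y + dist y x := dist_triangle _ _ _
                _ < R + R := add_lt_add hxh (by rw [dist_comm]; exact hx)
                _ = 2 * R := by ring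
            rw [Set.indicator_of_mem hxh, Set.indicator_of_mem this]
          · rw [Set.indicator_of_notMem hxh]; exact zero_le
      _ = _ := lintegral_lintegral_swap hjm2.aemeasurable
  have h2 : ∫⁻ h in Metric.ball (0 : Plane) (2 * R), ∫⁻ x in B,
        ENNReal.ofReal ((f x - f (x + h)) ^ 2) ≤
      ∫⁻ h in Metric.ball (0 : Plane) (2 * R), ENNReal.ofReal ((2 * R) ^ 2 * D) := by
    refine lintegral_mono_ae ?_
    filter_upwards [ae_restrict_mem Metric.isOpen_ball.measurableSet] with h hh
    rw [mem_ball_zero_iff] at hh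
    have htr : MemLp (fun x => f (x + h)) 2 :=
      hf.comp_measurePreserving (measurePreserving_add_right (volume : Measure Plane) h)
    have hint : Integrable (fun x => (f x - f (x + h)) ^ 2) := (hf.sub htr).integrable_sq
    rw [← ofReal_integral_eq_lintegral_ofReal hint.integrableOn
      (Eventually.of_forall fun x => sq_nonneg _)]
    refine ENNReal.ofReal_le_ofReal ?_
    have hkey := setIntegral_translate_sub_sq_le hf hg hfg h hBm
      (B := Metric.ball y (3 * R)) Metric.isOpen_ball.measurableSet fun x hx t ht => by
        rw [Metric.mem_ball]
        calc dist (x + t • h) y ≤ dist (x + t • h) x + dist x y := dist_triangle _ _ _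
          _ < 2 * R + R := by
            refine add_lt_add_of_le_of_lt ?_ hx
            rw [dist_eq_norm, add_sub_cancel_left, norm_smul, Real.norm_of_nonneg ht.1]
            exact (mul_le_of_le_one_left (norm_nonneg _) ht.2).trans hh.le
          _ = 3 * R := by ring
    have e : ∀ x, (f x - f (x + h)) ^ 2 = (f (x + h) - f x) ^ 2 := fun x => by ring
    simp_rw [e]
    refine hkey.trans ?_
    gcongr
  have hB0 : volume B ≠ 0 := (Metric.measure_ball_pos volume y hR).ne'
  have hBt : volume B ≠ ⊤ := measure_ball_lt_top.ne
  obtain ⟨z, -, hz⟩ := exists_le_setLAverage hB0 hBt hΨm.aemeasurable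
  refine ⟨f z, hz.trans ?_⟩
  rw [setLAverage_eq]
  refine ENNReal.div_le_of_le_mul ((h1.trans h2).trans (le_of_eq ?_))
  rw [lintegral_const, Measure.restrict_apply_univ, volume_ball_two_mul y hR, ← mul_assoc]
  congr 1
  rw [mul_comm, show (16 : ℝ) * R ^ 2 * D = 4 * ((2 * R) ^ 2 * D) by ring,
    ENNReal.ofReal_mul (by norm_num : (0 : ℝ) ≤ 4)]
  norm_num

/-- The mean minimises the quadratic deviation, because the cross term integrates to zero. -/
theorem setIntegral_sub_average_sq_le {s : Set Plane} (hs0 : volume s ≠ 0) (hst : volume s ≠ ⊤)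
    (hf : MemLp f 2) (c : ℝ) :
    ∫ x in s, (f x - ⨍ z in s, f z) ^ 2 ≤ ∫ x in s, (f x - c) ^ 2 := by
  have : IsFiniteMeasure (volume.restrict s) := ⟨by
    rw [Measure.restrict_apply_univ]; exact hst.lt_top⟩
  set a := ⨍ z in s, f z
  have hfs : MemLp f 2 (volume.restrict s) := hf.restrict s
  have hfi : Integrable f (volume.restrict s) := hfs.integrable (by norm_num)
  have ha : ∫ x in s, (f x - a) = 0 := by
    rw [integral_sub hfi (integrable_const _), integral_const, measureReal_restrict_apply_univ]
    simp only [a, setAverage_eq, smul_eq_mul]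
    have : volume.real s ≠ 0 := by
      simp [measureReal_def, ENNReal.toReal_eq_zero_iff, hs0, hst]
    field_simp
    ring
  have i1 : Integrable (fun x => (f x - a) ^ 2) (volume.restrict s) :=
    (hfs.sub (memLp_const a)).integrable_sq
  have i2 : Integrable (fun x => 2 * (a - c) * (f x - a)) (volume.restrict s) :=
    (hfi.sub (integrable_const _)).const_mul _
  have e : ∀ x, (f x - c) ^ 2 = (f x - a) ^ 2 + 2 * (a - c) * (f x - a) + (a - c) ^ 2 :=
    fun x => by ring
  simp_rw [e]
  rw [integral_add (f := fun x => (f x - a) ^ 2 + 2 * (a - c) * (f x - a)) (i1.add i2)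
    (integrable_const _), integral_add i1 i2, integral_const_mul, ha,
    mul_zero, add_zero]
  exact le_add_of_nonneg_right (integral_nonneg fun _ => sq_nonneg _)

/-- A Poincaré inequality on balls, with the energy taken over a larger concentric ball. -/
theorem setIntegral_sub_average_sq_le_gradSq (hf : MemLp f 2)
    (hg : ∀ i, MemLp (g i) 2) (hfg : ∀ i, HasWeakPartialDeriv Set.univ i f (g i)) (y : Plane)
    {R : ℝ} (hR : 0 < R) :
    ∫ x in Metric.ball y R, (f x - ⨍ z in Metric.ball y R, f z) ^ 2 ≤
      16 * R ^ 2 * ∫ x in Metric.ball y (3 * R), gradSq g x := by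
  obtain ⟨f', hf'm, hff'⟩ := hf.1
  have hf' : MemLp f' 2 := (memLp_congr_ae hff').1 hf
  obtain ⟨c, hc⟩ := exists_setLIntegral_sub_sq_le hf'm.measurable hf' hg
    (fun i => (hfg i).congr_ae (hff'.mono fun x hx _ => hx) (Eventually.of_forall fun _ _ => rfl))
    y hR
  have hB0 : volume (Metric.ball y R) ≠ 0 := (Metric.measure_ball_pos volume y hR).ne'
  have hBt : volume (Metric.ball y R) ≠ ⊤ := measure_ball_lt_top.ne
  refine (setIntegral_sub_average_sq_le hB0 hBt hf c).trans ?_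
  have : IsFiniteMeasure (volume.restrict (Metric.ball y R)) := ⟨by
    rw [Measure.restrict_apply_univ]; exact hBt.lt_top⟩
  have hint : Integrable (fun x => (f' x - c) ^ 2) (volume.restrict (Metric.ball y R)) :=
    ((hf'.restrict _).sub (memLp_const c)).integrable_sq
  have e : ∫ x in Metric.ball y R, (f x - c) ^ 2 = ∫ x in Metric.ball y R, (f' x - c) ^ 2 :=
    integral_congr_ae (ae_restrict_of_ae (hff'.mono fun x hx => by simp only [hx]))
  rw [e]
  rw [← ofReal_integral_eq_lintegral_ofReal hint (Eventually.of_forall fun x => sq_nonneg _)] at hc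
  exact (ENNReal.ofReal_le_ofReal_iff
    (mul_nonneg (by positivity) (integral_nonneg (gradSq_nonneg g)))).1 hc

end Poincare

/-! ### Weak derivatives from bounded difference quotients. -/

section DifferenceQuotients

variable {f : Plane → ℝ}

/-- A change of variables moves the difference quotient onto `φ`, where it converges pointwise and
is dominated by a Lipschitz constant. -/
theorem tendsto_integral_diffQuot_mul (hf : Integrable f) {φ : Plane → ℝ} (hφ : ContDiff ℝ ∞ φ)
    (hc : HasCompactSupport φ) (i : Fin 2) {t : ℕ → ℝ} (ht : Tendsto t atTop (𝓝 0))
    (ht0 : ∀ n, t n ≠ 0) :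
    Tendsto (fun n => ∫ x, (f (x + t n • coordVec i) - f x) / t n * φ x) atTop
      (𝓝 (-∫ x, f x * fderiv ℝ φ x (coordVec i))) := by
  obtain ⟨L, hL⟩ := hφ.lipschitzWith_of_hasCompactSupport hc (by simp)
  obtain ⟨M, hM⟩ := hc.exists_bound_of_continuous hφ.continuous
  have hmul : ∀ {k : Plane → ℝ}, Integrable k → Integrable fun x => k x * φ x := fun hk =>
    hk.mul_bdd (c := M) hφ.continuous.aestronglyMeasurable (Eventually.of_forall hM)
  have hmul' : ∀ v : Plane, Integrable fun x => f x * φ (x - v) := fun v =>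
    hf.mul_bdd (c := M) (hφ.continuous.comp (by fun_prop)).aestronglyMeasurable
      (Eventually.of_forall fun x => hM _)
  have e : ∀ n, ∫ x, (f (x + t n • coordVec i) - f x) / t n * φ x =
      ∫ x, f x * ((φ (x - t n • coordVec i) - φ x) / t n) := by
    intro n
    set v := t n • coordVec i
    have h1 : ∫ x, f (x + v) * φ x = ∫ x, f x * φ (x - v) := by
      rw [← integral_sub_right_eq_self _ v]; simp
    have e1 : ∀ x, (f (x + v) - f x) / t n * φ x = (t n)⁻¹ * (f (x + v) * φ x - f x * φ x) :=
      fun x => by field_simp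
    have e2 : ∀ x, f x * ((φ (x - v) - φ x) / t n) =
        (t n)⁻¹ * (f x * φ (x - v) - f x * φ x) := fun x => by field_simp
    simp_rw [e1, e2]
    rw [integral_const_mul, integral_const_mul,
      integral_sub (hmul (hf.comp_add_right v)) (hmul hf), integral_sub (hmul' v) (hmul hf), h1]
  simp_rw [e]
  rw [← integral_neg]
  refine tendsto_integral_of_dominated_convergence (fun x => ‖f x‖ * L) (fun n => ?_)
    (hf.norm.mul_const _) (fun n => Eventually.of_forall fun x => ?_)
    (Eventually.of_forall fun x => ?_)
  · exact hf.1.mul (Continuous.aestronglyMeasurable (by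
      have := hφ.continuous; fun_prop))
  · rw [norm_mul, norm_div]
    refine mul_le_mul_of_nonneg_left ?_ (norm_nonneg _)
    rw [div_le_iff₀ (norm_pos_iff.2 (ht0 n)), ← dist_eq_norm]
    refine (hL.dist_le_mul _ _).trans (le_of_eq ?_)
    rw [dist_eq_norm, sub_sub_cancel_left, norm_neg, norm_smul]
    simp [coordVec]
  · rw [← mul_neg]
    refine Tendsto.const_mul _ ?_
    have hd : HasDerivAt (fun s : ℝ => φ (x - s • coordVec i)) (-fderiv ℝ φ x (coordVec i)) 0 := by
      have h1 : HasDerivAt (fun s : ℝ => x - s • coordVec i) (-coordVec i) 0 := by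
        simpa using ((hasDerivAt_id (0 : ℝ)).smul_const (coordVec i)).const_sub x
      have h2 : HasFDerivAt φ (fderiv ℝ φ x) (x - (0 : ℝ) • coordVec i) := by
        simpa using (hφ.differentiable (by simp) x).hasFDerivAt
      have h3 := h2.comp_hasDerivAt (0 : ℝ) h1
      rw [map_neg] at h3
      exact h3
    have := (hasDerivAt_iff_tendsto_slope.1 hd).comp
      (tendsto_nhdsWithin_iff.2 ⟨ht, Eventually.of_forall fun n => ht0 n⟩)
    refine this.congr fun n => ?_
    simp [slope_def_field]

/-- A function with bounded difference quotients in `L²` has a weak derivative in `L²`. -/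
theorem exists_weakDeriv_of_diffQuot_bounded (hf : Integrable f) (hf2 : MemLp f 2) (i : Fin 2)
    {t : ℕ → ℝ} (ht : Tendsto t atTop (𝓝 0)) (ht0 : ∀ n, t n ≠ 0) {C : ℝ}
    (hb : ∀ n, ∫ x, ((f (x + t n • coordVec i) - f x) / t n) ^ 2 ≤ C) :
    ∃ g, MemLp g 2 ∧ HasWeakPartialDeriv Set.univ i f g := by
  have hq : ∀ n, MemLp (fun x => (f (x + t n • coordVec i) - f x) / t n) 2 := fun n => by
    have htr : MemLp (fun x => f (x + t n • coordVec i)) 2 :=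
      hf2.comp_measurePreserving (measurePreserving_add_right (volume : Measure Plane) _)
    have h : MemLp (fun x => (t n)⁻¹ * (f (x + t n • coordVec i) - f x)) 2 :=
      (htr.sub hf2).const_mul (t n)⁻¹
    simpa only [div_eq_inv_mul] using h
  set u : ℕ → Lp ℝ 2 (volume : Measure Plane) := fun n => (hq n).toLp _
  have hin : ∀ n {φ : Plane → ℝ} (hφ : MemLp φ 2), inner ℝ (u n) (hφ.toLp φ) =
      ∫ x, (f (x + t n • coordVec i) - f x) / t n * φ x := by
    intro n φ hφ
    rw [L2.inner_def]
    refine integral_congr_ae ?_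
    filter_upwards [(hq n).coeFn_toLp, hφ.coeFn_toLp] with x h1 h2
    simp only [u, h1, h2]
    simp [mul_comm]
  have hnorm : ∀ n, ‖u n‖ ≤ Real.sqrt C := by
    intro n
    refine Real.le_sqrt_of_sq_le ?_
    rw [← real_inner_self_eq_norm_sq, hin n (hq n)]
    simpa only [sq] using hb n
  -- The quotients lie in a weak-* compact ball of the dual of L²; a nonprincipal ultrafilter
  -- selects a limit without extracting a subsequence.
  set U : Ultrafilter ℕ := hyperfilter ℕ
  have hUle : (U : Filter ℕ) ≤ atTop := Nat.hyperfilter_le_atTop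
  set ℓ : ℕ → WeakDual ℝ (Lp ℝ 2 (volume : Measure Plane)) := fun n =>
    StrongDual.toWeakDual (InnerProductSpace.toDual ℝ _ (u n))
  have hcomp := WeakDual.isCompact_closedBall (𝕜 := ℝ)
    (0 : StrongDual ℝ (Lp ℝ 2 (volume : Measure Plane))) (Real.sqrt C)
  obtain ⟨ℓ₀, -, hℓ⟩ := isCompact_iff_ultrafilter_le_nhds.1 hcomp (U.map ℓ) (by
    rw [le_principal_iff]
    refine Filter.mem_map.2 (Eventually.of_forall fun n => ?_)
    simpa [ℓ] using hnorm n)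
  set v := (InnerProductSpace.toDual ℝ (Lp ℝ 2 (volume : Measure Plane))).symm
    (WeakDual.toStrongDual ℓ₀)
  refine ⟨v, Lp.memLp v, hasWeakPartialDeriv_of_integral_eq
    (memLpLoc_one_univ_iff.2 hf.locallyIntegrable)
    (memLpLoc_one_univ_iff.2 ((Lp.memLp v).locallyIntegrable (by norm_num)))
    fun φ hφ hc _ => ?_⟩
  have hφ2 : MemLp φ 2 := hφ.continuous.memLp_of_hasCompactSupport hc
  have lim1 : Tendsto (fun n => inner ℝ (u n) (hφ2.toLp φ)) U (𝓝 (ℓ₀ (hφ2.toLp φ))) := by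
    have : Tendsto ℓ U (𝓝 ℓ₀) := hℓ
    exact ((WeakDual.eval_continuous (hφ2.toLp φ)).tendsto ℓ₀).comp this
  have lim2 := (tendsto_integral_diffQuot_mul hf hφ hc i ht ht0).mono_left hUle
  simp_rw [hin] at lim1
  have h1 := tendsto_nhds_unique lim1 lim2
  have h2 : ℓ₀ (hφ2.toLp φ) = inner ℝ v (hφ2.toLp φ) := by
    rw [InnerProductSpace.toDual_symm_apply]; rfl
  have h3 : inner ℝ v (hφ2.toLp φ) = ∫ x, v x * φ x := by
    rw [L2.inner_def]
    refine integral_congr_ae ?_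
    filter_upwards [hφ2.coeFn_toLp] with x h2
    rw [h2]; simp [mul_comm]
  linarith

end DifferenceQuotients

/-! ### The chain rule for C¹ functions of bounded functions. -/

section ChainRule

variable {ι : Type*} [Fintype ι]

/-- Split `A n * Y n` as `A n * X + A n * (Y n - X)`: the first part converges by dominated
convergence, the second vanishes by Hölder because `A n` is bounded in L². -/
theorem tendsto_integral_mul_of_dominated_of_tendsto_eLpNorm {α : Type*} [MeasurableSpace α]
    {μ : Measure α} {A : ℕ → α → ℝ} {a b X : α → ℝ} {Y : ℕ → α → ℝ}
    (hA : ∀ n, AEStronglyMeasurable (A n) μ) (hb : MemLp b 2 μ)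
    (hAb : ∀ n, ∀ᵐ x ∂μ, ‖A n x‖ ≤ b x)
    (hlim : ∀ᵐ x ∂μ, Tendsto (fun n => A n x) atTop (𝓝 (a x)))
    (hX : MemLp X 2 μ) (hY : ∀ n, MemLp (Y n) 2 μ)
    (hYlim : Tendsto (fun n => eLpNorm (Y n - X) 2 μ) atTop (𝓝 0)) :
    Tendsto (fun n => ∫ x, A n x * Y n x ∂μ) atTop (𝓝 (∫ x, a x * X x ∂μ)) := by
  have hA2 : ∀ n, MemLp (A n) 2 μ := fun n => hb.mono' (hA n) (hAb n)
  have l1 : Tendsto (fun n => ∫ x, A n x * X x ∂μ) atTop (𝓝 (∫ x, a x * X x ∂μ)) := by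
    refine tendsto_integral_of_dominated_convergence (fun x => b x * ‖X x‖)
      (fun n => (hA n).mul hX.1) (hb.integrable_mul hX.norm) (fun n => ?_) ?_
    · filter_upwards [hAb n] with x hx
      rw [norm_mul]
      exact mul_le_mul_of_nonneg_right hx (norm_nonneg _)
    · filter_upwards [hlim] with x hx using hx.mul_const _
  have l2 : Tendsto (fun n => ∫ x, A n x * (Y n - X) x ∂μ) atTop (𝓝 0) := by
    rw [tendsto_zero_iff_norm_tendsto_zero]
    have hC : Tendsto (fun n => (eLpNorm b 2 μ * eLpNorm (Y n - X) 2 μ).toReal) atTop (𝓝 0) := by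
      have := ENNReal.Tendsto.const_mul (a := eLpNorm b 2 μ) hYlim (Or.inr hb.2.ne)
      rw [mul_zero] at this
      exact (ENNReal.tendsto_toReal ENNReal.zero_ne_top).comp this
    refine squeeze_zero (fun _ => norm_nonneg _) (fun n => ?_) hC
    have hfin : eLpNorm b 2 μ * eLpNorm (Y n - X) 2 μ ≠ ⊤ :=
      ENNReal.mul_ne_top hb.2.ne ((hY n).sub hX).2.ne
    rw [← toReal_enorm]
    refine ENNReal.toReal_mono hfin ?_
    refine (enorm_integral_le_lintegral_enorm _).trans ?_
    rw [← eLpNorm_one_eq_lintegral_enorm]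
    have h1 : eLpNorm (A n • (Y n - X)) 1 μ ≤ eLpNorm (A n) 2 μ * eLpNorm (Y n - X) 2 μ :=
      eLpNorm_smul_le_mul_eLpNorm ((hY n).sub hX).1 (hA n)
    refine h1.trans ?_
    gcongr
    exact eLpNorm_mono_ae_real (hAb n)
  have := l1.add l2
  rw [add_zero] at this
  refine this.congr fun n => ?_
  refine (integral_add ((hA2 n).integrable_mul hX)
    ((hA2 n).integrable_mul ((hY n).sub hX))).symm.trans ?_
  refine integral_congr_ae (Eventually.of_forall fun x => ?_)
  simp only [Pi.mul_apply, Pi.sub_apply]; ring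

/-- The chain rule for a `C¹` function of bounded functions with weak derivatives in `L²`. -/
theorem HasWeakPartialDeriv.comp_contDiff {Φ : (ι → ℝ) → ℝ} (hΦ : ContDiff ℝ 1 Φ)
    {p X : ι → Plane → ℝ} {k : Fin 2} {C : ℝ} (hC : 0 ≤ C) (hpC : ∀ i, ∀ᵐ x, ‖p i x‖ ≤ C)
    (hX : ∀ i, MemLp (X i) 2) (hpX : ∀ i, HasWeakPartialDeriv Set.univ k (p i) (X i)) :
    HasWeakPartialDeriv Set.univ k (fun x => Φ fun i => p i x)
      (fun x => fderiv ℝ Φ (fun i => p i x) fun i => X i x) := by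
  classical
  have hpl : ∀ i, LocallyIntegrable (p i) := fun i => memLpLoc_one_univ_iff.1 (hpX i).1
  have hpm : AEStronglyMeasurable (fun x i => p i x) (volume : Measure Plane) :=
    (aemeasurable_pi_lambda _ fun i => (hpl i).aestronglyMeasurable.aemeasurable).aestronglyMeasurable
  have hK : IsCompact (Metric.closedBall (0 : ι → ℝ) C) := isCompact_closedBall _ _
  have hcD : Continuous (fderiv ℝ Φ) := hΦ.continuous_fderiv (by simp)
  obtain ⟨M₀, hM₀⟩ := hK.exists_bound_of_continuousOn hΦ.continuous.continuousOn
  obtain ⟨M₁, hM₁⟩ := hK.exists_bound_of_continuousOn hcD.continuousOn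
  have hpCall : ∀ᵐ x, (fun i => p i x) ∈ Metric.closedBall (0 : ι → ℝ) C := by
    filter_upwards [ae_all_iff.2 hpC] with x hx
    rw [mem_closedBall_zero_iff, pi_norm_le_iff_of_nonneg hC]
    exact hx
  have hsum : ∀ (q Y : ι → ℝ), fderiv ℝ Φ q Y = ∑ i, fderiv ℝ Φ q (Pi.single i 1) * Y i := by
    intro q Y
    have hY : Y = ∑ i, Y i • Pi.single i (1 : ℝ) := by
      ext j
      simp [Finset.sum_apply, Pi.single_apply]
    conv_lhs => rw [hY]
    simp only [map_sum, map_smul, smul_eq_mul]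
    exact Finset.sum_congr rfl fun i _ => mul_comm _ _
  have hcoef : ∀ i, AEStronglyMeasurable
      (fun x => fderiv ℝ Φ (fun i => p i x) (Pi.single i 1)) (volume : Measure Plane) := fun i =>
    (hcD.clm_apply continuous_const).comp_aestronglyMeasurable hpm
  have hcoefb : ∀ (i : ι) (q : ι → ℝ), q ∈ Metric.closedBall (0 : ι → ℝ) C →
      ‖fderiv ℝ Φ q (Pi.single i 1)‖ ≤ M₁ := by
    intro i q hq
    refine ((fderiv ℝ Φ q).le_opNorm _).trans ?_
    rw [Pi.norm_single, norm_one, mul_one]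
    exact hM₁ q hq
  have hL2 : ∀ i, MemLp (fun x => fderiv ℝ Φ (fun i => p i x) (Pi.single i 1) * X i x) 2 := by
    intro i
    refine ((hX i).const_mul M₁).mono ((hcoef i).mul (hX i).1) ?_
    filter_upwards [hpCall] with x hx
    rw [norm_mul, norm_mul]
    exact mul_le_mul_of_nonneg_right ((hcoefb i _ hx).trans (le_abs_self _)) (norm_nonneg _)
  have hΦm : AEStronglyMeasurable (fun x => Φ fun i => p i x) (volume : Measure Plane) :=
    hΦ.continuous.comp_aestronglyMeasurable hpm
  refine hasWeakPartialDeriv_of_integral_eq ?_ ?_ fun φ hφ hφc _ => ?_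
  · intro K hK' _
    have : IsFiniteMeasure (volume.restrict K) := ⟨by
      rw [Measure.restrict_apply_univ]; exact hK'.measure_lt_top⟩
    exact MemLp.of_bound hΦm.restrict M₀ (ae_restrict_of_ae (hpCall.mono fun x hx => hM₀ _ hx))
  · rw [show (fun x => fderiv ℝ Φ (fun i => p i x) fun i => X i x) = fun x =>
        ∑ i, fderiv ℝ Φ (fun i => p i x) (Pi.single i 1) * X i x from funext fun x => hsum _ _]
    exact memLpLoc_one_univ_iff.2
      ((memLp_finsetSum _ fun i _ => hL2 i).locallyIntegrable (by norm_num))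
  set q : ℕ → Plane → ι → ℝ := fun n x i => mollify n (p i) x
  have hq : ∀ n, ContDiff ℝ ∞ (q n) := fun n => contDiff_pi.2 fun i => mollify_contDiff (hpl i) n
  -- Mollification does not increase sup bounds, so all approximants take values in the compact ball
  -- on which `Φ` and its derivative are bounded.
  have hqC : ∀ n x, q n x ∈ Metric.closedBall (0 : ι → ℝ) C := fun n x => by
    rw [mem_closedBall_zero_iff, pi_norm_le_iff_of_nonneg hC]
    exact fun i => norm_mollify_le (hpC i) n x
  have hqlim : ∀ᵐ x, Tendsto (fun n => q n x) atTop (𝓝 fun i => p i x) := by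
    filter_upwards [ae_all_iff.2 fun i => ae_tendsto_mollify (hpl i)] with x hx
    exact tendsto_pi_nhds.2 hx
  have hdq : ∀ n x, fderiv ℝ (fun y => Φ (q n y)) x (coordVec k) =
      ∑ i, fderiv ℝ Φ (q n x) (Pi.single i 1) * mollify n (X i) x := by
    intro n x
    have h1 : HasFDerivAt (q n) (fderiv ℝ (q n) x) x :=
      ((hq n).differentiable (by simp) x).hasFDerivAt
    have h2 := ((hΦ.differentiable (by simp) (q n x)).hasFDerivAt).comp x h1
    have h3 : fderiv ℝ (fun y => Φ (q n y)) x = (fderiv ℝ Φ (q n x)).comp (fderiv ℝ (q n) x) :=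
      h2.fderiv
    rw [h3, ContinuousLinearMap.comp_apply, hsum]
    refine Finset.sum_congr rfl fun i _ => ?_
    congr 1
    rw [← (hpX i).fderiv_mollify n x]
    have h4 : HasFDerivAt (fun y => q n y i) _ x := (hasFDerivAt_pi'.1 h1) i
    change _ = fderiv ℝ (fun y => q n y i) x (coordVec k)
    rw [h4.fderiv]
    rfl
  have hΦq : ∀ n, ContDiff ℝ 1 fun y => Φ (q n y) := fun n => hΦ.comp ((hq n).of_le (by simp))
  have hφ2 : MemLp φ 2 := hφ.continuous.memLp_of_hasCompactSupport hφc
  have hM1 : ∀ i, ∀ n x, ‖fderiv ℝ Φ (q n x) (Pi.single i 1) * φ x‖ ≤ M₁ * ‖φ x‖ := by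
    intro i n x
    rw [norm_mul]
    exact mul_le_mul_of_nonneg_right (hcoefb i _ (hqC n x)) (norm_nonneg _)
  have hqc : ∀ n i, Continuous fun x => fderiv ℝ Φ (q n x) (Pi.single i 1) := fun n i =>
    (hcD.clm_apply continuous_const).comp (hq n).continuous
  have lhs : Tendsto (fun n => ∫ x, Φ (q n x) * fderiv ℝ φ x (coordVec k)) atTop
      (𝓝 (∫ x, Φ (fun i => p i x) * fderiv ℝ φ x (coordVec k))) := by
    have hdi : Integrable fun x => fderiv ℝ φ x (coordVec k) :=
      (continuous_fderiv_coord hφ k).integrable_of_hasCompactSupport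
        (hasCompactSupport_fderiv_coord hφc k)
    refine tendsto_integral_of_dominated_convergence
      (fun x => M₀ * ‖fderiv ℝ φ x (coordVec k)‖)
      (fun n => ((hΦq n).continuous.mul (continuous_fderiv_coord hφ k)).aestronglyMeasurable)
      (hdi.norm.const_mul _) (fun n => Eventually.of_forall fun x => ?_) ?_
    · rw [norm_mul]
      exact mul_le_mul_of_nonneg_right (hM₀ _ (hqC n x)) (norm_nonneg _)
    · filter_upwards [hqlim] with x hx
      exact ((hΦ.continuous.tendsto _).comp hx).mul_const _
  have rhs : Tendsto (fun n => ∑ i, ∫ x, fderiv ℝ Φ (q n x) (Pi.single i 1) * φ x *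
      mollify n (X i) x) atTop
      (𝓝 (∑ i, ∫ x, fderiv ℝ Φ (fun i => p i x) (Pi.single i 1) * φ x * X i x)) := by
    refine tendsto_finsetSum _ fun i _ => ?_
    refine tendsto_integral_mul_of_dominated_of_tendsto_eLpNorm
      (fun n => ((hqc n i).mul hφ.continuous).aestronglyMeasurable)
      (hφ2.norm.const_mul M₁) (fun n => Eventually.of_forall (hM1 i n)) ?_ (hX i)
      (fun n => mollify_memLp (by norm_num) (by norm_num) (hX i) n)
      (tendsto_eLpNorm_mollify_sub (by norm_num) (by norm_num) (hX i))
    filter_upwards [hqlim] with x hx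
    exact ((((hcD.clm_apply continuous_const).tendsto _).comp hx)).mul_const _
  have hst : ∀ n, ∫ x, Φ (q n x) * fderiv ℝ φ x (coordVec k) =
      -∑ i, ∫ x, fderiv ℝ Φ (q n x) (Pi.single i 1) * φ x * mollify n (X i) x := by
    intro n
    rw [(hasWeakPartialDeriv_of_contDiff (hΦq n) Set.univ k).integral_eq hφ hφc (Set.subset_univ _)]
    congr 1
    rw [← integral_finsetSum]
    · refine integral_congr_ae (Eventually.of_forall fun x => ?_)
      simp only [hdq, Finset.sum_mul]
      exact Finset.sum_congr rfl fun i _ => by ring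
    · intro i _
      exact ((((hqc n i).mul hφ.continuous).mul
        (mollify_contDiff ((hX i).locallyIntegrable (by norm_num)) n).continuous)
        ).integrable_of_hasCompactSupport (hφc.mul_left.mul_right)
  simp_rw [hst] at lhs
  rw [tendsto_nhds_unique lhs rhs.neg]
  congr 1
  rw [← integral_finsetSum]
  · refine integral_congr_ae (Eventually.of_forall fun x => ?_)
    simp only
    rw [hsum, Finset.sum_mul]
    exact Finset.sum_congr rfl fun i _ => by ring
  · intro i _
    have := (hL2 i).integrable_mul hφ2
    refine this.congr (Eventually.of_forall fun x => ?_)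
    simp only [Pi.mul_apply]; ring

end ChainRule

/-! ### The determinant form and the Caccioppoli inequality. -/

section Caccioppoli

variable {α : Type*} [Fintype α]

/-- The quadratic form `∑ c_{ab} det (M_a, M_b)` on matrices with two columns. -/
def detForm (c : α → α → ℝ) (M : α → Fin 2 → ℝ) : ℝ :=
  ∑ a, ∑ b, c a b * (M a 0 * M b 1 - M a 1 * M b 0)

theorem integral_detForm_eq_zero (c : α → α → ℝ) {f : α → Plane → ℝ} {g : α → Fin 2 → Plane → ℝ}
    (hf : ∀ a, HasCompactSupport (f a)) (hg : ∀ a j, MemLp (g a j) 2)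
    (hfg : ∀ a j, HasWeakPartialDeriv Set.univ j (f a) (g a j)) :
    ∫ x, detForm c (fun a j => g a j x) = 0 := by
  have hi : ∀ a b, Integrable fun x => c a b * (g a 0 x * g b 1 x - g a 1 x * g b 0 x) :=
    fun a b => (((hg a 0).integrable_mul (hg b 1)).sub
      ((hg a 1).integrable_mul (hg b 0))).const_mul _
  unfold detForm
  rw [integral_finsetSum _ fun a _ => integrable_finsetSum _ fun b _ => hi a b]
  refine Finset.sum_eq_zero fun a _ => ?_
  rw [integral_finsetSum _ fun b _ => hi a b]
  refine Finset.sum_eq_zero fun b _ => ?_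
  rw [integral_const_mul, integral_jacobian_eq_zero (hg a) (hfg a) (hf b) (hg b) (hfg b), mul_zero]

/-- The matrix `U ⊗ ν` has vanishing minors, so the expansion has no term quadratic in it. In the
Caccioppoli inequality this is what removes the square of the cutoff gradient. -/
theorem detForm_add_rankOne (c : α → α → ℝ) (M : α → Fin 2 → ℝ) (U : α → ℝ) (ν : Fin 2 → ℝ)
    (t : ℝ) :
    detForm c (fun a j => t * M a j + U a * ν j) = t ^ 2 * detForm c M +
      t * ∑ a, ∑ b, c a b * (U b * (M a 0 * ν 1 - M a 1 * ν 0) +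
        U a * (ν 0 * M b 1 - ν 1 * M b 0)) := by
  simp only [detForm, Finset.mul_sum, ← Finset.sum_add_distrib]
  refine Finset.sum_congr rfl fun a _ => Finset.sum_congr rfl fun b _ => ?_
  ring

theorem abs_cross_le (c : α → α → ℝ) (M : α → Fin 2 → ℝ) (U : α → ℝ) (ν : Fin 2 → ℝ) :
    |∑ a, ∑ b, c a b * (U b * (M a 0 * ν 1 - M a 1 * ν 0) +
        U a * (ν 0 * M b 1 - ν 1 * M b 0))| ≤
      (2 * ∑ a, ∑ b, |c a b|) *
        ((|ν 0| + |ν 1|) * (∑ a, |U a|) * ∑ a, ∑ j, |M a j|) := by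
  set S := ∑ a, |U a|
  set T := ∑ a, ∑ j, |M a j|
  have hU : ∀ a, |U a| ≤ S := fun a =>
    Finset.single_le_sum (f := fun a => |U a|) (fun _ _ => abs_nonneg _) (Finset.mem_univ a)
  have hM : ∀ a, |M a 0| + |M a 1| ≤ T := fun a => by
    have := Finset.single_le_sum (f := fun a => ∑ j, |M a j|)
      (fun _ _ => Finset.sum_nonneg fun _ _ => abs_nonneg _) (Finset.mem_univ a)
    rw [Fin.sum_univ_two] at this
    exact this
  have hS : 0 ≤ S := Finset.sum_nonneg fun _ _ => abs_nonneg _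
  have hdet : ∀ a, |M a 0 * ν 1 - M a 1 * ν 0| ≤ (|ν 0| + |ν 1|) * T := by
    intro a
    calc |M a 0 * ν 1 - M a 1 * ν 0| ≤ |M a 0 * ν 1| + |M a 1 * ν 0| := abs_sub _ _
      _ = |M a 0| * |ν 1| + |M a 1| * |ν 0| := by rw [abs_mul, abs_mul]
      _ ≤ (|ν 0| + |ν 1|) * (|M a 0| + |M a 1|) := by
          nlinarith [mul_nonneg (abs_nonneg (M a 0)) (abs_nonneg (ν 0)),
            mul_nonneg (abs_nonneg (M a 1)) (abs_nonneg (ν 1))]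
      _ ≤ _ := mul_le_mul_of_nonneg_left (hM a) (by positivity)
  have hterm : ∀ a b, |U b * (M a 0 * ν 1 - M a 1 * ν 0) + U a * (ν 0 * M b 1 - ν 1 * M b 0)| ≤
      2 * ((|ν 0| + |ν 1|) * S * T) := by
    intro a b
    have h2 : |ν 0 * M b 1 - ν 1 * M b 0| ≤ (|ν 0| + |ν 1|) * T := by
      have := hdet b
      rw [abs_sub_comm] at this
      simpa [mul_comm] using this
    calc _ ≤ |U b * (M a 0 * ν 1 - M a 1 * ν 0)| + |U a * (ν 0 * M b 1 - ν 1 * M b 0)| :=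
          abs_add_le _ _
      _ ≤ S * ((|ν 0| + |ν 1|) * T) + S * ((|ν 0| + |ν 1|) * T) := by
          rw [abs_mul, abs_mul]
          exact add_le_add (mul_le_mul (hU b) (hdet a) (abs_nonneg _) hS)
            (mul_le_mul (hU a) h2 (abs_nonneg _) hS)
      _ = _ := by ring
  refine (Finset.abs_sum_le_sum_abs _ _).trans ?_
  rw [Finset.mul_sum, Finset.sum_mul]
  refine Finset.sum_le_sum fun a _ => (Finset.abs_sum_le_sum_abs _ _).trans ?_
  rw [Finset.mul_sum, Finset.sum_mul]
  refine Finset.sum_le_sum fun b _ => ?_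
  rw [abs_mul]
  calc _ ≤ |c a b| * (2 * ((|ν 0| + |ν 1|) * S * T)) :=
        mul_le_mul_of_nonneg_left (hterm a b) (abs_nonneg _)
    _ = _ := by ring

/-- The size of the gradient of a cutoff function. -/
noncomputable def gradAbs (η : Plane → ℝ) (x : Plane) : ℝ :=
  |fderiv ℝ η x (coordVec 0)| + |fderiv ℝ η x (coordVec 1)|

theorem gradAbs_nonneg (η : Plane → ℝ) (x : Plane) : 0 ≤ gradAbs η x := by
  unfold gradAbs; positivity

theorem continuous_gradAbs {η : Plane → ℝ} (hη : ContDiff ℝ ∞ η) : Continuous (gradAbs η) :=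
  (continuous_fderiv_coord hη 0).abs.add (continuous_fderiv_coord hη 1).abs

theorem hasCompactSupport_gradAbs {η : Plane → ℝ} (hη : HasCompactSupport η) :
    HasCompactSupport (gradAbs η) := by
  have h : ∀ i, HasCompactSupport fun x => |fderiv ℝ η x (coordVec i)| := fun i =>
    (hasCompactSupport_fderiv_coord hη i).comp_left (g := fun t : ℝ => |t|) abs_zero
  exact (h 0).add (h 1)

theorem gradAbs_eq_zero {η : Plane → ℝ} {x : Plane} (hx : x ∉ tsupport η) : gradAbs η x = 0 := by
  have h : ∀ i, fderiv ℝ η x (coordVec i) = 0 := fun i =>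
    image_eq_zero_of_notMem_tsupport (f := fun x => fderiv ℝ η x (coordVec i))
      fun hx' => hx (tsupport_fderiv_coord_subset η i hx')
  simp [gradAbs, h]

/-- A Caccioppoli inequality for maps whose gradient lies in a cone on which `detForm c` controls
the energy density `e`. -/
theorem caccioppoli (c : α → α → ℝ) {W : α → Plane → ℝ} {M : α → Fin 2 → Plane → ℝ}
    (hW : ∀ a, MemLp (W a) 2) (hM : ∀ a j, MemLp (M a j) 2)
    (hWM : ∀ a j, HasWeakPartialDeriv Set.univ j (W a) (M a j))
    {η : Plane → ℝ} (hη : ContDiff ℝ ∞ η) (hηc : HasCompactSupport η) (κ : α → ℝ)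
    {e : Plane → ℝ} (he : Integrable e) (he0 : ∀ x, 0 ≤ e x) {L : ℝ}
    (heQ : ∀ᵐ x, x ∈ tsupport η → e x ≤ detForm c fun a j => M a j x)
    (hML : ∀ᵐ x, x ∈ tsupport η → ∑ a, ∑ j, |M a j x| ≤ L * Real.sqrt (e x)) :
    ∫ x, η x ^ 2 * e x ≤ (2 * ∑ a, ∑ b, |c a b|) * L *
      ∫ x, |η x| * Real.sqrt (e x) * (gradAbs η x * ∑ a, |W a x - κ a|) := by
  obtain ⟨H, hH⟩ := hηc.exists_bound_of_continuous hη.continuous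
  have hcpt : HasCompactSupport (gradAbs η) := hasCompactSupport_gradAbs hηc
  have hcd : ∀ j, HasCompactSupport fun x => fderiv ℝ η x (coordVec j) :=
    hasCompactSupport_fderiv_coord hηc
  set ν : Plane → Fin 2 → ℝ := fun x j => fderiv ℝ η x (coordVec j)
  have hbddL2 : ∀ {k ψ : Plane → ℝ}, MemLp k 2 → Continuous ψ → HasCompactSupport ψ →
      MemLp (fun x => ψ x * k x) 2 := by
    intro k ψ hk hψ hψc
    obtain ⟨B, hB⟩ := hψc.exists_bound_of_continuous hψ
    refine (hk.const_mul B).mono (hψ.aestronglyMeasurable.mul hk.1)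
      (Eventually.of_forall fun x => ?_)
    rw [norm_mul, norm_mul]
    exact mul_le_mul_of_nonneg_right ((hB x).trans (le_abs_self _)) (norm_nonneg _)
  have hUL2 : ∀ {ψ : Plane → ℝ}, Continuous ψ → HasCompactSupport ψ → ∀ a,
      MemLp (fun x => ψ x * (W a x - κ a)) 2 := by
    intro ψ hψ hψc a
    have h1 := hbddL2 (hW a) hψ hψc
    have h2 : MemLp (fun x => ψ x * κ a) 2 :=
      ((hψ.memLp_of_hasCompactSupport hψc).mul_const (κ a))
    simp_rw [mul_sub]
    exact h1.sub h2
  have hG : ∀ a j, MemLp (fun x => η x * M a j x + (W a x - κ a) * ν x j) 2 := by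
    intro a j
    have h2 := hUL2 (continuous_fderiv_coord hη j) (hcd j) a
    simp_rw [mul_comm _ (W a _ - κ a)] at h2
    exact (hbddL2 (hM a j) hη.continuous hηc).add h2
  -- This matrix is the gradient of the compactly supported map `η (W - κ)`, so its minors integrate
  -- to zero.
  have hzero : ∫ x, detForm c (fun a j => η x * M a j x + (W a x - κ a) * ν x j) = 0 := by
    refine integral_detForm_eq_zero c (f := fun a x => η x * (W a x - κ a))
      (fun a => hηc.mul_right) hG fun a j => ?_
    exact ((hWM a j).sub_const (κ a)).mul_cutoff hη hηc (Set.subset_univ _)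
  set R : Plane → ℝ := fun x => ∑ a, ∑ b, c a b * ((W b x - κ b) *
      (M a 0 x * ν x 1 - M a 1 x * ν x 0) + (W a x - κ a) * (ν x 0 * M b 1 x - ν x 1 * M b 0 x))
  simp_rw [detForm_add_rankOne c] at hzero
  have hηM : ∀ a j, MemLp (fun x => η x * M a j x) 2 := fun a j => hbddL2 (hM a j) hη.continuous hηc
  have hI1 : Integrable fun x => η x ^ 2 * detForm c fun a j => M a j x := by
    simp only [detForm, Finset.mul_sum]
    refine integrable_finsetSum _ fun a _ => integrable_finsetSum _ fun b _ => ?_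
    refine ((((hηM a 0).integrable_mul (hηM b 1)).sub
      ((hηM a 1).integrable_mul (hηM b 0))).const_mul (c a b)).congr
      (Eventually.of_forall fun x => ?_)
    simp only [Pi.sub_apply, Pi.mul_apply]; ring
  have hI2 : Integrable fun x => η x * R x := by
    simp only [R, Finset.mul_sum]
    refine integrable_finsetSum _ fun a _ => integrable_finsetSum _ fun b _ => ?_
    have k := fun j a => hUL2 (continuous_fderiv_coord hη j) (hcd j) a
    refine (((((hηM a 0).integrable_mul (k 1 b)).sub ((hηM a 1).integrable_mul (k 0 b))).add
      (((hηM b 1).integrable_mul (k 0 a)).sub ((hηM b 0).integrable_mul (k 1 a)))).const_mul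
        (c a b)).congr (Eventually.of_forall fun x => ?_)
    simp only [Pi.sub_apply, Pi.mul_apply, Pi.add_apply, ν]; ring
  rw [integral_add hI1 hI2] at hzero
  have hsq : MemLp (fun x => Real.sqrt (e x)) 2 := by
    rw [memLp_two_iff_integrable_sq (Real.continuous_sqrt.comp_aestronglyMeasurable he.1)]
    exact he.congr (Eventually.of_forall fun x => (Real.sq_sqrt (he0 x)).symm)
  have hI3 : Integrable fun x => |η x| * Real.sqrt (e x) *
      (gradAbs η x * ∑ a, |W a x - κ a|) := by
    have k1 : MemLp (fun x => |η x| * Real.sqrt (e x)) 2 :=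
      hbddL2 hsq hη.continuous.abs (hηc.comp_left (g := fun t : ℝ => |t|) abs_zero)
    have k2 : MemLp (fun x => gradAbs η x * ∑ a, |W a x - κ a|) 2 := by
      simp_rw [Finset.mul_sum]
      refine memLp_finsetSum _ fun a _ => ?_
      have := (hUL2 (continuous_gradAbs hη) hcpt a).norm
      refine this.congr_norm this.1 (Eventually.of_forall fun x => ?_) |>.ae_eq
        (Eventually.of_forall fun x => ?_)
      · rfl
      · simp only [norm_mul, Real.norm_eq_abs, abs_of_nonneg (gradAbs_nonneg η x)]
    exact k1.integrable_mul k2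
  have hI0 : Integrable fun x => η x ^ 2 * e x := by
    refine he.bdd_mul (c := H ^ 2) (hη.continuous.pow 2).aestronglyMeasurable
      (Eventually.of_forall fun x => ?_)
    rw [norm_pow]
    exact pow_le_pow_left₀ (norm_nonneg _) (hH x) 2
  calc ∫ x, η x ^ 2 * e x ≤ ∫ x, η x ^ 2 * detForm c fun a j => M a j x := by
        refine integral_mono_ae hI0 hI1 ?_
        filter_upwards [heQ] with x hx
        by_cases h : x ∈ tsupport η
        · exact mul_le_mul_of_nonneg_left (hx h) (sq_nonneg _)
        · simp [image_eq_zero_of_notMem_tsupport h]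
    _ = ∫ x, -(η x * R x) := by rw [integral_neg]; linarith
    _ ≤ ∫ x, (2 * ∑ a, ∑ b, |c a b|) * L *
          (|η x| * Real.sqrt (e x) * (gradAbs η x * ∑ a, |W a x - κ a|)) := by
        refine integral_mono_ae hI2.neg (hI3.const_mul _) ?_
        filter_upwards [hML] with x hx
        by_cases h : x ∈ tsupport η
        · have h1 := abs_cross_le c (fun a j => M a j x) (fun a => W a x - κ a) (ν x)
          have h2 := hx h
          calc -(η x * R x) ≤ |η x| * |R x| := by rw [← abs_mul]; exact neg_le_abs _
            _ ≤ |η x| * ((2 * ∑ a, ∑ b, |c a b|) * (gradAbs η x *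
                  (∑ a, |W a x - κ a|) * (L * Real.sqrt (e x)))) := by
                refine mul_le_mul_of_nonneg_left (h1.trans ?_) (abs_nonneg _)
                have hS : 0 ≤ ∑ a, |W a x - κ a| := Finset.sum_nonneg fun _ _ => abs_nonneg _
                have hc : 0 ≤ 2 * ∑ a, ∑ b, |c a b| := mul_nonneg (by norm_num)
                  (Finset.sum_nonneg fun _ _ => Finset.sum_nonneg fun _ _ => abs_nonneg _)
                exact mul_le_mul_of_nonneg_left (mul_le_mul_of_nonneg_left h2
                  (mul_nonneg (gradAbs_nonneg η x) hS)) hc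
            _ = _ := by ring
        · simp [image_eq_zero_of_notMem_tsupport h]
    _ = _ := integral_const_mul _ _

end Caccioppoli

/-! ### Coercivity on the graph and on its tangent spaces. -/

section GraphMaps

variable {I J : Type*} [Fintype I] [Fintype J]

/-- The gradient matrix with upper block `q` and lower block `Φ q`. -/
def stackMap (Φ : J → Fin 2 → (I × Fin 2 → ℝ) → ℝ) (q : I × Fin 2 → ℝ) : I ⊕ J → Fin 2 → ℝ
  | Sum.inl i, j => q (i, j)
  | Sum.inr l, j => Φ l j q

/-- The derivative of `stackMap Φ` at `q` in the direction `X`. -/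
noncomputable def stackDeriv (Φ : J → Fin 2 → (I × Fin 2 → ℝ) → ℝ) (q X : I × Fin 2 → ℝ) :
    I ⊕ J → Fin 2 → ℝ
  | Sum.inl i, j => X (i, j)
  | Sum.inr l, j => fderiv ℝ (Φ l j) q X

/-- The strong monotonicity condition on the graph of `Φ`. -/
def IsCoerciveGraph (c : I ⊕ J → I ⊕ J → ℝ) (Φ : J → Fin 2 → (I × Fin 2 → ℝ) → ℝ) : Prop :=
  ∀ q q' : I × Fin 2 → ℝ, ∑ s, (q s - q' s) ^ 2 ≤
    detForm c fun a j => stackMap Φ q a j - stackMap Φ q' a j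

theorem detForm_smul {α : Type*} [Fintype α] (c : α → α → ℝ) (M : α → Fin 2 → ℝ) (t : ℝ) :
    detForm c (fun a j => t * M a j) = t ^ 2 * detForm c M := by
  simp only [detForm, Finset.mul_sum]
  exact Finset.sum_congr rfl fun a _ => Finset.sum_congr rfl fun b _ => by ring

theorem continuous_detForm {α : Type*} [Fintype α] (c : α → α → ℝ) :
    Continuous (detForm c) := by
  unfold detForm; fun_prop

omit [Fintype J] in
theorem tendsto_stackMap_slope {Φ : J → Fin 2 → (I × Fin 2 → ℝ) → ℝ}
    (hΦ : ∀ l j, ContDiff ℝ 1 (Φ l j)) (q X : I × Fin 2 → ℝ) (a : I ⊕ J) (j : Fin 2) :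
    Tendsto (fun t : ℝ => t⁻¹ * (stackMap Φ (q + t • X) a j - stackMap Φ q a j)) (𝓝[≠] 0)
      (𝓝 (stackDeriv Φ q X a j)) := by
  cases a with
  | inl i =>
    refine (tendsto_const_nhds (x := X (i, j))).congr' ?_
    filter_upwards [self_mem_nhdsWithin] with t ht
    have : t ≠ 0 := ht
    simp only [stackMap, Pi.add_apply, Pi.smul_apply, smul_eq_mul]
    field_simp
    ring
  | inr l =>
    have h1 : HasDerivAt (fun t : ℝ => q + t • X) X 0 := by
      simpa using ((hasDerivAt_id (0 : ℝ)).smul_const X).const_add q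
    have h2 : HasFDerivAt (Φ l j) (fderiv ℝ (Φ l j) q) (q + (0 : ℝ) • X) := by
      simpa using ((hΦ l j).differentiable (by simp) q).hasFDerivAt
    have h3 := hasDerivAt_iff_tendsto_slope.1 (h2.comp_hasDerivAt (0 : ℝ) h1)
    refine h3.congr fun t => ?_
    simp [slope_def_field, stackMap, div_eq_inv_mul]

/-- Both sides of the monotonicity condition are quadratic in increments: apply it to `q + t • X`
and `q`, divide by `t²` and let `t → 0`. -/
theorem IsCoerciveGraph.sum_sq_le_stackDeriv {c : I ⊕ J → I ⊕ J → ℝ}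
    {Φ : J → Fin 2 → (I × Fin 2 → ℝ) → ℝ} (h : IsCoerciveGraph c Φ)
    (hΦ : ∀ l j, ContDiff ℝ 1 (Φ l j)) (q X : I × Fin 2 → ℝ) :
    ∑ s, X s ^ 2 ≤ detForm c (stackDeriv Φ q X) := by
  have hlim : Tendsto (fun t : ℝ => detForm c fun a j =>
      t⁻¹ * (stackMap Φ (q + t • X) a j - stackMap Φ q a j)) (𝓝[≠] 0)
      (𝓝 (detForm c (stackDeriv Φ q X))) := by
    refine ((continuous_detForm c).tendsto _).comp ?_
    exact tendsto_pi_nhds.2 fun a => tendsto_pi_nhds.2 fun j => tendsto_stackMap_slope hΦ q X a j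
  refine ge_of_tendsto hlim ?_
  filter_upwards [self_mem_nhdsWithin] with t ht
  have ht : t ≠ 0 := ht
  rw [detForm_smul]
  have h1 := h (q + t • X) q
  have h2 : ∑ s, ((q + t • X) s - q s) ^ 2 = t ^ 2 * ∑ s, X s ^ 2 := by
    rw [Finset.mul_sum]
    exact Finset.sum_congr rfl fun s _ => by simp; ring
  rw [h2] at h1
  calc ∑ s, X s ^ 2 = t⁻¹ ^ 2 * (t ^ 2 * ∑ s, X s ^ 2) := by field_simp
    _ ≤ _ := mul_le_mul_of_nonneg_left h1 (by positivity)

theorem norm_le_sqrt_sum_sq {ι : Type*} [Fintype ι] (X : ι → ℝ) :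
    ‖X‖ ≤ Real.sqrt (∑ s, X s ^ 2) := by
  refine (pi_norm_le_iff_of_nonneg (Real.sqrt_nonneg _)).2 fun s => ?_
  rw [Real.norm_eq_abs]
  refine Real.abs_le_sqrt ?_
  exact Finset.single_le_sum (f := fun s => X s ^ 2) (fun _ _ => sq_nonneg _) (Finset.mem_univ s)

/-- A C¹ map is Lipschitz only on bounded sets, so the bound is confined to a ball, where the mean
value inequality applies. Solutions with bounded gradient stay in such a ball. -/
theorem exists_stackMap_lipschitz {Φ : J → Fin 2 → (I × Fin 2 → ℝ) → ℝ}
    (hΦ : ∀ l j, ContDiff ℝ 1 (Φ l j)) (C : ℝ) :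
    ∃ L : ℝ, 0 ≤ L ∧ ∀ q q' : I × Fin 2 → ℝ, ‖q‖ ≤ C → ‖q'‖ ≤ C →
      ∑ a, ∑ j, |stackMap Φ q a j - stackMap Φ q' a j| ≤
        L * Real.sqrt (∑ s, (q s - q' s) ^ 2) := by
  have hK : IsCompact (Metric.closedBall (0 : I × Fin 2 → ℝ) C) := isCompact_closedBall _ _
  have hb : ∀ l j, ∃ B, ∀ q ∈ Metric.closedBall (0 : I × Fin 2 → ℝ) C,
      ‖fderiv ℝ (Φ l j) q‖ ≤ B := fun l j =>
    hK.exists_bound_of_continuousOn ((hΦ l j).continuous_fderiv (by simp)).continuousOn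
  choose B hB using hb
  refine ⟨∑ a : I ⊕ J, ∑ j : Fin 2, Sum.elim (fun _ => 1) (fun l => |B l j|) a, ?_,
    fun q q' hq hq' => ?_⟩
  · refine Finset.sum_nonneg fun a _ => Finset.sum_nonneg fun j _ => ?_
    cases a <;> simp
  · rw [Finset.sum_mul]
    refine Finset.sum_le_sum fun a _ => ?_
    rw [Finset.sum_mul]
    refine Finset.sum_le_sum fun j _ => ?_
    have hn : ‖q - q'‖ ≤ Real.sqrt (∑ s, (q s - q' s) ^ 2) := norm_le_sqrt_sum_sq (q - q')
    cases a with
    | inl i =>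
      simp only [stackMap, Sum.elim_inl, one_mul]
      exact (norm_le_pi_norm (q - q') (i, j)).trans hn
    | inr l =>
      simp only [stackMap, Sum.elim_inr]
      have := (convex_closedBall (0 : I × Fin 2 → ℝ) C).norm_image_sub_le_of_norm_fderiv_le
        (f := Φ l j) (fun x _ => (hΦ l j).differentiable (by simp) x)
        (fun x hx => (hB l j x hx).trans (le_abs_self _)) (mem_closedBall_zero_iff.2 hq')
        (mem_closedBall_zero_iff.2 hq)
      exact this.trans (mul_le_mul_of_nonneg_left hn (abs_nonneg _))

theorem exists_stackDeriv_bound {Φ : J → Fin 2 → (I × Fin 2 → ℝ) → ℝ}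
    (hΦ : ∀ l j, ContDiff ℝ 1 (Φ l j)) (C : ℝ) :
    ∃ L : ℝ, 0 ≤ L ∧ ∀ q X : I × Fin 2 → ℝ, ‖q‖ ≤ C →
      ∑ a, ∑ j, |stackDeriv Φ q X a j| ≤ L * Real.sqrt (∑ s, X s ^ 2) := by
  -- The extra unit of radius leaves room for `q + t • X` with small `t`; the derivative bound is
  -- the limit of the Lipschitz bound.
  obtain ⟨L, hL0, hL⟩ := exists_stackMap_lipschitz hΦ (C + 1)
  refine ⟨L, hL0, fun q X hq => ?_⟩
  have hlim : Tendsto (fun t : ℝ => ∑ a, ∑ j,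
      |t⁻¹ * (stackMap Φ (q + t • X) a j - stackMap Φ q a j)|) (𝓝[≠] 0)
      (𝓝 (∑ a, ∑ j, |stackDeriv Φ q X a j|)) :=
    tendsto_finsetSum _ fun a _ => tendsto_finsetSum _ fun j _ =>
      (tendsto_stackMap_slope hΦ q X a j).abs
  refine le_of_tendsto hlim ?_
  have hsmall : ∀ᶠ t : ℝ in 𝓝[≠] 0, ‖t • X‖ < 1 := by
    refine nhdsWithin_le_nhds ?_
    have : Tendsto (fun t : ℝ => ‖t • X‖) (𝓝 0) (𝓝 0) := by
      have := ((continuous_id.smul continuous_const).norm : Continuous fun t : ℝ => ‖t • X‖).tendsto 0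
      simpa using this
    exact this.eventually (gt_mem_nhds one_pos)
  filter_upwards [self_mem_nhdsWithin, hsmall] with t ht hts
  have ht : t ≠ 0 := ht
  have h1 := hL (q + t • X) q ((norm_add_le _ _).trans (by linarith)) (by linarith)
  have h2 : ∑ s, ((q + t • X) s - q s) ^ 2 = t ^ 2 * ∑ s, X s ^ 2 := by
    rw [Finset.mul_sum]
    exact Finset.sum_congr rfl fun s _ => by simp; ring
  rw [h2, Real.sqrt_mul (sq_nonneg t), Real.sqrt_sq_eq_abs] at h1
  simp_rw [abs_mul, ← Finset.mul_sum]
  calc |t⁻¹| * ∑ a, ∑ j, |stackMap Φ (q + t • X) a j - stackMap Φ q a j|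
      ≤ |t⁻¹| * (L * (|t| * Real.sqrt (∑ s, X s ^ 2))) :=
        mul_le_mul_of_nonneg_left h1 (abs_nonneg _)
    _ = L * Real.sqrt (∑ s, X s ^ 2) := by
        rw [abs_inv]
        have := abs_pos.2 ht
        field_simp

end GraphMaps

/-! ### Second derivatives in L² by difference quotients. -/

section SecondDerivatives

variable {I J : Type*} [Fintype I] [Fintype J]

theorem sum_abs_sq_le {α : Type*} [Fintype α] (u : α → ℝ) :
    (∑ a, |u a|) ^ 2 ≤ Fintype.card α * ∑ a, u a ^ 2 := by
  have := sq_sum_le_card_mul_sum_sq (s := Finset.univ) (f := fun a => |u a|)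
  simpa using this

theorem diffQuot_weakDeriv {f g : Plane → ℝ} {j : Fin 2}
    (h : HasWeakPartialDeriv Set.univ j f g) (v : Plane) (t : ℝ) :
    HasWeakPartialDeriv Set.univ j (fun x => t⁻¹ * (f (x + v) - f x))
      (fun x => t⁻¹ * (g (x + v) - g x)) :=
  ((h.comp_add v).sub h).const_mul t⁻¹

theorem memLp_diffQuot {f : Plane → ℝ} (hf : MemLp f 2) (v : Plane) (t : ℝ) :
    MemLp (fun x => t⁻¹ * (f (x + v) - f x)) 2 :=
  ((hf.comp_measurePreserving (measurePreserving_add_right (volume : Measure Plane) v)).sub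
    hf).const_mul t⁻¹

/-- Energy estimate for the difference quotients of a solution of the differential inclusion. -/
theorem integral_cutoff_diffQuot_sq_le {c : I ⊕ J → I ⊕ J → ℝ}
    {Φ : J → Fin 2 → (I × Fin 2 → ℝ) → ℝ} (hcoer : IsCoerciveGraph c Φ)
    {V : I ⊕ J → Plane → ℝ} {G : I ⊕ J → Fin 2 → Plane → ℝ}
    (hV : ∀ a, MemLp (V a) 2) (hG : ∀ a j, MemLp (G a j) 2)
    (hVG : ∀ a j, HasWeakPartialDeriv Set.univ j (V a) (G a j)) {C L : ℝ}
    (hL0 : 0 ≤ L)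
    (hGC : ∀ᵐ x, ‖fun s : I × Fin 2 => G (Sum.inl s.1) s.2 x‖ ≤ C)
    (hL : ∀ q q' : I × Fin 2 → ℝ, ‖q‖ ≤ C → ‖q'‖ ≤ C →
      ∑ a, ∑ j, |stackMap Φ q a j - stackMap Φ q' a j| ≤ L * Real.sqrt (∑ s, (q s - q' s) ^ 2))
    {U : Set Plane}
    (hU : ∀ᵐ x, x ∈ U → ∀ a j, G a j x = stackMap Φ (fun s => G (Sum.inl s.1) s.2 x) a j)
    {η : Plane → ℝ} (hη : ContDiff ℝ ∞ η) (hηc : HasCompactSupport η) {T : ℝ}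
    (hT : ∀ x, gradAbs η x ≤ T) (k : Fin 2) {t : ℝ} (ht : t ≠ 0)
    (htU : ∀ x ∈ tsupport η, x ∈ U ∧ x + t • coordVec k ∈ U) :
    ∫ x, η x ^ 2 * ∑ s : I × Fin 2,
        (t⁻¹ * (G (Sum.inl s.1) s.2 (x + t • coordVec k) - G (Sum.inl s.1) s.2 x)) ^ 2 ≤
      ((2 * ∑ a, ∑ b, |c a b|) * L) ^ 2 * (T ^ 2 * (Fintype.card (I ⊕ J) *
        ∑ a, ∫ x, gradSq (G a) x)) := by
  set v := t • coordVec k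
  set W : I ⊕ J → Plane → ℝ := fun a x => t⁻¹ * (V a (x + v) - V a x)
  set M : I ⊕ J → Fin 2 → Plane → ℝ := fun a j x => t⁻¹ * (G a j (x + v) - G a j x)
  set e : Plane → ℝ := fun x => ∑ s : I × Fin 2, (M (Sum.inl s.1) s.2 x) ^ 2
  have hW : ∀ a, MemLp (W a) 2 := fun a => memLp_diffQuot (hV a) v t
  have hM : ∀ a j, MemLp (M a j) 2 := fun a j => memLp_diffQuot (hG a j) v t
  have he : Integrable e := integrable_finsetSum _ fun s _ => (hM _ _).integrable_sq
  have he0 : ∀ x, 0 ≤ e x := fun x => Finset.sum_nonneg fun _ _ => sq_nonneg _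
  have hqmp := (measurePreserving_add_right (volume : Measure Plane) v).quasiMeasurePreserving
  have hU' := hqmp.ae hU
  have hGC' := hqmp.ae hGC
  have hscale : ∀ x, e x = t⁻¹ ^ 2 * ∑ s : I × Fin 2,
      (G (Sum.inl s.1) s.2 (x + v) - G (Sum.inl s.1) s.2 x) ^ 2 := fun x => by
    rw [Finset.mul_sum]
    exact Finset.sum_congr rfl fun s _ => by simp only [M]; ring
  have heQ : ∀ᵐ x, x ∈ tsupport η → e x ≤ detForm c fun a j => M a j x := by
    filter_upwards [hU, hU'] with x h1 h2 hx
    obtain ⟨hx1, hx2⟩ := htU x hx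
    simp only [M]
    rw [detForm_smul c (fun a j => G a j (x + v) - G a j x), hscale]
    refine mul_le_mul_of_nonneg_left ?_ (by positivity)
    have e1 : (fun a j => G a j (x + v) - G a j x) = fun a j =>
        stackMap Φ (fun s => G (Sum.inl s.1) s.2 (x + v)) a j -
          stackMap Φ (fun s => G (Sum.inl s.1) s.2 x) a j := by
      funext a j
      rw [← h1 hx1 a j, ← h2 hx2 a j]
    rw [e1]
    exact hcoer (fun s => G (Sum.inl s.1) s.2 (x + v)) (fun s => G (Sum.inl s.1) s.2 x)
  have hML : ∀ᵐ x, x ∈ tsupport η → ∑ a, ∑ j, |M a j x| ≤ L * Real.sqrt (e x) := by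
    filter_upwards [hU, hU', hGC, hGC'] with x h1 h2 h3 h4 hx
    obtain ⟨hx1, hx2⟩ := htU x hx
    have := hL _ _ h4 h3
    simp_rw [← h1 hx1, ← h2 hx2] at this
    rw [hscale, Real.sqrt_mul (by positivity), Real.sqrt_sq_eq_abs]
    simp only [M, abs_mul, ← Finset.mul_sum]
    calc _ ≤ |t⁻¹| * (L * Real.sqrt (∑ s : I × Fin 2,
          (G (Sum.inl s.1) s.2 (x + v) - G (Sum.inl s.1) s.2 x) ^ 2)) :=
          mul_le_mul_of_nonneg_left this (abs_nonneg _)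
      _ = _ := by ring
  -- No constant needs to be subtracted (`κ = 0`): the difference quotients of `V` themselves are
  -- bounded in L² by its gradient.
  have hcac := caccioppoli c hW hM (fun a j => diffQuot_weakDeriv (hVG a j) v t) hη hηc
    (fun _ => 0) he he0 heQ hML
  simp only [sub_zero] at hcac
  set K := (2 * ∑ a, ∑ b, |c a b|) * L
  obtain ⟨H, hH⟩ := hηc.exists_bound_of_continuous hη.continuous
  have hI0 : Integrable fun x => η x ^ 2 * e x := by
    refine he.bdd_mul (c := H ^ 2) (hη.continuous.pow 2).aestronglyMeasurable
      (Eventually.of_forall fun x => ?_)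
    rw [norm_pow]
    exact pow_le_pow_left₀ (norm_nonneg _) (hH x) 2
  have hWsum : Integrable fun x => ∑ a, W a x ^ 2 :=
    integrable_finsetSum _ fun a _ => (hW a).integrable_sq
  have hT0 : 0 ≤ T := (gradAbs_nonneg η 0).trans (hT 0)
  have hR : Integrable fun x => (1 / 2) * (η x ^ 2 * e x) +
      (1 / 2) * (K ^ 2 * (T ^ 2 * (Fintype.card (I ⊕ J) * ∑ a, W a x ^ 2))) :=
    (hI0.const_mul _).add ((((hWsum.const_mul _).const_mul _).const_mul _).const_mul _)
  have hK0 : 0 ≤ K := mul_nonneg (mul_nonneg (by norm_num)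
    (Finset.sum_nonneg fun _ _ => Finset.sum_nonneg fun _ _ => abs_nonneg _)) hL0
  have hbound : K * ∫ x, |η x| * Real.sqrt (e x) * (gradAbs η x * ∑ a, |W a x|) ≤
      ∫ x, ((1 / 2) * (η x ^ 2 * e x) +
        (1 / 2) * (K ^ 2 * (T ^ 2 * (Fintype.card (I ⊕ J) * ∑ a, W a x ^ 2)))) := by
    rw [← integral_const_mul]
    refine integral_mono_of_nonneg (Eventually.of_forall fun x => ?_) hR
      (Eventually.of_forall fun x => ?_)
    · exact mul_nonneg hK0 (mul_nonneg (mul_nonneg (abs_nonneg _) (Real.sqrt_nonneg _))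
        (mul_nonneg (gradAbs_nonneg η x) (Finset.sum_nonneg fun _ _ => abs_nonneg _)))
    · have h1 : (|η x| * Real.sqrt (e x)) ^ 2 = η x ^ 2 * e x := by
        rw [mul_pow, sq_abs, Real.sq_sqrt (he0 x)]
      have h2 : (gradAbs η x * ∑ a, |W a x|) ^ 2 ≤
          T ^ 2 * (Fintype.card (I ⊕ J) * ∑ a, W a x ^ 2) := by
        rw [mul_pow]
        exact mul_le_mul (pow_le_pow_left₀ (gradAbs_nonneg η x) (hT x) 2)
          (sum_abs_sq_le fun a => W a x) (sq_nonneg _) (sq_nonneg _)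
      have h3 := mul_le_mul_of_nonneg_left h2 (sq_nonneg K)
      simp only
      -- Young's inequality with weight one half, so that the energy term can be absorbed on the
      -- left at the end.
      nlinarith [sq_nonneg (|η x| * Real.sqrt (e x) - K * (gradAbs η x * ∑ a, |W a x|))]
  have hWint : ∀ a, ∫ x, W a x ^ 2 ≤ ∫ x, gradSq (G a) x := by
    intro a
    have h1 := setIntegral_translate_sub_sq_le (hV a) (hG a) (hVG a) v MeasurableSet.univ
      MeasurableSet.univ fun _ _ _ _ => Set.mem_univ _
    simp only [Measure.restrict_univ] at h1
    have h2 : ‖v‖ ^ 2 = t ^ 2 := by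
      simp [v, norm_smul, coordVec]
    rw [h2] at h1
    simp only [W, mul_pow]
    rw [integral_const_mul]
    calc _ ≤ t⁻¹ ^ 2 * (t ^ 2 * ∫ x, gradSq (G a) x) :=
          mul_le_mul_of_nonneg_left h1 (by positivity)
      _ = _ := by field_simp
  have hfin := hcac.trans hbound
  rw [integral_add (hI0.const_mul _) ((((hWsum.const_mul _).const_mul _).const_mul _).const_mul _),
    integral_const_mul, integral_const_mul, integral_const_mul, integral_const_mul,
    integral_const_mul, integral_finsetSum _ fun a _ => (hW a).integrable_sq] at hfin
  have hsum : K ^ 2 * (T ^ 2 * (Fintype.card (I ⊕ J) * ∑ a, ∫ x, W a x ^ 2)) ≤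
      K ^ 2 * (T ^ 2 * (Fintype.card (I ⊕ J) * ∑ a, ∫ x, gradSq (G a) x)) := by
    refine mul_le_mul_of_nonneg_left (mul_le_mul_of_nonneg_left (mul_le_mul_of_nonneg_left
      (Finset.sum_le_sum fun a _ => hWint a) (by positivity)) (by positivity)) (by positivity)
  linarith

/-- Second derivatives of solutions of the differential inclusion exist locally in `L²`. -/
theorem exists_weakDeriv_cutoff_gradient {c : I ⊕ J → I ⊕ J → ℝ}
    {Φ : J → Fin 2 → (I × Fin 2 → ℝ) → ℝ} (hcoer : IsCoerciveGraph c Φ)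
    (hΦ : ∀ l j, ContDiff ℝ 1 (Φ l j))
    {V : I ⊕ J → Plane → ℝ} {G : I ⊕ J → Fin 2 → Plane → ℝ}
    (hV : ∀ a, MemLp (V a) 2) (hG : ∀ a j, MemLp (G a j) 2)
    (hVG : ∀ a j, HasWeakPartialDeriv Set.univ j (V a) (G a j)) {C : ℝ}
    (hGC : ∀ᵐ x, ‖fun s : I × Fin 2 => G (Sum.inl s.1) s.2 x‖ ≤ C)
    {U : Set Plane} (hUo : IsOpen U)
    (hU : ∀ᵐ x, x ∈ U → ∀ a j, G a j x = stackMap Φ (fun s => G (Sum.inl s.1) s.2 x) a j)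
    {η : Plane → ℝ} (hη : ContDiff ℝ ∞ η) (hηc : HasCompactSupport η) (hηU : tsupport η ⊆ U)
    (k : Fin 2) (s : I × Fin 2) :
    ∃ X, MemLp X 2 ∧
      HasWeakPartialDeriv Set.univ k (fun x => η x * G (Sum.inl s.1) s.2 x) X := by
  obtain ⟨L, hL0, hL⟩ := exists_stackMap_lipschitz hΦ C
  obtain ⟨d, hd, hdU⟩ := hηc.exists_cthickening_subset_open hUo hηU
  obtain ⟨T, hT⟩ := (hasCompactSupport_gradAbs hηc).exists_bound_of_continuous
    (continuous_gradAbs hη)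
  have hT' : ∀ x, gradAbs η x ≤ T := fun x => (le_abs_self _).trans (hT x)
  obtain ⟨Lη, hLη⟩ := hη.lipschitzWith_of_hasCompactSupport hηc (by simp)
  obtain ⟨H, hH⟩ := hηc.exists_bound_of_continuous hη.continuous
  set P : Plane → ℝ := G (Sum.inl s.1) s.2
  have hP : MemLp P 2 := hG _ _
  have hηP : MemLp (fun x => η x * P x) 2 := by
    refine (hP.const_mul H).mono (hη.continuous.aestronglyMeasurable.mul hP.1)
      (Eventually.of_forall fun x => ?_)
    rw [norm_mul, norm_mul]
    exact mul_le_mul_of_nonneg_right ((hH x).trans (le_abs_self _)) (norm_nonneg _)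
  have hηPi : Integrable fun x => η x * P x :=
    (hη.continuous.memLp_of_hasCompactSupport hηc : MemLp η 2 volume).integrable_mul hP
  -- Steps of length at most `d` keep the translated support of `η` inside `U`, where the inclusion
  -- holds.
  set t : ℕ → ℝ := fun n => d * (1 / ((n : ℝ) + 1))
  have ht0 : ∀ n, 0 < t n := fun n => by positivity
  have htd : ∀ n, t n ≤ d := fun n => by
    refine mul_le_of_le_one_right hd.le ?_
    rw [div_le_one (by positivity)]
    linarith [(Nat.cast_nonneg n : (0 : ℝ) ≤ n)]
  have htlim : Tendsto t atTop (𝓝 0) := by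
    have h := (tendsto_one_div_add_atTop_nhds_zero_nat (𝕜 := ℝ)).const_mul d
    rwa [mul_zero] at h
  have htU : ∀ n, ∀ x ∈ tsupport η, x ∈ U ∧ x + t n • coordVec k ∈ U := fun n x hx =>
    ⟨hηU hx, hdU (Metric.mem_cthickening_of_dist_le _ x _ _ hx (by
      rw [dist_eq_norm, add_sub_cancel_left, norm_smul, Real.norm_of_nonneg (ht0 n).le]
      simpa [coordVec] using htd n))⟩
  set B := ((2 * ∑ a, ∑ b, |c a b|) * L) ^ 2 * (T ^ 2 * (Fintype.card (I ⊕ J) *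
        ∑ a, ∫ x, gradSq (G a) x))
  refine exists_weakDeriv_of_diffQuot_bounded hηPi hηP k htlim (fun n => (ht0 n).ne')
    (C := 2 * B + 2 * ((Lη : ℝ) ^ 2 * ∫ x, P x ^ 2)) fun n => ?_
  have hmain := integral_cutoff_diffQuot_sq_le hcoer hV hG hVG hL0 hGC hL hU hη hηc hT' k
    (ht0 n).ne' (htU n)
  set v := t n • coordVec k
  set e : Plane → ℝ := fun x => ∑ s : I × Fin 2,
    ((t n)⁻¹ * (G (Sum.inl s.1) s.2 (x + v) - G (Sum.inl s.1) s.2 x)) ^ 2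
  have he : Integrable e :=
    integrable_finsetSum _ fun s _ => (memLp_diffQuot (hG (Sum.inl s.1) s.2) v (t n)).integrable_sq
  have hI0 : Integrable fun x => η x ^ 2 * e x := by
    refine he.bdd_mul (c := H ^ 2) (hη.continuous.pow 2).aestronglyMeasurable
      (Eventually.of_forall fun x => ?_)
    rw [norm_pow]
    exact pow_le_pow_left₀ (norm_nonneg _) (hH x) 2
  have hPv : Integrable fun x => P (x + v) ^ 2 := hP.integrable_sq.comp_add_right v
  have hstep : ∫ x, ((η (x + v) * P (x + v) - η x * P x) / t n) ^ 2 ≤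
      ∫ x, (2 * (η x ^ 2 * e x) + 2 * ((Lη : ℝ) ^ 2 * P (x + v) ^ 2)) := by
    refine integral_mono_of_nonneg (Eventually.of_forall fun x => sq_nonneg _)
      ((hI0.const_mul 2).add ((hPv.const_mul _).const_mul 2)) (Eventually.of_forall fun x => ?_)
    simp only
    -- Discrete Leibniz rule: the first term is controlled by the energy estimate, the second by the
    -- Lipschitz constant of the cutoff.
    have hdiv : (η (x + v) * P (x + v) - η x * P x) / t n =
        η x * ((t n)⁻¹ * (P (x + v) - P x)) + (t n)⁻¹ * (η (x + v) - η x) * P (x + v) := by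
      field_simp; ring
    have h1 : ((t n)⁻¹ * (P (x + v) - P x)) ^ 2 ≤ e x :=
      Finset.single_le_sum (f := fun s : I × Fin 2 =>
        ((t n)⁻¹ * (G (Sum.inl s.1) s.2 (x + v) - G (Sum.inl s.1) s.2 x)) ^ 2)
        (fun _ _ => sq_nonneg _) (Finset.mem_univ s)
    have h2 : |(t n)⁻¹ * (η (x + v) - η x)| ≤ Lη := by
      rw [abs_mul, abs_inv, abs_of_pos (ht0 n), inv_mul_le_iff₀ (ht0 n), ← Real.dist_eq]
      refine (hLη.dist_le_mul _ _).trans (le_of_eq ?_)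
      rw [dist_eq_norm, add_sub_cancel_left, norm_smul, Real.norm_of_nonneg (ht0 n).le]
      simp [coordVec, mul_comm]
    have h3 : ((t n)⁻¹ * (η (x + v) - η x)) ^ 2 ≤ (Lη : ℝ) ^ 2 := by
      rw [← sq_abs]; exact pow_le_pow_left₀ (abs_nonneg _) h2 2
    rw [hdiv]
    have h4 := mul_le_mul_of_nonneg_left h1 (sq_nonneg (η x))
    have h5 := mul_le_mul_of_nonneg_right h3 (sq_nonneg (P (x + v)))
    nlinarith [sq_nonneg (η x * ((t n)⁻¹ * (P (x + v) - P x)) -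
      (t n)⁻¹ * (η (x + v) - η x) * P (x + v))]
  refine hstep.trans ?_
  rw [integral_add (hI0.const_mul 2) ((hPv.const_mul _).const_mul 2), integral_const_mul,
    integral_const_mul, integral_const_mul, integral_add_right_eq_self (fun x => P x ^ 2) v]
  linarith

end SecondDerivatives

/-! ### Hole filling: decay of the energy on balls. -/

section HoleFilling

/-- One fixed bump is rescaled, so `C₀` is independent of centre and radius; this makes the
hole-filling factor uniform. The gradient vanishes on the inner ball, which creates the hole. -/
theorem exists_scaled_cutoff : ∃ C₀, 0 ≤ C₀ ∧ ∀ (y : Plane) (ρ : ℝ), 0 < ρ → ∃ η : Plane → ℝ,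
    ContDiff ℝ ∞ η ∧ HasCompactSupport η ∧ (∀ x, 0 ≤ η x) ∧ (∀ x, η x ≤ 1) ∧
    (∀ x ∈ Metric.ball y ρ, η x = 1) ∧ tsupport η ⊆ Metric.closedBall y (2 * ρ) ∧
    (∀ x, gradAbs η x ≤ C₀ / ρ) ∧ ∀ x ∈ Metric.ball y ρ, gradAbs η x = 0 := by
  set β : ContDiffBump (0 : Plane) := ⟨1, 2, one_pos, one_lt_two⟩
  have hβ : ContDiff ℝ ∞ (β : Plane → ℝ) := β.contDiff
  obtain ⟨C₀, hC₀⟩ := (hasCompactSupport_gradAbs β.hasCompactSupport).exists_bound_of_continuous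
    (continuous_gradAbs hβ)
  refine ⟨C₀, (norm_nonneg _).trans (hC₀ 0), fun y ρ hρ => ?_⟩
  set S : Plane → Plane := fun x => ρ⁻¹ • (x - y)
  have hS : ContDiff ℝ ∞ S := (contDiff_id.sub contDiff_const).const_smul _
  have hSd : ∀ x, HasFDerivAt S (ρ⁻¹ • ContinuousLinearMap.id ℝ Plane) x := fun x =>
    ((hasFDerivAt_id x).sub_const y).const_smul ρ⁻¹
  have hη : ContDiff ℝ ∞ fun x => β (S x) := hβ.comp hS
  have hnS : ∀ x, ‖S x‖ = ρ⁻¹ * dist x y := fun x => by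
    rw [norm_smul, Real.norm_of_nonneg (by positivity), dist_eq_norm]
  have hsupp : tsupport (fun x => β (S x)) ⊆ Metric.closedBall y (2 * ρ) := by
    refine closure_minimal (fun x hx => ?_) Metric.isClosed_closedBall
    by_contra h
    refine hx (β.zero_of_le_dist ?_)
    rw [Metric.mem_closedBall, not_le] at h
    rw [dist_zero_right, hnS, inv_mul_eq_div, le_div_iff₀ hρ]
    exact h.le
  have hderiv : ∀ x j, fderiv ℝ (fun x => β (S x)) x (coordVec j) =
      ρ⁻¹ * fderiv ℝ β (S x) (coordVec j) := fun x j => by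
    have h := ((hβ.differentiable (by simp) (S x)).hasFDerivAt.comp x (hSd x)).fderiv
    rw [show (fun x => β (S x)) = β ∘ S from rfl, h]
    simp
  have hgrad : ∀ x, gradAbs (fun x => β (S x)) x = ρ⁻¹ * gradAbs β (S x) := fun x => by
    simp only [gradAbs, hderiv, abs_mul, abs_of_pos (inv_pos.2 hρ)]
    ring
  have hball : ∀ x ∈ Metric.ball y ρ, S x ∈ Metric.ball (0 : Plane) 1 := fun x hx => by
    rw [mem_ball_zero_iff, hnS, inv_mul_eq_div, div_lt_one hρ]
    exact hx
  refine ⟨fun x => β (S x), hη, HasCompactSupport.of_support_subset_isCompact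
    (isCompact_closedBall y (2 * ρ)) ((subset_tsupport _).trans hsupp), fun x => β.nonneg,
    fun x => β.le_one, fun x hx => β.one_of_mem_closedBall (Metric.ball_subset_closedBall
    (hball x hx)), hsupp, fun x => ?_, fun x hx => ?_⟩
  · rw [hgrad, div_eq_inv_mul]
    exact mul_le_mul_of_nonneg_left ((le_abs_self _).trans (hC₀ _)) (by positivity)
  · have h : (β : Plane → ℝ) =ᶠ[𝓝 (S x)] fun _ => 1 := by
      filter_upwards [Metric.isOpen_ball.mem_nhds (hball x hx)] with z hz
      exact β.one_of_mem_closedBall (Metric.ball_subset_closedBall hz)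
    rw [hgrad]
    simp [gradAbs, h.fderiv_eq]

variable {α : Type*} [Fintype α]

/-- The hole-filling inequality for the energy of a weak solution. -/
theorem exists_hole_filling (c : α → α → ℝ) (L : ℝ) (hL : 0 ≤ L) :
    ∃ θ, 0 < θ ∧ θ < 1 ∧ ∀ {W : α → Plane → ℝ} {M : α → Fin 2 → Plane → ℝ},
    (∀ a, MemLp (W a) 2) → (∀ a j, MemLp (M a j) 2) →
    (∀ a j, HasWeakPartialDeriv Set.univ j (W a) (M a j)) →
    ∀ {e : Plane → ℝ}, Integrable e → (∀ x, 0 ≤ e x) → ∀ {U : Set Plane},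
    (∀ᵐ x, x ∈ U → e x ≤ detForm c fun a j => M a j x) →
    (∀ᵐ x, x ∈ U → ∑ a, ∑ j, |M a j x| ≤ L * Real.sqrt (e x)) →
    ∀ (y : Plane) (ρ : ℝ), 0 < ρ → Metric.ball y (9 * ρ) ⊆ U →
    ∫ x in Metric.ball y ρ, e x ≤ θ * ∫ x in Metric.ball y (9 * ρ), e x := by
  obtain ⟨C₀, hC₀, hcut⟩ := exists_scaled_cutoff
  set K₁ := (2 * ∑ a, ∑ b, |c a b|) * L
  have hK₁ : 0 ≤ K₁ := by positivity
  -- The cardinality comes from Cauchy–Schwarz over the components, and `144 = 16 * 3 ^ 2` from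
  -- Poincaré on the ball of radius `3 ρ`.
  set K₂ := C₀ ^ 2 * (Fintype.card α * (144 * L ^ 2))
  have hK₂ : 0 ≤ K₂ := by positivity
  -- The parameter in Young's inequality, large enough that `K₁ * K₂ / (2 * s) ≤ 1 / 4`.
  set s := 2 * K₁ * K₂ + 1
  have hs : 0 < s := by positivity
  set K := K₁ * (s / 2)
  have hK : 0 ≤ K := by positivity
  -- With energies `φ₁` and `φ₉` on the small and large balls, the estimate reads `φ₁ ≤ K (φ₉ - φ₁)
  -- + φ₉ / 4`; adding `K φ₁` to both sides fills the hole and gives this factor.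
  refine ⟨(K + 1 / 4) / (K + 1), by positivity, by rw [div_lt_one (by positivity)]; linarith, ?_⟩
  intro W M hW hM hWM e he he0 U heQ hML y ρ hρ hyU
  obtain ⟨η, hη, hηc, hη0, hη1, hη1', hηs, hgr, hgr0⟩ := hcut y ρ hρ
  set B₁ := Metric.ball y ρ
  set B₃ := Metric.ball y (3 * ρ)
  set B₉ := Metric.ball y (9 * ρ)
  have h13 : B₁ ⊆ B₃ := Metric.ball_subset_ball (by linarith)
  have h39 : B₃ ⊆ B₉ := Metric.ball_subset_ball (by linarith)
  have hη3 : tsupport η ⊆ B₃ := hηs.trans (Metric.closedBall_subset_ball (by linarith))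
  -- Means over `B₃` allow Poincaré there, whose energy lives on a ball three times larger; hence
  -- the factor nine between the balls compared.
  set κ : α → ℝ := fun a => ⨍ z in B₃, W a z
  have hcac := caccioppoli c hW hM hWM hη hηc κ he he0
    (heQ.mono fun x hx hxη => hx (hyU (h39 (hη3 hxη))))
    (hML.mono fun x hx hxη => hx (hyU (h39 (hη3 hxη))))
  have hB1m : MeasurableSet B₁ := Metric.isOpen_ball.measurableSet
  have hB3m : MeasurableSet B₃ := Metric.isOpen_ball.measurableSet
  have hB9m : MeasurableSet B₉ := Metric.isOpen_ball.measurableSet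
  have hB3t : volume B₃ ≠ ⊤ := measure_ball_lt_top.ne
  have hWκ : ∀ a, IntegrableOn (fun x => (W a x - κ a) ^ 2) B₃ := fun a => by
    have : IsFiniteMeasure (volume.restrict B₃) := ⟨by
      rw [Measure.restrict_apply_univ]; exact hB3t.lt_top⟩
    have h : MemLp (fun x => W a x - κ a) 2 (volume.restrict B₃) :=
      ((hW a).restrict B₃).sub (memLp_const _)
    exact h.integrable_sq
  have hlow : ∫ x in B₁, e x ≤ ∫ x, η x ^ 2 * e x := by
    have hint : Integrable fun x => η x ^ 2 * e x := by
      refine he.bdd_mul (c := 1) (hη.continuous.pow 2).aestronglyMeasurable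
        (Eventually.of_forall fun x => ?_)
      rw [Real.norm_of_nonneg (by positivity)]
      exact pow_le_one₀ (hη0 x) (hη1 x)
    refine le_trans (le_of_eq ?_) (setIntegral_le_integral (s := B₁) hint
      (Eventually.of_forall fun x => mul_nonneg (sq_nonneg _) (he0 x)))
    refine setIntegral_congr_fun hB1m fun x hx => ?_
    simp [hη1' x hx]
  -- Since the cutoff gradient vanishes on `B₁`, the energy in Young's inequality is charged only to
  -- `B₃ \ B₁`.
  have hptw : ∀ x, |η x| * Real.sqrt (e x) * (gradAbs η x * ∑ a, |W a x - κ a|) ≤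
      (B₃ \ B₁).indicator (fun x => s / 2 * e x) x + B₃.indicator (fun x =>
        (C₀ / ρ) ^ 2 / (2 * s) * (Fintype.card α * ∑ a, (W a x - κ a) ^ 2)) x := by
    intro x
    have hnn : 0 ≤ B₃.indicator (fun x =>
        (C₀ / ρ) ^ 2 / (2 * s) * (Fintype.card α * ∑ a, (W a x - κ a) ^ 2)) x :=
      Set.indicator_nonneg (fun x _ => by positivity) x
    by_cases hx1 : x ∈ B₁
    · rw [hgr0 x hx1, Set.indicator_of_notMem fun h => h.2 hx1]
      simpa using hnn
    by_cases hx3 : x ∈ B₃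
    · have hx31 : x ∈ B₃ \ B₁ := Set.mem_sdiff_of_mem hx3 hx1
      rw [Set.indicator_of_mem hx31, Set.indicator_of_mem hx3]
      set T := ∑ a, |W a x - κ a|
      have hT : 0 ≤ T := Finset.sum_nonneg fun a _ => abs_nonneg _
      have hT2 : T ^ 2 ≤ Fintype.card α * ∑ a, (W a x - κ a) ^ 2 := sum_abs_sq_le _
      have h1 : |η x| * Real.sqrt (e x) * (gradAbs η x * T) ≤
          Real.sqrt (e x) * (C₀ / ρ * T) := by
        rw [abs_of_nonneg (hη0 x)]
        refine mul_le_mul (mul_le_of_le_one_left (Real.sqrt_nonneg _) (hη1 x))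
          (mul_le_mul_of_nonneg_right (hgr x) hT) (mul_nonneg (gradAbs_nonneg _ _) hT)
          (Real.sqrt_nonneg _)
      have h2 : Real.sqrt (e x) * (C₀ / ρ * T) ≤
          s / 2 * e x + (C₀ / ρ) ^ 2 / (2 * s) * T ^ 2 := by
        have h3 := Real.sq_sqrt (he0 x)
        set q := Real.sqrt (e x)
        rw [← h3]
        have : s / 2 * q ^ 2 + (C₀ / ρ) ^ 2 / (2 * s) * T ^ 2 - q * (C₀ / ρ * T) =
          (s * q - C₀ / ρ * T) ^ 2 / (2 * s) := by
          field_simp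
          ring
        have h4 : 0 ≤ (s * q - C₀ / ρ * T) ^ 2 / (2 * s) := by positivity
        linarith
      exact h1.trans (h2.trans (add_le_add_right
        (mul_le_mul_of_nonneg_left hT2 (by positivity)) _))
    · have : x ∉ tsupport η := fun h => hx3 (hη3 h)
      rw [gradAbs_eq_zero this, Set.indicator_of_notMem fun h => hx3 h.1]
      simpa using hnn
  have hi1 : Integrable ((B₃ \ B₁).indicator fun x => s / 2 * e x) :=
    (he.const_mul _).indicator (hB3m.diff hB1m)
  have hi2 : Integrable (B₃.indicator fun x =>
      (C₀ / ρ) ^ 2 / (2 * s) * (Fintype.card α * ∑ a, (W a x - κ a) ^ 2)) :=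
    (integrable_indicator_iff hB3m).2
      (((integrable_finsetSum _ fun a _ => hWκ a).const_mul _).const_mul _)
  have hup : ∫ x, |η x| * Real.sqrt (e x) * (gradAbs η x * ∑ a, |W a x - κ a|) ≤
      (s / 2) * (∫ x in B₃ \ B₁, e x) + (C₀ / ρ) ^ 2 / (2 * s) * (Fintype.card α *
        ∑ a, ∫ x in B₃, (W a x - κ a) ^ 2) := by
    refine (integral_mono_of_nonneg (Eventually.of_forall fun x => ?_) (hi1.add hi2)
      (Eventually.of_forall hptw)).trans (le_of_eq ?_)
    · exact mul_nonneg (by positivity) (mul_nonneg (gradAbs_nonneg _ _) (by positivity))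
    · refine (integral_add hi1 hi2).trans ?_
      rw [integral_indicator (hB3m.diff hB1m), integral_indicator hB3m, integral_const_mul,
        integral_const_mul, integral_const_mul, integral_finsetSum _ fun a _ => hWκ a]
  have hpoinc : ∑ a, ∫ x in B₃, (W a x - κ a) ^ 2 ≤ 144 * ρ ^ 2 * (L ^ 2 * ∫ x in B₉, e x) := by
    have h1 : ∀ a, ∫ x in B₃, (W a x - κ a) ^ 2 ≤
        16 * (3 * ρ) ^ 2 * ∫ x in B₉, gradSq (M a) x := fun a => by
      have := setIntegral_sub_average_sq_le_gradSq (hW a) (hM a) (hWM a) y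
        (R := 3 * ρ) (by positivity)
      rwa [show 3 * (3 * ρ) = 9 * ρ by ring] at this
    have h2 : ∑ a, ∫ x in B₉, gradSq (M a) x ≤ L ^ 2 * ∫ x in B₉, e x := by
      rw [← integral_finsetSum _ fun a _ => (integrable_gradSq (hM a)).integrableOn,
        ← integral_const_mul]
      refine integral_mono_ae (integrable_finsetSum _ fun a _ =>
        (integrable_gradSq (hM a)).integrableOn) (he.integrableOn.const_mul _) ?_
      filter_upwards [ae_restrict_of_ae hML, ae_restrict_mem hB9m] with x hx hx9
      have h3 := hx (hyU hx9)
      have h4 : ∑ a, gradSq (M a) x ≤ (∑ a, ∑ j, |M a j x|) ^ 2 := by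
        have h5 : ∀ a, gradSq (M a) x ≤ (∑ j, |M a j x|) ^ 2 := fun a => by
          rw [Fin.sum_univ_two, gradSq, add_sq, sq_abs, sq_abs]
          nlinarith [mul_nonneg (abs_nonneg (M a 0 x)) (abs_nonneg (M a 1 x))]
        refine (Finset.sum_le_sum fun a _ => h5 a).trans ?_
        exact Finset.sum_sq_le_sq_sum_of_nonneg fun a _ =>
          Finset.sum_nonneg fun j _ => abs_nonneg _
      calc ∑ a, gradSq (M a) x ≤ (∑ a, ∑ j, |M a j x|) ^ 2 := h4
        _ ≤ (L * Real.sqrt (e x)) ^ 2 := pow_le_pow_left₀ (by positivity) h3 2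
        _ = L ^ 2 * e x := by rw [mul_pow, Real.sq_sqrt (he0 x)]
    calc _ ≤ ∑ a, 16 * (3 * ρ) ^ 2 * ∫ x in B₉, gradSq (M a) x :=
          Finset.sum_le_sum fun a _ => h1 a
      _ = 144 * ρ ^ 2 * ∑ a, ∫ x in B₉, gradSq (M a) x := by
          rw [← Finset.mul_sum]; ring
      _ ≤ _ := mul_le_mul_of_nonneg_left h2 (by positivity)
  set φ₁ := ∫ x in B₁, e x
  set φ₉ := ∫ x in B₉, e x
  have hφ₉ : 0 ≤ φ₉ := integral_nonneg he0
  have hann : ∫ x in B₃ \ B₁, e x ≤ φ₉ - φ₁ := by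
    rw [setIntegral_sdiff hB1m he.integrableOn h13]
    exact sub_le_sub_right (setIntegral_mono_set he.integrableOn
      (Eventually.of_forall he0) h39.eventuallyLE) _
  have hsecond : K₁ * ((C₀ / ρ) ^ 2 / (2 * s) * (Fintype.card α *
        ∑ a, ∫ x in B₃, (W a x - κ a) ^ 2)) ≤ 1 / 4 * φ₉ := by
    calc _ ≤ K₁ * ((C₀ / ρ) ^ 2 / (2 * s) * (Fintype.card α *
          (144 * ρ ^ 2 * (L ^ 2 * φ₉)))) := by
          refine mul_le_mul_of_nonneg_left (mul_le_mul_of_nonneg_left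
            (mul_le_mul_of_nonneg_left hpoinc ?_) ?_) hK₁ <;> positivity
      _ = K₁ * K₂ / (2 * s) * φ₉ := by
          simp only [K₂]
          field_simp
      _ ≤ 1 / 4 * φ₉ := by
          refine mul_le_mul_of_nonneg_right ?_ hφ₉
          rw [div_le_iff₀ (by positivity)]
          simp only [s]
          nlinarith [mul_nonneg hK₁ hK₂]
  have hmain : φ₁ ≤ K * (φ₉ - φ₁) + 1 / 4 * φ₉ := by
    calc φ₁ ≤ K₁ * (s / 2 * (∫ x in B₃ \ B₁, e x) + (C₀ / ρ) ^ 2 / (2 * s) * (Fintype.card α *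
        ∑ a, ∫ x in B₃, (W a x - κ a) ^ 2)) :=
          hlow.trans (hcac.trans (mul_le_mul_of_nonneg_left hup hK₁))
      _ = K * (∫ x in B₃ \ B₁, e x) + K₁ * ((C₀ / ρ) ^ 2 / (2 * s) * (Fintype.card α *
        ∑ a, ∫ x in B₃, (W a x - κ a) ^ 2)) := by simp only [K]; ring
      _ ≤ _ := add_le_add (mul_le_mul_of_nonneg_left hann hK) hsecond
  rw [div_mul_eq_mul_div, le_div_iff₀ (by positivity)]
  linarith

end HoleFilling

/-! ### Averages over balls and how they vary. -/

section Averages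

theorem volume_real_ball (y : Plane) {r : ℝ} (hr : 0 ≤ r) :
    volume.real (Metric.ball y r) = Real.pi * r ^ 2 := by
  rw [measureReal_def, EuclideanSpace.volume_ball_fin_two, ENNReal.toReal_mul, ENNReal.toReal_pow,
    ENNReal.toReal_ofReal hr, mul_comm]
  simp [Real.pi_pos.le]

theorem sq_setAverage_ball_sub_le {f : Plane → ℝ} (hf : MemLp f 2) (y : Plane) {r : ℝ} (hr : 0 < r)
    (κ : ℝ) :
    ((⨍ x in Metric.ball y r, f x) - κ) ^ 2 ≤
      (Real.pi * r ^ 2)⁻¹ * ∫ x in Metric.ball y r, (f x - κ) ^ 2 := by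
  have h0 : volume (Metric.ball y r) ≠ 0 := (Metric.measure_ball_pos volume y hr).ne'
  have ht : volume (Metric.ball y r) ≠ ⊤ := measure_ball_lt_top.ne
  have : IsFiniteMeasure (volume.restrict (Metric.ball y r)) := ⟨by
    rw [Measure.restrict_apply_univ]; exact ht.lt_top⟩
  have hfr : MemLp f 2 (volume.restrict (Metric.ball y r)) := hf.restrict _
  have hsub : MemLp (fun x => f x - κ) 2 (volume.restrict (Metric.ball y r)) :=
    hfr.sub (memLp_const _)
  have hJ := (even_two.convexOn_pow (𝕜 := ℝ)).map_set_average_le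
    (continuous_pow 2).continuousOn isClosed_univ h0 ht (f := fun x => f x - κ)
    (Eventually.of_forall fun _ => Set.mem_univ _) (hsub.integrable (by norm_num))
    hsub.integrable_sq
  have hav : (⨍ x in Metric.ball y r, (f x - κ)) = (⨍ x in Metric.ball y r, f x) - κ := by
    rw [setAverage_eq, setAverage_eq, integral_sub (hfr.integrable (by norm_num))
      (integrable_const _), smul_sub]
    congr 1
    rw [setIntegral_const, smul_smul, inv_mul_cancel₀, one_smul]
    exact (ENNReal.toReal_pos h0 ht).ne'
  rw [hav] at hJ
  refine hJ.trans (le_of_eq ?_)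
  rw [setAverage_eq, volume_real_ball y hr.le, smul_eq_mul]

theorem setAverage_translate (f : Plane → ℝ) (x v : Plane) (r : ℝ) :
    (⨍ z in Metric.ball (x + v) r, f z) = ⨍ z in Metric.ball x r, f (z + v) := by
  have hmp := measurePreserving_add_right (volume : Measure Plane) v
  have hpre : (fun z => z + v) ⁻¹' Metric.ball (x + v) r = Metric.ball x r := by
    ext z; simp
  rw [setAverage_eq, setAverage_eq, ← hpre,
    hmp.setIntegral_preimage_emb (MeasurableEquiv.addRight v).measurableEmbedding, measureReal_def,
    measureReal_def, hmp.measure_preimage Metric.isOpen_ball.measurableSet.nullMeasurableSet]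

/-- At a fixed radius the mean is Lipschitz in the centre: the difference is the mean of `f (z + v)
- f z`, controlled by Jensen and the translation estimate. -/
theorem sq_setAverage_translate_sub_le {f : Plane → ℝ} {g : Fin 2 → Plane → ℝ} (hf : MemLp f 2)
    (hg : ∀ i, MemLp (g i) 2) (hfg : ∀ i, HasWeakPartialDeriv Set.univ i f (g i)) (x v : Plane)
    {r : ℝ} (hr : 0 < r) :
    ((⨍ z in Metric.ball (x + v) r, f z) - ⨍ z in Metric.ball x r, f z) ^ 2 ≤
      (Real.pi * r ^ 2)⁻¹ * (‖v‖ ^ 2 * ∫ z, gradSq g z) := by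
  have ht : volume (Metric.ball x r) ≠ ⊤ := measure_ball_lt_top.ne
  have : IsFiniteMeasure (volume.restrict (Metric.ball x r)) := ⟨by
    rw [Measure.restrict_apply_univ]; exact ht.lt_top⟩
  have htr : MemLp (fun x => f (x + v)) 2 :=
    hf.comp_measurePreserving (measurePreserving_add_right (volume : Measure Plane) v)
  have hav : (⨍ z in Metric.ball (x + v) r, f z) - (⨍ z in Metric.ball x r, f z) =
      (⨍ z in Metric.ball x r, (f (z + v) - f z)) - 0 := by
    rw [setAverage_translate, setAverage_eq, setAverage_eq, setAverage_eq,
      integral_sub ((htr.restrict _).integrable (by norm_num))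
        ((hf.restrict _).integrable (by norm_num)), smul_sub, sub_zero]
  rw [hav]
  refine (sq_setAverage_ball_sub_le (htr.sub hf) x hr 0).trans ?_
  refine mul_le_mul_of_nonneg_left ?_ (by positivity)
  have h := setIntegral_translate_sub_sq_le hf hg hfg v
    (Metric.isOpen_ball (x := x) (ε := r)).measurableSet MeasurableSet.univ
    (fun _ _ _ _ => Set.mem_univ _)
  simpa using h

/-- In the plane the factor `R²` in Poincaré cancels the area, so the change of mean between scales
is bounded by energy alone. The ratio nine matches hole filling, and `1296 = 16 * 81`. -/
theorem abs_setAverage_ninth_sub_le {f : Plane → ℝ} {g : Fin 2 → Plane → ℝ} (hf : MemLp f 2)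
    (hg : ∀ i, MemLp (g i) 2) (hfg : ∀ i, HasWeakPartialDeriv Set.univ i f (g i)) (y : Plane)
    {r : ℝ} (hr : 0 < r) :
    ((⨍ z in Metric.ball y (r / 9), f z) - ⨍ z in Metric.ball y r, f z) ^ 2 ≤
      1296 * ∫ z in Metric.ball y (3 * r), gradSq g z := by
  have ht : volume (Metric.ball y r) ≠ ⊤ := measure_ball_lt_top.ne
  have : IsFiniteMeasure (volume.restrict (Metric.ball y r)) := ⟨by
    rw [Measure.restrict_apply_univ]; exact ht.lt_top⟩
  set κ := ⨍ z in Metric.ball y r, f z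
  have hI : IntegrableOn (fun x => (f x - κ) ^ 2) (Metric.ball y r) :=
    MemLp.integrable_sq (f := fun x => f x - κ) ((hf.restrict _).sub (memLp_const _))
  have h1 := sq_setAverage_ball_sub_le hf y (r := r / 9) (by positivity) κ
  have h2 : ∫ x in Metric.ball y (r / 9), (f x - κ) ^ 2 ≤
      ∫ x in Metric.ball y r, (f x - κ) ^ 2 :=
    setIntegral_mono_set hI (Eventually.of_forall fun _ => sq_nonneg _)
      (Metric.ball_subset_ball (by linarith)).eventuallyLE
  have h3 := setIntegral_sub_average_sq_le_gradSq hf hg hfg y hr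
  set I := ∫ z in Metric.ball y (3 * r), gradSq g z
  have hI0 : 0 ≤ I := integral_nonneg fun _ => gradSq_nonneg _ _
  calc _ ≤ (Real.pi * (r / 9) ^ 2)⁻¹ * (16 * r ^ 2 * I) :=
        h1.trans (mul_le_mul_of_nonneg_left (h2.trans h3) (by positivity))
    _ = 1296 / Real.pi * I := by field_simp; norm_num; ring
    _ ≤ 1296 * I := by
        refine mul_le_mul_of_nonneg_right ?_ hI0
        rw [div_le_iff₀ Real.pi_pos]
        linarith [Real.pi_gt_three]

/-- Lebesgue differentiation is available for closed balls; open balls have the same averages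
because spheres are null. -/
theorem ae_tendsto_setAverage_ball {f : Plane → ℝ} (hf : MemLp f 2) {r : ℕ → ℝ}
    (hr : ∀ n, 0 < r n) (hr0 : Tendsto r atTop (𝓝 0)) :
    ∀ᵐ y, Tendsto (fun n => ⨍ z in Metric.ball y (r n), f z) atTop (𝓝 (f y)) := by
  have hloc : LocallyIntegrable f := hf.locallyIntegrable (by norm_num)
  filter_upwards [IsUnifLocDoublingMeasure.ae_tendsto_average volume hloc 1] with y hy
  have h := hy (l := atTop) (fun _ : ℕ => y) r
    (tendsto_nhdsWithin_iff.2 ⟨hr0, Eventually.of_forall hr⟩)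
    (Eventually.of_forall fun n => Metric.mem_closedBall_self (by simpa using (hr n).le))
  refine h.congr fun n => setAverage_congr ?_
  refine (ae_eq_of_subset_of_measure_ge Metric.ball_subset_closedBall ?_
    Metric.isOpen_ball.measurableSet.nullMeasurableSet measure_closedBall_lt_top.ne).symm
  rw [Measure.addHaar_closedBall_eq_addHaar_ball]

end Averages

/-! ### Essential continuity from energy decay. -/

section Continuity

variable {α : Type*} [Fintype α]

/-- Weak solutions of a planar elliptic system are essentially continuous. -/
theorem exists_essential_limit (c : α → α → ℝ) {L : ℝ} (hL : 0 ≤ L) {W : α → Plane → ℝ}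
    {M : α → Fin 2 → Plane → ℝ} (hW : ∀ a, MemLp (W a) 2) (hM : ∀ a j, MemLp (M a j) 2)
    (hWM : ∀ a j, HasWeakPartialDeriv Set.univ j (W a) (M a j)) {e : Plane → ℝ}
    (he : Integrable e) (he0 : ∀ x, 0 ≤ e x) {x₀ : Plane} {R : ℝ} (hR : 0 < R)
    (heQ : ∀ᵐ x, x ∈ Metric.ball x₀ (2 * R) → e x ≤ detForm c fun a j => M a j x)
    (hML : ∀ᵐ x, x ∈ Metric.ball x₀ (2 * R) → ∑ a, ∑ j, |M a j x| ≤ L * Real.sqrt (e x)) (a : α) :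
    ∃ w, ∀ δ > 0, ∃ r > 0, ∀ᵐ x, x ∈ Metric.ball x₀ r → |W a x - w| ≤ δ := by
  obtain ⟨θ, hθ0, hθ1, hhole⟩ := exists_hole_filling c L hL
  set E := ∫ x, e x
  have hE : 0 ≤ E := integral_nonneg he0
  -- Iterated hole filling, uniform in the centre `y`.
  have hdecay : ∀ y ∈ Metric.ball x₀ R, ∀ n : ℕ,
      ∫ x in Metric.ball y (R / 9 ^ n), e x ≤ θ ^ n * E := by
    intro y hy n
    induction n with
    | zero =>
      simp only [pow_zero, div_one, one_mul]
      exact setIntegral_le_integral he (Eventually.of_forall he0)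
    | succ n ih =>
      have hpos : 0 < R / 9 ^ (n + 1) := by positivity
      have h9 : 9 * (R / 9 ^ (n + 1)) = R / 9 ^ n := by rw [pow_succ]; field_simp
      have hsub : Metric.ball y (9 * (R / 9 ^ (n + 1))) ⊆ Metric.ball x₀ (2 * R) := by
        rw [h9]
        refine Metric.ball_subset_ball' ?_
        have : R / 9 ^ n ≤ R := div_le_self hR.le (one_le_pow₀ (by norm_num))
        have := Metric.mem_ball.1 hy
        linarith
      have h := hhole hW hM hWM he he0 heQ hML y _ hpos hsub
      rw [h9] at h
      refine h.trans ?_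
      rw [pow_succ', mul_assoc]
      exact mul_le_mul_of_nonneg_left ih hθ0.le
  -- Division by three makes the tripled ball of Poincaré's inequality exactly the ball on which the
  -- decay is known.
  set r : ℕ → ℝ := fun n => R / 9 ^ n / 3
  have hr : ∀ n, 0 < r n := fun n => by positivity
  have hr0 : Tendsto r atTop (𝓝 0) := by
    have h := ((tendsto_pow_atTop_nhds_zero_of_lt_one (r := (1 / 9 : ℝ)) (by norm_num)
      (by norm_num)).const_mul (R / 3))
    rw [mul_zero] at h
    refine h.congr fun n => ?_
    simp only [r]
    rw [one_div, inv_pow]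
    field_simp
  have hgrad : ∀ᵐ x, x ∈ Metric.ball x₀ (2 * R) → gradSq (M a) x ≤ L ^ 2 * e x := by
    filter_upwards [hML] with x hx hxb
    have h1 : |M a 0 x| + |M a 1 x| ≤ L * Real.sqrt (e x) := by
      refine le_trans ?_ (hx hxb)
      have := Finset.single_le_sum (f := fun b => ∑ j, |M b j x|)
        (fun b _ => Finset.sum_nonneg fun j _ => abs_nonneg _) (Finset.mem_univ a)
      rwa [Fin.sum_univ_two] at this
    have h2 := pow_le_pow_left₀ (by positivity) h1 2
    rw [mul_pow, Real.sq_sqrt (he0 x)] at h2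
    unfold gradSq
    rw [← sq_abs (M a 0 x), ← sq_abs (M a 1 x)]
    nlinarith [mul_nonneg (abs_nonneg (M a 0 x)) (abs_nonneg (M a 1 x))]
  set A : Plane → ℕ → ℝ := fun y n => ⨍ z in Metric.ball y (r n), W a z
  -- Increments of means are bounded by the square root of the energy, so they form a geometric
  -- series of ratio `√θ`.
  set l := Real.sqrt θ
  have hl1 : l < 1 := by rw [Real.sqrt_lt' one_pos]; simpa
  have hl0 : 0 ≤ l := Real.sqrt_nonneg _
  set C := Real.sqrt (1296 * (L ^ 2 * E))
  have hC : 0 ≤ C := Real.sqrt_nonneg _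
  have hstep : ∀ y ∈ Metric.ball x₀ R, ∀ n, dist (A y n) (A y (n + 1)) ≤ C * l ^ n := by
    intro y hy n
    have h1 := abs_setAverage_ninth_sub_le (hW a) (hM a) (hWM a) y (hr n)
    have hrn : r n / 9 = r (n + 1) := by simp only [r, pow_succ]; field_simp
    have hrn3 : 3 * r n = R / 9 ^ n := by simp only [r]; ring
    rw [hrn, hrn3] at h1
    have hsub : Metric.ball y (R / 9 ^ n) ⊆ Metric.ball x₀ (2 * R) := by
      refine Metric.ball_subset_ball' ?_
      have : R / 9 ^ n ≤ R := div_le_self hR.le (one_le_pow₀ (by norm_num))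
      have := Metric.mem_ball.1 hy
      linarith
    have h2 : ∫ z in Metric.ball y (R / 9 ^ n), gradSq (M a) z ≤ L ^ 2 * (θ ^ n * E) := by
      refine le_trans ?_ (mul_le_mul_of_nonneg_left (hdecay y hy n) (sq_nonneg L))
      rw [← integral_const_mul]
      refine integral_mono_ae (integrable_gradSq (hM a)).integrableOn
        (he.integrableOn.const_mul _) ?_
      filter_upwards [ae_restrict_of_ae hgrad, ae_restrict_mem Metric.isOpen_ball.measurableSet]
        with x hx hxb
      exact hx (hsub hxb)
    rw [dist_comm, Real.dist_eq]
    refine abs_le_of_sq_le_sq ?_ (by positivity)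
    have h3 : (C * l ^ n) ^ 2 = 1296 * (L ^ 2 * E) * θ ^ n := by
      rw [mul_pow, ← pow_mul, mul_comm n 2, pow_mul, Real.sq_sqrt (by positivity),
        Real.sq_sqrt hθ0.le]
    rw [h3]
    exact h1.trans (by nlinarith)
  have hx₀ : x₀ ∈ Metric.ball x₀ R := Metric.mem_ball_self hR
  -- The limit of the means at `x₀`; the chosen representative of `W a` may take a different value
  -- at that point.
  obtain ⟨w, hw⟩ := cauchySeq_tendsto_of_complete (cauchySeq_of_le_geometric l C hl1 (hstep x₀ hx₀))
  refine ⟨w, fun δ hδ => ?_⟩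
  have htail : Tendsto (fun n => C * l ^ n / (1 - l)) atTop (𝓝 0) := by
    have h := ((tendsto_pow_atTop_nhds_zero_of_lt_one hl0 hl1).const_mul C).div_const (1 - l)
    rwa [mul_zero, zero_div] at h
  obtain ⟨n, hn⟩ := (htail.eventually (gt_mem_nhds (show 0 < δ / 3 by positivity))).exists
  set D := (Real.pi * r n ^ 2)⁻¹ * ∫ z, gradSq (M a) z
  have hD : 0 ≤ D := mul_nonneg (by have := hr n; positivity)
    (integral_nonneg fun _ => gradSq_nonneg _ _)
  -- With the scale `n` fixed by the geometric tail, this radius makes the means at that scale about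
  -- `y` and `x₀` differ by at most `δ / 3`.
  refine ⟨min R (δ / 3 / (Real.sqrt D + 1)), by positivity, ?_⟩
  filter_upwards [ae_tendsto_setAverage_ball (hW a) hr hr0] with y hy hyb
  have hyR : y ∈ Metric.ball x₀ R := Metric.ball_subset_ball (min_le_left _ _) hyb
  have h1 := dist_le_of_le_geometric_of_tendsto l C hl1 (hstep y hyR) hy n
  have h2 := dist_le_of_le_geometric_of_tendsto l C hl1 (hstep x₀ hx₀) hw n
  have h3 : |A y n - A x₀ n| ≤ δ / 3 := by
    have h := sq_setAverage_translate_sub_le (hW a) (hM a) (hWM a) x₀ (y - x₀) (hr n)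
    rw [add_sub_cancel] at h
    refine abs_le_of_sq_le_sq (h.trans ?_) (by positivity)
    have h4 : ‖y - x₀‖ * (Real.sqrt D + 1) ≤ δ / 3 := by
      rw [← le_div_iff₀ (by positivity), ← dist_eq_norm]
      exact (Metric.mem_ball.1 hyb).le.trans (min_le_right _ _)
    have h5 := pow_le_pow_left₀ (by positivity) h4 2
    have h6 : D ≤ (Real.sqrt D + 1) ^ 2 := by
      nlinarith [Real.sq_sqrt hD, Real.sqrt_nonneg D]
    calc _ = ‖y - x₀‖ ^ 2 * D := by simp only [D]; ring
      _ ≤ ‖y - x₀‖ ^ 2 * (Real.sqrt D + 1) ^ 2 := mul_le_mul_of_nonneg_left h6 (sq_nonneg _)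
      _ ≤ _ := by rw [← mul_pow]; exact h5
  rw [Real.dist_eq] at h1 h2
  have h7 : W a y - w = -(A y n - W a y) + (A y n - A x₀ n) + (A x₀ n - w) := by ring
  rw [h7]
  refine (abs_add_three _ _ _).trans ?_
  rw [abs_neg]
  linarith

end Continuity

/-! ### The Fourier transform on L² and orthogonality of squares. -/

section Fourier

open scoped FourierTransform SchwartzMap

/-- Complex valued square integrable functions on the plane. -/
noncomputable abbrev L2C := Lp ℂ 2 (volume : Measure Plane)

theorem integral_schwartz_mul_fourier (f : L2C) (φ : 𝓢(Plane, ℂ)) :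
    ∫ x, φ x * (𝓕 f : L2C) x = ∫ x, 𝓕 φ x * f x := by
  have h := congrArg (fun T => T φ) (Lp.fourier_toTemperedDistribution_eq f)
  simpa [TemperedDistribution.fourier_apply] using h.symm

theorem integral_schwartz_mul_fourierInv (f : L2C) (φ : 𝓢(Plane, ℂ)) :
    ∫ x, φ x * (𝓕⁻ f : L2C) x = ∫ x, 𝓕⁻ φ x * f x := by
  have h := congrArg (fun T => T φ) (Lp.fourierInv_toTemperedDistribution_eq f)
  simpa [TemperedDistribution.fourierInv_apply] using h.symm

theorem ae_eq_of_integral_schwartz_mul {f g : Plane → ℂ} (hf : LocallyIntegrable f)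
    (hg : LocallyIntegrable g)
    (h : ∀ φ : 𝓢(Plane, ℂ), HasCompactSupport φ → ∫ x, φ x * f x = ∫ x, φ x * g x) :
    f =ᵐ[volume] g := by
  refine ae_eq_of_integral_contDiff_smul_eq hf hg fun φ hφ hφc => ?_
  have h₁ : HasCompactSupport (Complex.ofRealCLM ∘ φ) := hφc.comp_left rfl
  have h₂ : ContDiff ℝ ∞ (Complex.ofRealCLM ∘ φ) := Complex.ofRealCLM.contDiff.comp hφ
  simpa using h (h₁.toSchwartzMap h₂) h₁

theorem integral_fourier_mul_schwartz {f : Plane → ℂ} (hf : Integrable f) (φ : 𝓢(Plane, ℂ)) :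
    ∫ x, φ x * 𝓕 f x = ∫ x, 𝓕 φ x * f x := by
  have h := VectorFourier.integral_fourierIntegral_smul_eq_flip (L := innerₗ Plane)
    (μ := volume) (ν := volume) Real.continuous_fourierChar continuous_inner φ.integrable hf
  rw [flip_innerₗ] at h
  exact h.symm

theorem integral_fourierInv_mul_schwartz {f : Plane → ℂ} (hf : Integrable f) (φ : 𝓢(Plane, ℂ)) :
    ∫ x, φ x * 𝓕⁻ f x = ∫ x, 𝓕⁻ φ x * f x := by
  have h := integral_fourier_mul_schwartz (hf.comp_neg) φ
  simp_rw [Real.fourierInv_eq_fourier_comp_neg, SchwartzMap.fourierInv_coe,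
    Real.fourierInv_eq_fourier_neg]
  rw [h, ← integral_neg_eq_self]
  simp [SchwartzMap.fourier_coe]

theorem locallyIntegrable_coe (f : L2C) : LocallyIntegrable f :=
  (Lp.memLp f).locallyIntegrable (by norm_num)

theorem continuous_fourier_of_integrable {f : Plane → ℂ} (hf : Integrable f) :
    Continuous (𝓕 f) :=
  VectorFourier.fourierIntegral_continuous Real.continuous_fourierChar continuous_inner hf

theorem continuous_fourierInv_of_integrable {f : Plane → ℂ} (hf : Integrable f) :
    Continuous (𝓕⁻ f) := by
  rw [Real.fourierInv_eq_fourier_comp_neg]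
  exact continuous_fourier_of_integrable hf.comp_neg

/-- The L² transform and the integral transform have the same pairings with Schwartz functions, so
they agree almost everywhere. -/
theorem fourier_toLp_ae_eq {f : Plane → ℂ} (hf : Integrable f) (hf2 : MemLp f 2) :
    (𝓕 (hf2.toLp f) : L2C) =ᵐ[volume] 𝓕 f := by
  refine ae_eq_of_integral_schwartz_mul (locallyIntegrable_coe _)
    (continuous_fourier_of_integrable hf).locallyIntegrable fun φ _ => ?_
  rw [integral_schwartz_mul_fourier, integral_fourier_mul_schwartz hf]
  exact integral_congr_ae (hf2.coeFn_toLp.mono fun x hx => by simp only [hx])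

theorem fourierInv_toLp_ae_eq {f : Plane → ℂ} (hf : Integrable f) (hf2 : MemLp f 2) :
    (𝓕⁻ (hf2.toLp f) : L2C) =ᵐ[volume] 𝓕⁻ f := by
  refine ae_eq_of_integral_schwartz_mul (locallyIntegrable_coe _)
    (continuous_fourierInv_of_integrable hf).locallyIntegrable fun φ _ => ?_
  rw [integral_schwartz_mul_fourierInv, integral_fourierInv_mul_schwartz hf]
  exact integral_congr_ae (hf2.coeFn_toLp.mono fun x hx => by simp only [hx])

theorem norm_fourier_le_integral_norm (f : Plane → ℂ) (x : Plane) : ‖𝓕 f x‖ ≤ ∫ y, ‖f y‖ :=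
  VectorFourier.norm_fourierIntegral_le_integral_norm _ _ _ _ _

theorem L2C.continuous_integral_mul :
    Continuous fun p : L2C × L2C => ∫ x, p.1 x * p.2 x := by
  have h := ((ContinuousLinearMap.mul ℂ ℂ).lpPairing (volume : Measure Plane) 2 2).continuous₂
  exact h.congr fun p => ContinuousLinearMap.lpPairing_eq_integral _ _ _

/-- The product is continuous from L² × L² to L¹, and the inverse transform is continuous from L¹ to
bounded continuous functions. -/
theorem continuous_fourierInv_mul (ξ : Plane) :
    Continuous fun p : L2C × L2C => 𝓕⁻ (fun x => p.1 x * p.2 x) ξ := by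
  have h := ((ContinuousLinearMap.mul ℂ ℂ).holderL (volume : Measure Plane) 2 2 1).continuous₂
  have h2 := (BoundedContinuousFunction.evalCLM ℂ ξ).continuous.comp
    ((Real.Lp.fourierTransformInvCLM Plane ℂ).continuous.comp h)
  refine h2.congr fun p => ?_
  simp only [Function.comp_apply, Real.Lp.fourierTransformInvCLM_apply,
    BoundedContinuousFunction.evalCLM_apply, Real.Lp.fourierTransformInv_apply]
  exact Real.fourierInv_congr_ae
    (ContinuousLinearMap.coeFn_holder (r := 1) (ContinuousLinearMap.mul ℂ ℂ) p.1 p.2) ξ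

theorem fourierInv_mul_schwartz (φ ψ : 𝓢(Plane, ℂ)) (ξ : Plane) :
    𝓕⁻ (fun x => φ x * ψ x) ξ = ∫ η, 𝓕⁻ φ η * 𝓕⁻ ψ (ξ - η) := by
  have h := SchwartzMap.convolution_apply (ContinuousLinearMap.mul ℂ ℂ) (𝓕⁻ φ) (𝓕⁻ ψ) ξ
  simp only [SchwartzMap.convolution, LinearMap.coe_mk, AddHom.coe_mk,
    ContinuousLinearMap.comp_apply, FourierTransform.fourierCLM_apply,
    FourierTransform.fourierInvCLM_apply, FourierTransform.fourier_fourierInv_eq] at h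
  rw [SchwartzMap.fourierInv_coe] at h
  exact h

theorem measurePreserving_const_sub (ξ : Plane) :
    MeasurePreserving (fun η : Plane => ξ - η) volume volume :=
  Measure.measurePreserving_sub_left volume ξ

/-- The Fourier transform of a product of square integrable functions is a convolution. -/
theorem fourierInv_mul (f g : L2C) (ξ : Plane) :
    𝓕⁻ (fun x => f x * g x) ξ = ∫ η, (𝓕⁻ f : L2C) η * (𝓕⁻ g : L2C) (ξ - η) := by
  have hR : Continuous fun p : L2C × L2C =>
      ∫ η, (𝓕⁻ p.1 : L2C) η * (𝓕⁻ p.2 : L2C) (ξ - η) := by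
    have hc := (Lp.compMeasurePreservingₗᵢ ℂ (E := ℂ) (p := 2) (fun η : Plane => ξ - η)
      (measurePreserving_const_sub ξ)).continuous
    have h := L2C.continuous_integral_mul.comp
      (((Lp.fourierTransformₗᵢ Plane ℂ).symm.continuous.comp continuous_fst).prodMk
        (hc.comp ((Lp.fourierTransformₗᵢ Plane ℂ).symm.continuous.comp continuous_snd)))
    refine h.congr fun p => integral_congr_ae ?_
    filter_upwards [Lp.coeFn_compMeasurePreserving (𝓕⁻ p.2 : L2C)
      (measurePreserving_const_sub ξ)] with η hη
    exact congrArg _ hη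
  -- Both sides are continuous on L² × L², so it suffices to treat Schwartz functions.
  refine isClosed_property2 (SchwartzMap.denseRange_toLpCLM (F := ℂ) (E := Plane)
    (μ := volume) (p := 2) ENNReal.ofNat_ne_top) (p := fun f g : L2C =>
      𝓕⁻ (fun x => f x * g x) ξ = ∫ η, (𝓕⁻ f : L2C) η * (𝓕⁻ g : L2C) (ξ - η))
    (isClosed_eq (continuous_fourierInv_mul ξ) hR) (fun φ ψ => ?_) f g
  simp only [SchwartzMap.toLpCLM_apply, SchwartzMap.toLp_fourierInv_eq]
  have h1 : 𝓕⁻ (fun x => (φ.toLp 2 : L2C) x * (ψ.toLp 2 : L2C) x) ξ =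
      𝓕⁻ (fun x => φ x * ψ x) ξ := by
    refine Real.fourierInv_congr_ae ?_ ξ
    filter_upwards [φ.coeFn_toLp 2, ψ.coeFn_toLp 2] with x h1 h2
    rw [h1, h2]
  rw [h1, fourierInv_mul_schwartz]
  refine integral_congr_ae ?_
  filter_upwards [(𝓕⁻ φ).coeFn_toLp 2 volume, (measurePreserving_const_sub ξ).quasiMeasurePreserving.ae
    ((𝓕⁻ ψ).coeFn_toLp 2 volume)] with η h1 h2
  rw [h1, h2]

theorem memLp_mul_self_of_memLp_four {f : Plane → ℂ} (hf : MemLp f 4) :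
    MemLp (fun x => f x * f x) 2 := by
  have : ENNReal.HolderTriple 4 4 2 := ⟨by
    rw [← two_mul, show (4 : ℝ≥0∞) = 2 * 2 by norm_num, ENNReal.mul_inv (by simp) (by simp),
      ← mul_assoc, ENNReal.mul_inv_cancel (by simp) (by simp), one_mul]⟩
  exact hf.mul hf

theorem integrable_norm_pow_four {f : Plane → ℂ} (hf : MemLp f 4) :
    Integrable fun x => ‖f x‖ ^ 4 := by
  have := hf.integrable_norm_pow (p := 4) (by norm_num)
  exact this

/-- If the spectra of `A` and `B` lie in opposite half planes, then `A²` and `B²` are orthogonal. -/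
theorem inner_sq_eq_zero_of_halfplane {ν : Plane} {A B : L2C} (hA4 : MemLp A 4) (hB4 : MemLp B 4)
    (hA : ∀ᵐ ξ, inner ℝ ν ξ ≤ 0 → (𝓕⁻ A : L2C) ξ = 0)
    (hB : ∀ᵐ ξ, 0 < inner ℝ ν ξ → (𝓕⁻ B : L2C) ξ = 0) :
    ∫ x, inner ℂ (B x * B x) (A x * A x) = 0 := by
  set A' : L2C := (memLp_mul_self_of_memLp_four hA4).toLp
  set B' : L2C := (memLp_mul_self_of_memLp_four hB4).toLp
  have hA' : (A' : Plane → ℂ) =ᵐ[volume] fun x => A x * A x := MemLp.coeFn_toLp _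
  have hB' : (B' : Plane → ℂ) =ᵐ[volume] fun x => B x * B x := MemLp.coeFn_toLp _
  have h1 : ∫ x, inner ℂ (B x * B x) (A x * A x) = inner ℂ B' A' := by
    rw [L2.inner_def]
    refine integral_congr_ae ?_
    filter_upwards [hA', hB'] with x h1 h2
    rw [h1, h2]
  have hAi : Integrable fun x => A x * A x := (Lp.memLp A).integrable_mul (Lp.memLp A)
  have hBi : Integrable fun x => B x * B x := (Lp.memLp B).integrable_mul (Lp.memLp B)
  have h2 : inner ℂ B' A' = inner ℂ (𝓕⁻ B' : L2C) (𝓕⁻ A' : L2C) :=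
    ((Lp.fourierTransformₗᵢ Plane ℂ).symm.inner_map_map B' A').symm
  rw [h1, h2, L2.inner_def]
  refine integral_eq_zero_of_ae ?_
  filter_upwards [fourierInv_toLp_ae_eq hAi (memLp_mul_self_of_memLp_four hA4),
    fourierInv_toLp_ae_eq hBi (memLp_mul_self_of_memLp_four hB4)] with ξ h3 h4
  rw [h3, h4, fourierInv_mul, fourierInv_mul]
  -- The transforms of `A²` and `B²` are self-convolutions. If `ξ` is outside the open half plane,
  -- `η` and `ξ - η` cannot both lie in it, so the first vanishes; otherwise the second does.
  rcases le_or_gt (inner ℝ ν ξ) 0 with hξ | hξ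
  · have : ∫ η, (𝓕⁻ A : L2C) η * (𝓕⁻ A : L2C) (ξ - η) = 0 := by
      refine integral_eq_zero_of_ae ?_
      filter_upwards [hA, (measurePreserving_const_sub ξ).quasiMeasurePreserving.ae hA]
        with η h5 h6
      rcases le_or_gt (inner ℝ ν η) 0 with hη | hη
      · simp [h5 hη]
      · have := h6 (by rw [inner_sub_right]; linarith)
        simp [this]
    rw [this]
    simp
  · have : ∫ η, (𝓕⁻ B : L2C) η * (𝓕⁻ B : L2C) (ξ - η) = 0 := by
      refine integral_eq_zero_of_ae ?_
      filter_upwards [hB, (measurePreserving_const_sub ξ).quasiMeasurePreserving.ae hB]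
        with η h5 h6
      rcases lt_or_ge 0 (inner ℝ ν η) with hη | hη
      · simp [h5 hη]
      · have := h6 (by rw [inner_sub_right]; linarith)
        simp [this]
    rw [this]
    simp

/-- Expand `‖a² - b²‖²` and factor it as `‖a + b‖² ‖a - b‖²`; Young absorbs the fourth powers. The
remaining inner product integrates to zero when the squares are orthogonal. -/
theorem norm_pow_four_le (a b : ℂ) :
    ‖a‖ ^ 4 ≤ 8 * ‖a + b‖ ^ 4 + 4 * (inner ℂ (b * b) (a * a)).re := by
  have h1 : ‖a * a - b * b‖ ^ 2 = ‖a‖ ^ 4 + ‖b‖ ^ 4 - 2 * (inner ℂ (b * b) (a * a)).re := by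
    have := norm_sub_sq (𝕜 := ℂ) (b * b) (a * a)
    rw [norm_sub_rev, this, norm_mul, norm_mul]
    simp only [RCLike.re_to_complex]
    ring
  have h2 : ‖a * a - b * b‖ ^ 2 = ‖a + b‖ ^ 2 * ‖a - b‖ ^ 2 := by
    rw [← mul_pow, ← norm_mul]; congr 2; ring
  have h3 : ‖a - b‖ ^ 2 ≤ 2 * (‖a‖ ^ 2 + ‖b‖ ^ 2) := by
    have := norm_sub_le a b
    nlinarith [norm_nonneg (a - b), norm_nonneg a, norm_nonneg b, sq_nonneg (‖a‖ - ‖b‖)]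
  have h4 := mul_le_mul_of_nonneg_left h3 (sq_nonneg ‖a + b‖)
  nlinarith [sq_nonneg (2 * ‖a + b‖ ^ 2 - ‖a‖ ^ 2), sq_nonneg (2 * ‖a + b‖ ^ 2 - ‖b‖ ^ 2),
    sq_nonneg (‖b‖ ^ 2)]

theorem eLpNorm_four_le_of_integral_le {f g : Plane → ℂ} (hf : MemLp f 4) (hg : MemLp g 4) {C : NNReal}
    (h : ∫ x, ‖g x‖ ^ 4 ≤ C ^ 4 * ∫ x, ‖f x‖ ^ 4) : eLpNorm g 4 ≤ C * eLpNorm f 4 := by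
  have key : ∀ {u : Plane → ℂ}, MemLp u 4 →
      eLpNorm u 4 = ENNReal.ofReal ((∫ x, ‖u x‖ ^ 4) ^ (4 : ℝ)⁻¹) := fun {u} hu => by
    rw [hu.eLpNorm_eq_integral_rpow_norm (by simp) (by simp)]
    simp
  rw [key hf, key hg, ← ENNReal.ofReal_coe_nnreal, ← ENNReal.ofReal_mul (by positivity)]
  refine ENNReal.ofReal_le_ofReal ?_
  have h0 : 0 ≤ ∫ x, ‖f x‖ ^ 4 := integral_nonneg fun _ => by positivity
  have h1 : 0 ≤ ∫ x, ‖g x‖ ^ 4 := integral_nonneg fun _ => by positivity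
  refine (Real.rpow_le_rpow h1 h (by norm_num)).trans (le_of_eq ?_)
  rw [Real.mul_rpow (by positivity) h0]
  congr 1
  exact Real.pow_rpow_inv_natCast C.2 (by norm_num)

/-- The classical squaring argument for the boundedness of the Hilbert transform on L⁴: integrating
the pointwise inequality removes the inner product, leaving the constant `8 ≤ 2 ^ 4`. -/
theorem eLpNorm_four_le_of_halfplane {ν : Plane} {A B : L2C} (hA4 : MemLp A 4) (hB4 : MemLp B 4)
    (hA : ∀ᵐ ξ, inner ℝ ν ξ ≤ 0 → (𝓕⁻ A : L2C) ξ = 0)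
    (hB : ∀ᵐ ξ, 0 < inner ℝ ν ξ → (𝓕⁻ B : L2C) ξ = 0) :
    eLpNorm A 4 ≤ (2 : NNReal) * eLpNorm (A + B : L2C) 4 := by
  have hAB : MemLp (fun x => A x + B x) 4 := hA4.add hB4
  have hAB' : MemLp (A + B : L2C) 4 := (memLp_congr_ae (Lp.coeFn_add A B)).2 hAB
  refine eLpNorm_four_le_of_integral_le hAB' hA4 ?_
  have hI : Integrable fun x => inner ℂ (B x * B x) (A x * A x) := by
    have h1 := memLp_mul_self_of_memLp_four hA4
    have h2 := (memLp_mul_self_of_memLp_four hB4).star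
    exact (h1.integrable_mul h2).congr (Eventually.of_forall fun x => by simp)
  have h0 : ∫ x, (inner ℂ (B x * B x) (A x * A x)).re = 0 := by
    have := integral_re hI
    simp only [RCLike.re_to_complex] at this
    rw [this, inner_sq_eq_zero_of_halfplane hA4 hB4 hA hB, Complex.zero_re]
  have heq : ∫ x, ‖(A + B : L2C) x‖ ^ 4 = ∫ x, ‖A x + B x‖ ^ 4 :=
    integral_congr_ae ((Lp.coeFn_add A B).mono fun x hx => by simp only [hx, Pi.add_apply])
  have hIre : Integrable fun x => (inner ℂ (B x * B x) (A x * A x)).re := hI.re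
  have hint := integral_mono (integrable_norm_pow_four hA4)
    (((integrable_norm_pow_four hAB).const_mul 8).add (hIre.const_mul 4))
    fun x => norm_pow_four_le (A x) (B x)
  have hsum : ∫ x, (8 * ‖A x + B x‖ ^ 4 + 4 * (inner ℂ (B x * B x) (A x * A x)).re) =
      8 * ∫ x, ‖A x + B x‖ ^ 4 := by
    rw [integral_add ((integrable_norm_pow_four hAB).const_mul 8) (hIre.const_mul 4),
      integral_const_mul, integral_const_mul, h0, mul_zero, add_zero]
  rw [heq]
  refine (hint.trans (le_of_eq hsum)).trans ?_
  have : 0 ≤ ∫ x, ‖A x + B x‖ ^ 4 := integral_nonneg fun _ => by positivity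
  norm_num
  linarith

end Fourier

/-! ### Approximation in L² and L⁴. -/

section Multipliers

open scoped FourierTransform SchwartzMap

theorem tendsto_eLpNorm_zero_of_dominated {p : ℝ≥0∞} (hp0 : p ≠ 0) (hp : p ≠ ⊤)
    {u : ℕ → Plane → ℂ} {h : Plane → ℂ} (hu : ∀ n, AEStronglyMeasurable (u n) volume)
    (hh : MemLp h p) (hb : ∀ n, ∀ᵐ x, ‖u n x‖ ≤ ‖h x‖)
    (hlim : ∀ᵐ x, Tendsto (fun n => u n x) atTop (𝓝 0)) :
    Tendsto (fun n => eLpNorm (u n) p volume) atTop (𝓝 0) := by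
  have hp' : 0 < p.toReal := ENNReal.toReal_pos hp0 hp
  have hfin := lintegral_rpow_enorm_lt_top_of_eLpNorm_lt_top hp0 hp hh.2
  have h1 : Tendsto (fun n => ∫⁻ x, ‖u n x‖ₑ ^ p.toReal) atTop (𝓝 (∫⁻ _ : Plane, 0)) := by
    refine tendsto_lintegral_of_dominated_convergence' (fun x => ‖h x‖ₑ ^ p.toReal)
      (fun n => (hu n).enorm.pow_const _) (fun n => (hb n).mono fun x hx => ?_) hfin.ne
      (hlim.mono fun x hx => ?_)
    · exact ENNReal.rpow_le_rpow (enorm_le_iff_norm_le.2 hx) hp'.le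
    · have h2 := (ENNReal.continuous_rpow_const (y := p.toReal)).continuousAt.tendsto.comp
        (continuous_enorm.continuousAt.tendsto.comp hx)
      simpa [hp', Function.comp_def] using h2
  rw [lintegral_zero] at h1
  have h2 := (ENNReal.continuous_rpow_const (y := p.toReal⁻¹)).continuousAt.tendsto.comp h1
  rw [ENNReal.zero_rpow_of_pos (by positivity)] at h2
  refine h2.congr fun n => ?_
  rw [eLpNorm_eq_lintegral_rpow_enorm_toReal hp0 hp, Function.comp_apply, one_div]

/-- L² convergence gives an almost everywhere convergent subsequence, and Fatou transfers the L⁴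
bounds to the limit. -/
theorem eLpNorm_four_le_of_tendsto {f : L2C} {u : ℕ → L2C} {C : ℝ≥0∞} {c : ℕ → ℝ≥0∞}
    (hu : Tendsto u atTop (𝓝 f)) (hc : ∀ n, eLpNorm (u n) 4 ≤ c n) (hcC : Tendsto c atTop (𝓝 C)) :
    eLpNorm f 4 ≤ C := by
  have h1 := tendstoInMeasure_of_tendsto_Lp hu
  obtain ⟨ns, hns, hlim⟩ := h1.exists_seq_tendsto_ae
  refine (Lp.eLpNorm_lim_le_liminf_eLpNorm (fun n => (Lp.memLp (u (ns n))).1) f hlim).trans ?_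
  refine (liminf_le_liminf (Eventually.of_forall fun n => hc (ns n))).trans (le_of_eq ?_)
  exact (hcC.comp hns.tendsto_atTop).liminf_eq

theorem memLp_four_of_bounded {f : Plane → ℂ} (hf : MemLp f 2) {C : NNReal}
    (hC : ∀ᵐ x, ‖f x‖ ≤ C) : MemLp f 4 := by
  refine ⟨hf.1, ?_⟩
  rw [eLpNorm_lt_top_iff_lintegral_rpow_enorm_lt_top (by simp) (by simp)]
  have hfin := lintegral_rpow_enorm_lt_top_of_eLpNorm_lt_top (by simp) (by simp) hf.2
  have : ∫⁻ x, ‖f x‖ₑ ^ (4 : ℝ≥0∞).toReal ≤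
      ∫⁻ x, (C : ℝ≥0∞) ^ 2 * ‖f x‖ₑ ^ (2 : ℝ≥0∞).toReal := by
    refine lintegral_mono_ae (hC.mono fun x hx => ?_)
    have h1 : ‖f x‖ₑ ≤ (C : ℝ≥0∞) := by
      rw [← ofReal_norm, ← ENNReal.ofReal_coe_nnreal]
      exact ENNReal.ofReal_le_ofReal hx
    simp only [ENNReal.toReal_ofNat, ENNReal.rpow_ofNat]
    calc ‖f x‖ₑ ^ 4 = ‖f x‖ₑ ^ 2 * ‖f x‖ₑ ^ 2 := by ring
      _ ≤ _ := mul_le_mul_left (pow_le_pow_left₀ (by simp) h1 2) _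
  refine this.trans_lt ?_
  rw [lintegral_const_mul' _ _ (by simp)]
  exact ENNReal.mul_lt_top (by simp) hfin

/-- Truncation to a large ball followed by mollification converges in both norms at once, so a
single Schwartz function serves both exponents. -/
theorem exists_schwartz_close {f : Plane → ℂ} (hf2 : MemLp f 2) (hf4 : MemLp f 4) {ε : ℝ≥0∞}
    (hε : 0 < ε) : ∃ φ : 𝓢(Plane, ℂ), eLpNorm (⇑φ - f) 2 < ε ∧ eLpNorm (⇑φ - f) 4 < ε := by
  set B : ℕ → Set Plane := fun n => Metric.closedBall 0 n
  have hB : ∀ n, MeasurableSet (B n) := fun n => Metric.isClosed_closedBall.measurableSet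
  set t : ℕ → Plane → ℂ := fun n => (B n).indicator f
  have htr : ∀ p : ℝ≥0∞, p ≠ 0 → p ≠ ⊤ → MemLp f p →
      Tendsto (fun n => eLpNorm (t n - f) p volume) atTop (𝓝 0) := by
    intro p hp0 hp hf
    refine tendsto_eLpNorm_zero_of_dominated hp0 hp (fun n => (hf.1.indicator (hB n)).sub hf.1) hf
      (fun n => Eventually.of_forall fun x => ?_) (Eventually.of_forall fun x => ?_)
    · by_cases hx : x ∈ B n <;> simp [t, hx]
    · refine tendsto_const_nhds.congr' ?_
      obtain ⟨N, hN⟩ := exists_nat_ge ‖x‖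
      filter_upwards [eventually_ge_atTop N] with n hn
      have : x ∈ B n := by
        rw [mem_closedBall_zero_iff]; exact hN.trans (by exact_mod_cast hn)
      simp [t, this]
  have hε2 : 0 < ε / 2 := ENNReal.half_pos hε.ne'
  obtain ⟨n, hn2, hn4⟩ := (((htr 2 (by simp) (by simp) hf2).eventually (gt_mem_nhds hε2)).and
    ((htr 4 (by simp) (by simp) hf4).eventually (gt_mem_nhds hε2))).exists
  have ht2 : MemLp (t n) 2 := hf2.indicator (hB n)
  have ht4 : MemLp (t n) 4 := hf4.indicator (hB n)
  have htc : HasCompactSupport (t n) := HasCompactSupport.of_support_subset_isCompact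
    (isCompact_closedBall (0 : Plane) n) Set.support_indicator_subset
  have h12 : (1 : ℝ≥0∞) ≤ 2 := by norm_num
  have h14 : (1 : ℝ≥0∞) ≤ 4 := by norm_num
  obtain ⟨k, hk2, hk4⟩ := (((tendsto_eLpNorm_mollify_sub h12 (by simp) ht2).eventually
    (gt_mem_nhds hε2)).and ((tendsto_eLpNorm_mollify_sub h14 (by simp) ht4).eventually
    (gt_mem_nhds hε2))).exists
  have hsm := mollify_contDiff (ht2.locallyIntegrable h12) k
  refine ⟨(mollify_hasCompactSupport htc k).toSchwartzMap hsm, ?_⟩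
  have hkm : AEStronglyMeasurable (mollify k (t n)) volume := hsm.continuous.aestronglyMeasurable
  have key : ∀ p : ℝ≥0∞, 1 ≤ p → eLpNorm (mollify k (t n) - t n) p volume < ε / 2 →
      eLpNorm (t n - f) p volume < ε / 2 → eLpNorm (mollify k (t n) - f) p volume < ε := by
    intro p hp h1 h2
    have h3 : mollify k (t n) - f = (mollify k (t n) - t n) + (t n - f) := by abel
    rw [h3]
    refine (eLpNorm_add_le (hkm.sub ht2.1) (ht2.1.sub hf2.1) hp).trans_lt ?_
    rw [← ENNReal.add_halves ε]
    exact ENNReal.add_lt_add h1 h2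
  exact ⟨key 2 h12 hk2 hn2, key 4 h14 hk4 hn4⟩

theorem exists_schwartz_approx (f : L2C) (hf4 : MemLp f 4) : ∃ φ : ℕ → 𝓢(Plane, ℂ),
    Tendsto (fun n => ((φ n).toLp 2 : L2C)) atTop (𝓝 f) ∧
      Tendsto (fun n => eLpNorm (φ n) 4 volume) atTop (𝓝 (eLpNorm f 4)) := by
  have hpos : ∀ n : ℕ, 0 < ENNReal.ofReal (1 / ((n : ℝ) + 1)) := fun n => by
    rw [ENNReal.ofReal_pos]; positivity
  have h0 : Tendsto (fun n : ℕ => ENNReal.ofReal (1 / ((n : ℝ) + 1))) atTop (𝓝 0) := by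
    have := ENNReal.tendsto_ofReal (tendsto_one_div_add_atTop_nhds_zero_nat (𝕜 := ℝ))
    rwa [ENNReal.ofReal_zero] at this
  choose φ hφ2 hφ4 using fun n : ℕ => exists_schwartz_close (Lp.memLp f) hf4 (hpos n)
  refine ⟨φ, ?_, ?_⟩
  · rw [Lp.tendsto_Lp_iff_tendsto_eLpNorm']
    refine tendsto_of_tendsto_of_tendsto_of_le_of_le tendsto_const_nhds h0 (fun _ => zero_le)
      fun n => ?_
    refine le_trans (le_of_eq (eLpNorm_congr_ae ?_)) (hφ2 n).le
    filter_upwards [(φ n).coeFn_toLp 2 volume] with x hx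
    simp [hx]
  · have h4 : Tendsto (fun n => eLpNorm (⇑(φ n) - ⇑f) 4 volume) atTop (𝓝 0) :=
      tendsto_of_tendsto_of_tendsto_of_le_of_le tendsto_const_nhds h0 (fun _ => zero_le)
        fun n => (hφ4 n).le
    refine tendsto_of_tendsto_of_tendsto_of_le_of_le
      (g := fun n => eLpNorm f 4 volume - eLpNorm (⇑(φ n) - ⇑f) 4 volume)
      (h := fun n => eLpNorm f 4 volume + eLpNorm (⇑(φ n) - ⇑f) 4 volume) ?_ ?_
      (fun n => ?_) fun n => ?_
    · have := ENNReal.Tendsto.sub (tendsto_const_nhds (x := eLpNorm f 4 volume)) h4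
        (Or.inr (by simp))
      rwa [tsub_zero] at this
    · have := (tendsto_const_nhds (x := eLpNorm f 4 volume)).add h4
      rwa [add_zero] at this
    · refine tsub_le_iff_right.2 ?_
      have h3 : (f : Plane → ℂ) = ⇑(φ n) - (⇑(φ n) - ⇑f) := by abel
      conv_lhs => rw [h3]
      exact eLpNorm_sub_le ((φ n).memLp 2 volume).1
        (((φ n).memLp 2 volume).1.sub (Lp.memLp f).1) (by norm_num)
    · have h3 : (φ n : Plane → ℂ) = ⇑f + (⇑(φ n) - ⇑f) := by abel
      conv_lhs => rw [h3]
      exact eLpNorm_add_le (Lp.memLp f).1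
        (((φ n).memLp 2 volume).1.sub (Lp.memLp f).1) (by norm_num)

end Multipliers

/-! ### The algebra of L⁴ multipliers. -/

section MultiplierAlgebra

open scoped FourierTransform SchwartzMap

/-- `m` is a bounded symbol whose Fourier multiplier maps `L² ∩ L⁴` to `L⁴` with norm at most
`C`. -/
structure IsL4MultiplierWith (C : NNReal) (m : Plane → ℂ) : Prop where
  aestronglyMeasurable : AEStronglyMeasurable m volume
  bounded : ∃ K : ℝ, ∀ᵐ ξ, ‖m ξ‖ ≤ K
  le : ∀ f g : L2C, MemLp f 4 → (∀ᵐ ξ, (𝓕⁻ g : L2C) ξ = m ξ * (𝓕⁻ f : L2C) ξ) →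
    eLpNorm g 4 ≤ C * eLpNorm f 4

theorem memLp_symbol_mul {m : Plane → ℂ} (hm : AEStronglyMeasurable m volume) {K : ℝ}
    (hK : ∀ᵐ ξ, ‖m ξ‖ ≤ K) {h : Plane → ℂ} {p : ℝ≥0∞} (hh : MemLp h p) :
    MemLp (fun ξ => m ξ * h ξ) p := by
  refine (hh.const_mul (K : ℂ)).mono (hm.mul hh.1) (hK.mono fun ξ hξ => ?_)
  rw [norm_mul, norm_mul]
  refine mul_le_mul_of_nonneg_right (hξ.trans ?_) (norm_nonneg _)
  rw [Complex.norm_real]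
  exact le_abs_self K

theorem exists_fourierInv_eq_mul {m : Plane → ℂ} (hm : AEStronglyMeasurable m volume) {K : ℝ}
    (hK : ∀ᵐ ξ, ‖m ξ‖ ≤ K) (f : L2C) :
    ∃ g : L2C, ∀ᵐ ξ, (𝓕⁻ g : L2C) ξ = m ξ * (𝓕⁻ f : L2C) ξ := by
  refine ⟨𝓕 ((memLp_symbol_mul hm hK (Lp.memLp (𝓕⁻ f : L2C))).toLp _ : L2C), ?_⟩
  rw [FourierTransform.fourierInv_fourier_eq]
  exact MemLp.coeFn_toLp _

theorem L2C.eq_of_fourierInv_ae_eq {f g : L2C} (h : (𝓕⁻ f : L2C) =ᵐ[volume] (𝓕⁻ g : L2C)) :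
    f = g :=
  (Lp.fourierTransformₗᵢ Plane ℂ).symm.injective (Lp.ext h)

theorem fourierInv_add_ae (f g : L2C) :
    ((𝓕⁻ (f + g) : L2C) : Plane → ℂ) =ᵐ[volume] fun ξ => (𝓕⁻ f : L2C) ξ + (𝓕⁻ g : L2C) ξ := by
  rw [FourierTransform.fourierInv_add]
  exact Lp.coeFn_add _ _

theorem fourierInv_sub_ae (f g : L2C) :
    ((𝓕⁻ (f - g) : L2C) : Plane → ℂ) =ᵐ[volume] fun ξ => (𝓕⁻ f : L2C) ξ - (𝓕⁻ g : L2C) ξ := by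
  have h : (𝓕⁻ (f - g) : L2C) = 𝓕⁻ f - 𝓕⁻ g := (Lp.fourierTransformₗᵢ Plane ℂ).symm.map_sub f g
  rw [h]
  exact Lp.coeFn_sub _ _

theorem fourierInv_const_smul_ae (c : ℂ) (f : L2C) :
    ((𝓕⁻ (c • f) : L2C) : Plane → ℂ) =ᵐ[volume] fun ξ => c * (𝓕⁻ f : L2C) ξ := by
  have h : (𝓕⁻ (c • f) : L2C) = c • 𝓕⁻ f := (Lp.fourierTransformₗᵢ Plane ℂ).symm.map_smul c f
  rw [h]
  exact Lp.coeFn_smul _ _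

theorem L2C.norm_le_of_fourierInv_eq_mul {m : Plane → ℂ} {K : ℝ}
    (hK : ∀ᵐ ξ, ‖m ξ‖ ≤ K) {f g : L2C} (h : ∀ᵐ ξ, (𝓕⁻ g : L2C) ξ = m ξ * (𝓕⁻ f : L2C) ξ) :
    ‖g‖ ≤ K * ‖f‖ := by
  have hn : ∀ u : L2C, ‖(𝓕⁻ u : L2C)‖ = ‖u‖ := (Lp.fourierTransformₗᵢ Plane ℂ).symm.norm_map
  rw [← hn g, ← hn f]
  refine Lp.norm_le_mul_norm_of_ae_le_mul ?_
  filter_upwards [h, hK] with ξ h1 h2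
  rw [h1, norm_mul]
  exact mul_le_mul_of_nonneg_right h2 (norm_nonneg _)

namespace IsL4MultiplierWith

variable {C C' : NNReal} {m m' : Plane → ℂ}

theorem congr_ae (h : IsL4MultiplierWith C m) (hm : m =ᵐ[volume] m') :
    IsL4MultiplierWith C m' where
  aestronglyMeasurable := h.aestronglyMeasurable.congr hm
  bounded := by
    obtain ⟨K, hK⟩ := h.bounded
    exact ⟨K, by filter_upwards [hK, hm] with ξ h1 h2; rwa [← h2]⟩
  le f g hf hfg := h.le f g hf (by
    filter_upwards [hfg, hm] with ξ h1 h2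
    rwa [h2])

theorem mono (h : IsL4MultiplierWith C m) (hC : C ≤ C') : IsL4MultiplierWith C' m where
  aestronglyMeasurable := h.aestronglyMeasurable
  bounded := h.bounded
  le f g hf hfg := (h.le f g hf hfg).trans (by gcongr)

theorem const (c : ℂ) : IsL4MultiplierWith ‖c‖₊ fun _ => c where
  aestronglyMeasurable := aestronglyMeasurable_const
  bounded := ⟨‖c‖, Eventually.of_forall fun _ => le_rfl⟩
  le f g hf hfg := by
    have h : g = c • f := L2C.eq_of_fourierInv_ae_eq (by
      filter_upwards [hfg, fourierInv_const_smul_ae c f] with ξ h1 h2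
      rw [h1, h2])
    rw [h, eLpNorm_congr_ae (Lp.coeFn_smul c f), eLpNorm_const_smul]
    rfl

theorem add (h : IsL4MultiplierWith C m) (h' : IsL4MultiplierWith C' m') :
    IsL4MultiplierWith (C + C') fun ξ => m ξ + m' ξ where
  aestronglyMeasurable := h.aestronglyMeasurable.add h'.aestronglyMeasurable
  bounded := by
    obtain ⟨K, hK⟩ := h.bounded
    obtain ⟨K', hK'⟩ := h'.bounded
    exact ⟨K + K', by
      filter_upwards [hK, hK'] with ξ h1 h2
      exact (norm_add_le _ _).trans (add_le_add h1 h2)⟩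
  le f g hf hfg := by
    obtain ⟨K, hK⟩ := h.bounded
    obtain ⟨K', hK'⟩ := h'.bounded
    obtain ⟨g₁, hg₁⟩ := exists_fourierInv_eq_mul h.aestronglyMeasurable hK f
    obtain ⟨g₂, hg₂⟩ := exists_fourierInv_eq_mul h'.aestronglyMeasurable hK' f
    have hg : g = g₁ + g₂ := L2C.eq_of_fourierInv_ae_eq (by
      filter_upwards [hfg, hg₁, hg₂, fourierInv_add_ae g₁ g₂] with ξ h1 h2 h3 h4
      rw [h1, h4, h2, h3, add_mul])
    rw [hg, eLpNorm_congr_ae (Lp.coeFn_add g₁ g₂), ENNReal.coe_add, add_mul]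
    exact (eLpNorm_add_le (Lp.memLp g₁).1 (Lp.memLp g₂).1 (by norm_num)).trans
      (add_le_add (h.le f g₁ hf hg₁) (h'.le f g₂ hf hg₂))

theorem mul (h : IsL4MultiplierWith C m) (h' : IsL4MultiplierWith C' m') :
    IsL4MultiplierWith (C * C') fun ξ => m ξ * m' ξ where
  aestronglyMeasurable := h.aestronglyMeasurable.mul h'.aestronglyMeasurable
  bounded := by
    obtain ⟨K, hK⟩ := h.bounded
    obtain ⟨K', hK'⟩ := h'.bounded
    exact ⟨K * K', by
      filter_upwards [hK, hK'] with ξ h1 h2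
      rw [norm_mul]
      exact mul_le_mul h1 h2 (norm_nonneg _) ((norm_nonneg _).trans h1)⟩
  le f g hf hfg := by
    obtain ⟨K', hK'⟩ := h'.bounded
    obtain ⟨u, hu⟩ := exists_fourierInv_eq_mul h'.aestronglyMeasurable hK' f
    have h1 := h'.le f u hf hu
    have hu4 : MemLp u 4 := ⟨(Lp.memLp u).1, h1.trans_lt (ENNReal.mul_lt_top (by simp) hf.2)⟩
    have h2 := h.le u g hu4 (by
      filter_upwards [hfg, hu] with ξ h3 h4
      rw [h3, h4, mul_assoc])
    rw [ENNReal.coe_mul, mul_assoc]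
    exact h2.trans (by gcongr)

theorem sum {ι : Type*} (s : Finset ι) {D : ι → NNReal} {n : ι → Plane → ℂ}
    (h : ∀ i ∈ s, IsL4MultiplierWith (D i) (n i)) :
    IsL4MultiplierWith (∑ i ∈ s, D i) fun ξ => ∑ i ∈ s, n i ξ := by
  classical
  induction s using Finset.induction_on with
  | empty => simpa using const 0
  | insert a s ha ih =>
    simp only [Finset.sum_insert ha]
    exact (h a (Finset.mem_insert_self a s)).add
      (ih fun i hi => h i (Finset.mem_insert_of_mem hi))

/-- Dominated convergence on the Fourier side gives L² convergence of the outputs, and the common L⁴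
bound survives the limit by Fatou. -/
theorem of_tendsto {n : ℕ → Plane → ℂ} (hn : ∀ k, IsL4MultiplierWith C (n k)) {K : ℝ}
    (hK : ∀ k, ∀ᵐ ξ, ‖n k ξ‖ ≤ K)
    (hlim : ∀ᵐ ξ, Tendsto (fun k => n k ξ) atTop (𝓝 (m ξ))) : IsL4MultiplierWith C m := by
  have hmK : ∀ᵐ ξ, ‖m ξ‖ ≤ K := by
    filter_upwards [hlim, ae_all_iff.2 hK] with ξ h1 h2
    exact le_of_tendsto h1.norm (Eventually.of_forall h2)
  have hm : AEStronglyMeasurable m volume :=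
    aestronglyMeasurable_of_tendsto_ae atTop (fun k => (hn k).aestronglyMeasurable) hlim
  refine ⟨hm, ⟨K, hmK⟩, fun f g hf hfg => ?_⟩
  choose u hu using fun k => exists_fourierInv_eq_mul (hn k).aestronglyMeasurable (hK k) f
  have hconv : Tendsto (fun k => (𝓕⁻ (u k) : L2C)) atTop (𝓝 (𝓕⁻ g)) := by
    rw [Lp.tendsto_Lp_iff_tendsto_eLpNorm']
    refine tendsto_eLpNorm_zero_of_dominated (by simp) (by simp)
      (h := fun ξ => (2 * K : ℂ) * (𝓕⁻ f : L2C) ξ)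
      (fun k => (Lp.memLp _).1.sub (Lp.memLp _).1) ((Lp.memLp _).const_mul _) (fun k => ?_) ?_
    · filter_upwards [hu k, hfg, hK k, hmK] with ξ h1 h2 h3 h4
      rw [Pi.sub_apply, h1, h2, ← sub_mul, norm_mul, norm_mul]
      refine mul_le_mul_of_nonneg_right ((norm_sub_le _ _).trans ?_) (norm_nonneg _)
      have h5 : ‖(2 * K : ℂ)‖ = 2 * |K| := by simp
      rw [h5]
      linarith [le_abs_self K]
    · filter_upwards [ae_all_iff.2 hu, hfg, hlim] with ξ h1 h2 h3
      have h4 : ∀ k, (⇑(𝓕⁻ (u k) : L2C) - ⇑(𝓕⁻ g : L2C)) ξ = (n k ξ - m ξ) * (𝓕⁻ f : L2C) ξ :=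
        fun k => by rw [Pi.sub_apply, h1 k, h2, sub_mul]
      simp only [h4]
      have h5 := (h3.sub_const (m ξ)).mul_const ((𝓕⁻ f : L2C) ξ)
      rwa [sub_self, zero_mul] at h5
  have hug : Tendsto u atTop (𝓝 g) := by
    have h := ((Lp.fourierTransformₗᵢ Plane ℂ).continuous.tendsto _).comp hconv
    refine (h.congr fun k => ?_).trans_eq ?_
    · exact (Lp.fourierTransformₗᵢ Plane ℂ).apply_symm_apply (u k)
    · rw [show Lp.fourierTransformₗᵢ Plane ℂ (𝓕⁻ g) = g from
        (Lp.fourierTransformₗᵢ Plane ℂ).apply_symm_apply g]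
  exact eLpNorm_four_le_of_tendsto hug (fun k => (hn k).le f (u k) hf (hu k)) tendsto_const_nhds

/-- It suffices to test the estimate on Schwartz functions. -/
theorem of_schwartz (hm : AEStronglyMeasurable m volume) {K : ℝ} (hK : ∀ᵐ ξ, ‖m ξ‖ ≤ K)
    (h : ∀ (φ : 𝓢(Plane, ℂ)) (g : L2C),
      (∀ᵐ ξ, (𝓕⁻ g : L2C) ξ = m ξ * (𝓕⁻ (φ.toLp 2) : L2C) ξ) →
      eLpNorm g 4 ≤ C * eLpNorm φ 4 volume) : IsL4MultiplierWith C m := by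
  refine ⟨hm, ⟨K, hK⟩, fun f g hf hfg => ?_⟩
  obtain ⟨φ, hφ2, hφ4⟩ := exists_schwartz_approx f hf
  choose u hu using fun n => exists_fourierInv_eq_mul hm hK ((φ n).toLp 2 : L2C)
  have hug : Tendsto u atTop (𝓝 g) := by
    rw [tendsto_iff_norm_sub_tendsto_zero] at hφ2 ⊢
    have h0 := hφ2.const_mul |K|
    rw [mul_zero] at h0
    refine squeeze_zero (fun _ => norm_nonneg _) (fun n => ?_) h0
    refine L2C.norm_le_of_fourierInv_eq_mul (m := m)
      (hK.mono fun ξ h1 => h1.trans (le_abs_self K)) ?_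
    filter_upwards [hu n, hfg, fourierInv_sub_ae (u n) g, fourierInv_sub_ae ((φ n).toLp 2) f]
      with ξ h1 h2 h3 h4
    rw [h3, h4, h1, h2, mul_sub]
  exact eLpNorm_four_le_of_tendsto hug (fun n => h (φ n) (u n) (hu n))
    (ENNReal.Tendsto.const_mul hφ4 (Or.inr (by simp)))

/-- The projection onto a half plane of frequencies. -/
theorem halfplane (ν : Plane) :
    IsL4MultiplierWith 2 ({ξ : Plane | 0 < inner ℝ ν ξ}.indicator fun _ => 1) := by
  set H : Set Plane := {ξ | 0 < inner ℝ ν ξ}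
  have hH : MeasurableSet H :=
    (isOpen_lt continuous_const (continuous_const.inner continuous_id)).measurableSet
  have hm : AEStronglyMeasurable (H.indicator fun _ => (1 : ℂ)) volume :=
    (aestronglyMeasurable_const.indicator hH)
  have hK : ∀ ξ, ‖H.indicator (fun _ => (1 : ℂ)) ξ‖ ≤ 1 := fun ξ => by
    by_cases hξ : ξ ∈ H <;> simp [hξ]
  refine of_schwartz hm (K := 1) (Eventually.of_forall hK) fun φ A hA => ?_
  have hφF : ((𝓕⁻ (φ.toLp 2) : L2C) : Plane → ℂ) =ᵐ[volume] (𝓕⁻ φ : 𝓢(Plane, ℂ)) := by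
    rw [SchwartzMap.toLp_fourierInv_eq]
    exact (𝓕⁻ φ).coeFn_toLp 2 volume
  -- The quantitative bound presupposes that the projection is in L⁴. For Schwartz `φ` it is,
  -- because the truncated transform is integrable and `A` is therefore bounded.
  have hA4 : MemLp A 4 := by
    have hi : Integrable (H.indicator (𝓕⁻ φ : 𝓢(Plane, ℂ))) := (𝓕⁻ φ).integrable.indicator hH
    have h2 : MemLp (H.indicator (𝓕⁻ φ : 𝓢(Plane, ℂ))) 2 := ((𝓕⁻ φ).memLp 2 volume).indicator hH
    have hAeq : A = 𝓕 (h2.toLp _ : L2C) := L2C.eq_of_fourierInv_ae_eq (by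
      rw [FourierTransform.fourierInv_fourier_eq]
      filter_upwards [hA, hφF, h2.coeFn_toLp] with ξ h3 h4 h5
      rw [h3, h4, h5]
      by_cases hξ : ξ ∈ H <;> simp [hξ])
    refine memLp_four_of_bounded (Lp.memLp A)
      (C := ⟨∫ y, ‖H.indicator (𝓕⁻ φ : 𝓢(Plane, ℂ)) y‖, integral_nonneg fun _ => norm_nonneg _⟩) ?_
    rw [hAeq]
    filter_upwards [fourier_toLp_ae_eq hi h2] with x hx
    rw [hx]
    exact norm_fourier_le_integral_norm _ x
  set B : L2C := (φ.toLp 2 volume : L2C) - A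
  have hB4 : MemLp B 4 := by
    have h0 : MemLp (fun x => φ x - A x) 4 := (φ.memLp 4 volume).sub hA4
    refine h0.ae_eq ?_
    filter_upwards [Lp.coeFn_sub (φ.toLp 2 : L2C) A, φ.coeFn_toLp 2 volume] with x h1 h2
    rw [h1, Pi.sub_apply, h2]
  have h := eLpNorm_four_le_of_halfplane (ν := ν) hA4 hB4 ?_ ?_
  · rw [add_sub_cancel] at h
    rwa [eLpNorm_congr_ae (φ.coeFn_toLp 2 volume)] at h
  · filter_upwards [hA] with ξ h1 h2
    have : ξ ∉ H := fun h3 => absurd h3 (not_lt.2 h2)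
    rw [h1, Set.indicator_of_notMem this, zero_mul]
  · filter_upwards [hA, fourierInv_sub_ae (φ.toLp 2) A] with ξ h1 h3 h2
    have : ξ ∈ H := h2
    rw [h3, h1, Set.indicator_of_mem this, one_mul, sub_self]

end IsL4MultiplierWith

end MultiplierAlgebra

/-! ### Symbols that are homogeneous of degree zero. -/

section HomogeneousSymbols

theorem ae_coord_zero_ne_zero : ∀ᵐ ξ : Plane, ξ 0 ≠ 0 := by
  set s : Submodule ℝ Plane := (EuclideanSpace.proj (0 : Fin 2) : Plane →L[ℝ] ℝ).ker
  have h : volume (s : Set Plane) = 0 := by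
    refine Measure.addHaar_submodule volume s fun h => ?_
    have h1 : coordVec 0 ∈ s := h ▸ Submodule.mem_top
    simp [s, coordVec] at h1
  exact measure_eq_zero_iff_ae_notMem.1 h

/-- The projection onto a double sector `{arctan (ξ₁ / ξ₀) > arctan t}`. -/
theorem IsL4MultiplierWith.doubleSector (t : ℝ) :
    IsL4MultiplierWith 8 ({ξ : Plane | t < ξ 1 / ξ 0}.indicator fun _ => 1) := by
  -- The double sector splits according to the sign of `ξ 0` into two intersections of half planes,
  -- whence `8 = 2 * 2 + 2 * 2`.
  have h1 := IsL4MultiplierWith.halfplane !₂[(1 : ℝ), 0]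
  have h2 := IsL4MultiplierWith.halfplane !₂[-t, (1 : ℝ)]
  have h3 := IsL4MultiplierWith.halfplane !₂[(-1 : ℝ), 0]
  have h4 := IsL4MultiplierWith.halfplane !₂[t, (-1 : ℝ)]
  have h := ((h1.mul h2).add (h3.mul h4)).mono (C' := 8) (by norm_num)
  refine h.congr_ae ?_
  filter_upwards [ae_coord_zero_ne_zero] with ξ hξ
  simp only [Set.indicator, Set.mem_ofPred_eq, PiLp.inner_apply, Fin.sum_univ_two]
  simp
  rcases lt_or_gt_of_ne hξ with h0 | h0
  · have e1 : ¬ 0 < ξ 0 := not_lt.2 h0.le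
    simp only [lt_div_iff_of_neg h0, e1, h0, mul_comm t, if_true, if_false, ite_self, zero_add]
  · have e1 : ¬ ξ 0 < 0 := not_lt.2 h0.le
    simp only [lt_div_iff₀ h0, e1, h0, mul_comm t, if_true, if_false, ite_self, add_zero]

/-- A Lipschitz function of the angle, approximated by step functions with steps of size `h`. -/
noncomputable def stepApprox (M : ℝ → ℝ) (a h : ℝ) (n : ℕ) (θ : ℝ) : ℝ :=
  M a + ∑ k ∈ Finset.range n,
    (M (a + (k + 1) * h) - M (a + k * h)) * (if a + (k + 1) * h < θ then 1 else 0)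

/-- The sum telescopes to the value of `M` at the last grid point below `θ`, which is within one
step of `θ` unless `θ` lies beyond the grid. -/
theorem stepApprox_spec {M : ℝ → ℝ} {a b h L : ℝ} (hh : 0 ≤ h)
    (hL : ∀ x ∈ Set.Icc a b, ∀ y ∈ Set.Icc a b, |M x - M y| ≤ L * |x - y|) (hL0 : 0 ≤ L) {θ : ℝ}
    (hθ : θ ∈ Set.Ioo a b) (n : ℕ) :
    (a + n * h < θ → stepApprox M a h n θ = M (a + n * h)) ∧
      (θ ≤ a + n * h → |stepApprox M a h n θ - M θ| ≤ L * h) := by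
  induction n with
  | zero =>
    refine ⟨fun _ => by simp [stepApprox], fun h1 => ?_⟩
    simp only [Nat.cast_zero, zero_mul, add_zero] at h1
    exact absurd hθ.1 (not_lt.2 h1)
  | succ n ih =>
    have hs : stepApprox M a h (n + 1) θ = stepApprox M a h n θ +
        (M (a + (n + 1) * h) - M (a + n * h)) * (if a + (n + 1) * h < θ then 1 else 0) := by
      simp only [stepApprox, Finset.sum_range_succ]; ring
    push_cast
    refine ⟨fun h1 => ?_, fun h1 => ?_⟩
    · have h2 : a + n * h < θ := by linarith
      rw [hs, ih.1 h2, if_pos h1]; ring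
    · rw [hs, if_neg (not_lt.2 h1), mul_zero, add_zero]
      rcases lt_or_ge (a + n * h) θ with h2 | h2
      · rw [ih.1 h2]
        have hnh : 0 ≤ n * h := by positivity
        have h3 := hL (a + n * h) ⟨by linarith, by linarith [hθ.2]⟩ θ ⟨hθ.1.le, hθ.2.le⟩
        refine h3.trans (mul_le_mul_of_nonneg_left ?_ hL0)
        rw [abs_sub_comm, abs_of_pos (by linarith)]
        linarith
      · exact ih.2 h2

/-- The constant is independent of `n`: the jumps have total size at most `L π`, and each jump
multiplies a double sector of norm 8, so `8 π L ≤ 32 L`. -/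
theorem IsL4MultiplierWith.stepApprox {M : ℝ → ℝ} {L : NNReal}
    (hL : ∀ x ∈ Set.Icc (-(Real.pi / 2)) (Real.pi / 2),
      ∀ y ∈ Set.Icc (-(Real.pi / 2)) (Real.pi / 2), |M x - M y| ≤ L * |x - y|) (n : ℕ) :
    IsL4MultiplierWith (‖M (-(Real.pi / 2))‖₊ + L * 32) fun ξ =>
      ((stepApprox M (-(Real.pi / 2)) (Real.pi / (n + 1)) n (Real.arctan (ξ 1 / ξ 0)) : ℝ) : ℂ) := by
  set a := -(Real.pi / 2)
  -- With `n` jumps of spacing `π / (n + 1)`, every jump point lies strictly inside `(-π/2, π/2)`,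
  -- where tangent and arctangent are inverse.
  set h := Real.pi / (n + 1)
  have hh : 0 < h := by positivity
  have hnh : (n + 1) * h = Real.pi := by simp only [h]; field_simp
  have hk : ∀ k ∈ Finset.range n, IsL4MultiplierWith (‖M (a + (k + 1) * h) - M (a + k * h)‖₊ * 8)
      fun ξ => ((M (a + (k + 1) * h) - M (a + k * h) : ℝ) : ℂ) *
        ({ξ : Plane | Real.tan (a + (k + 1) * h) < ξ 1 / ξ 0}.indicator (fun _ => 1) ξ) := by
    intro k _
    have h1 := (IsL4MultiplierWith.const ((M (a + (k + 1) * h) - M (a + k * h) : ℝ) : ℂ)).mul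
      (IsL4MultiplierWith.doubleSector (Real.tan (a + (k + 1) * h)))
    rwa [Complex.nnnorm_real] at h1
  have hsum := (IsL4MultiplierWith.const (M a : ℂ)).add
    (IsL4MultiplierWith.sum (Finset.range n) hk)
  rw [Complex.nnnorm_real] at hsum
  refine (hsum.mono ?_).congr_ae (Eventually.of_forall fun ξ => ?_)
  · refine add_le_add le_rfl ?_
    have h2 : ∀ k ∈ Finset.range n, ‖M (a + (k + 1) * h) - M (a + k * h)‖₊ * 8 ≤
        L * ⟨h, hh.le⟩ * 8 := fun k hkn => by
      have hkn' : (k : ℝ) + 1 ≤ n + 1 := by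
        have := Finset.mem_range.1 hkn
        have : (k : ℝ) ≤ n := by exact_mod_cast this.le
        linarith
      have h5 : (k + 1) * h ≤ Real.pi := hnh ▸ mul_le_mul_of_nonneg_right hkn' hh.le
      have h6 : 0 ≤ k * h := by positivity
      have h7 : (k + 1) * h = k * h + h := by ring
      have h3 := hL (a + (k + 1) * h) ⟨by simp only [a] at *; linarith, by simp only [a]; linarith⟩
        (a + k * h) ⟨by simp only [a] at *; linarith, by simp only [a]; linarith⟩
      refine mul_le_mul_left ?_ 8
      rw [← NNReal.coe_le_coe]
      refine h3.trans (le_of_eq ?_)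
      have h4 : a + (k + 1) * h - (a + k * h) = h := by ring
      rw [h4, abs_of_pos hh]
      rfl
    refine (Finset.sum_le_sum h2).trans ?_
    rw [Finset.sum_const, Finset.card_range, nsmul_eq_mul, ← NNReal.coe_le_coe]
    push_cast
    have h3 : n * h ≤ 4 := by nlinarith [Real.pi_le_four]
    have : (L : ℝ) * (n * h) ≤ L * 4 := mul_le_mul_of_nonneg_left h3 L.2
    change (n : ℝ) * (L * h * 8) ≤ L * 32
    nlinarith
  · simp only [_root_.stepApprox, Complex.ofReal_add, Complex.ofReal_sum]
    congr 1
    refine Finset.sum_congr rfl fun k hkn => ?_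
    rw [Complex.ofReal_mul]
    congr 1
    have hkn' : (k : ℝ) + 1 ≤ n := by exact_mod_cast Finset.mem_range.1 hkn
    have h1 : (k + 1) * h < Real.pi := by
      rw [← hnh]; exact mul_lt_mul_of_pos_right (by linarith) hh
    have h2 : 0 < (k + 1) * h := by positivity
    have h3 : a + (k + 1) * h < Real.arctan (ξ 1 / ξ 0) ↔
        Real.tan (a + (k + 1) * h) < ξ 1 / ξ 0 := by
      have ha : a = -(Real.pi / 2) := rfl
      have h4 := Real.arctan_tan (x := a + (k + 1) * h) (by linarith) (by linarith)
      conv_lhs => rw [← h4]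
      exact Real.arctan_strictMono.lt_iff_lt
    by_cases h4 : Real.tan (a + (k + 1) * h) < ξ 1 / ξ 0
    · simp [Set.indicator, h4, h3.2 h4]
    · simp [Set.indicator, h4, h3]

/-- Symbols that are homogeneous of degree zero and smooth away from the origin are `L⁴`
multipliers. -/
theorem exists_isL4MultiplierWith_of_homogeneous {m : Plane → ℝ}
    (hm : ∀ ξ (r : ℝ), r ≠ 0 → m (r • ξ) = m ξ)
    (hC : ContDiff ℝ 1 fun θ : ℝ => m !₂[Real.cos θ, Real.sin θ]) :
    ∃ C, IsL4MultiplierWith C fun ξ => (m ξ : ℂ) := by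
  set M : ℝ → ℝ := fun θ => m !₂[Real.cos θ, Real.sin θ]
  set a := Real.pi / 2
  obtain ⟨L, hL⟩ := (isCompact_Icc (a := -a) (b := a)).exists_bound_of_continuousOn
    (hC.continuous_deriv le_rfl).continuousOn
  have hL0 : 0 ≤ L := (norm_nonneg _).trans (hL 0 ⟨by simp only [a]; linarith [Real.pi_pos],
    by simp only [a]; linarith [Real.pi_pos]⟩)
  have hLip : ∀ x ∈ Set.Icc (-a) a, ∀ y ∈ Set.Icc (-a) a, |M x - M y| ≤ L * |x - y| :=
    fun x hx y hy => (convex_Icc (-a) a).norm_image_sub_le_of_norm_deriv_le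
      (fun z _ => (hC.differentiable one_ne_zero) z) hL hy hx
  have hmM : ∀ᵐ ξ : Plane, m ξ = M (Real.arctan (ξ 1 / ξ 0)) := by
    filter_upwards [ae_coord_zero_ne_zero] with ξ hξ
    have h1 : 0 < Real.sqrt (1 + (ξ 1 / ξ 0) ^ 2) := by positivity
    -- The scalar is `±|ξ|`. Homogeneity is assumed for negative scalars too, so angles in `(-π/2,
    -- π/2)` suffice.
    have h2 : ξ = (ξ 0 * Real.sqrt (1 + (ξ 1 / ξ 0) ^ 2)) •
        !₂[Real.cos (Real.arctan (ξ 1 / ξ 0)), Real.sin (Real.arctan (ξ 1 / ξ 0))] := by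
      rw [Real.cos_arctan, Real.sin_arctan]
      ext i
      fin_cases i
      · simp; field_simp
      · simp; field_simp
    conv_lhs => rw [h2]
    exact hm _ _ (by positivity)
  obtain ⟨B, hB⟩ := (isCompact_Icc (a := -a) (b := a)).exists_bound_of_continuousOn
    hC.continuous.continuousOn
  have hθ : ∀ t, Real.arctan t ∈ Set.Ioo (-a) a := fun t => Real.arctan_mem_Ioo t
  have happ : ∀ (n : ℕ) (t : ℝ),
      |stepApprox M (-a) (Real.pi / (n + 1)) n (Real.arctan t) - M (Real.arctan t)| ≤
        L * (Real.pi / (n + 1)) := by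
    intro n t
    set h := Real.pi / ((n : ℝ) + 1)
    have hh : 0 < h := by positivity
    have hnh : (n + 1) * h = Real.pi := by simp only [h]; field_simp
    have hs := stepApprox_spec hh.le hLip hL0 (hθ t) n
    rcases lt_or_ge (-a + n * h) (Real.arctan t) with h1 | h1
    · rw [hs.1 h1]
      have h0 : 0 ≤ n * h := by positivity
      have h2 := hLip (-a + n * h) ⟨by linarith, by linarith [(hθ t).2]⟩ (Real.arctan t)
        ⟨(hθ t).1.le, (hθ t).2.le⟩
      refine h2.trans (mul_le_mul_of_nonneg_left ?_ hL0)
      rw [abs_sub_comm, abs_of_pos (by linarith)]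
      have := (hθ t).2
      simp only [a] at *
      linarith
    · exact hs.2 h1
  refine ⟨‖M (-a)‖₊ + ⟨L, hL0⟩ * 32, ?_⟩
  refine IsL4MultiplierWith.of_tendsto (n := fun n ξ =>
    ((stepApprox M (-a) (Real.pi / (n + 1)) n (Real.arctan (ξ 1 / ξ 0)) : ℝ) : ℂ))
    (fun n => IsL4MultiplierWith.stepApprox (L := ⟨L, hL0⟩) hLip n) (K := B + L * 4)
    (fun n => Eventually.of_forall fun ξ => ?_) ?_
  · rw [Complex.norm_real, Real.norm_eq_abs]
    have h1 := happ n (ξ 1 / ξ 0)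
    have h2 := hB _ (Set.Ioo_subset_Icc_self (hθ (ξ 1 / ξ 0)))
    rw [Real.norm_eq_abs] at h2
    have h3 : L * (Real.pi / (n + 1)) ≤ L * 4 := by
      refine mul_le_mul_of_nonneg_left ?_ hL0
      exact (div_le_self Real.pi_pos.le (by linarith [(Nat.cast_nonneg n : (0 : ℝ) ≤ n)])).trans
        Real.pi_le_four
    have h4 := abs_sub_abs_le_abs_sub
      (stepApprox M (-a) (Real.pi / (n + 1)) n (Real.arctan (ξ 1 / ξ 0)))
      (M (Real.arctan (ξ 1 / ξ 0)))
    linarith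
  · filter_upwards [hmM] with ξ hξ
    rw [hξ]
    refine (Complex.continuous_ofReal.tendsto _).comp ?_
    rw [tendsto_iff_dist_tendsto_zero]
    have h0 := ((tendsto_one_div_add_atTop_nhds_zero_nat (𝕜 := ℝ)).const_mul (L * Real.pi))
    rw [mul_zero] at h0
    refine squeeze_zero (fun _ => dist_nonneg) (fun n => ?_) h0
    rw [Real.dist_eq]
    refine (happ n _).trans (le_of_eq ?_)
    ring

end HomogeneousSymbols

/-! ### Weak derivatives on the Fourier side. -/

section FourierDerivative

open scoped FourierTransform SchwartzMap LineDeriv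

/-- A real valued square integrable function as an element of complex `L²`. -/
noncomputable def toL2C (f : Plane → ℝ) (hf : MemLp f 2) : L2C :=
  (hf.ofReal (K := ℂ)).toLp _

theorem coeFn_toL2C {f : Plane → ℝ} (hf : MemLp f 2) :
    (toL2C f hf : Plane → ℂ) =ᵐ[volume] fun x => (f x : ℂ) := MemLp.coeFn_toLp _

theorem exists_contDiff_cutoff {K : Set Plane} (hK : IsCompact K) {U : Set Plane} (hU : IsOpen U)
    (hKU : K ⊆ U) : ∃ η : Plane → ℝ, ContDiff ℝ ∞ η ∧ HasCompactSupport η ∧ tsupport η ⊆ U ∧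
      (∀ x, η x ∈ Set.Icc (0 : ℝ) 1) ∧ ∃ W, IsOpen W ∧ K ⊆ W ∧ ∀ x ∈ W, η x = 1 := by
  obtain ⟨t, ht, hKt, htU⟩ := exists_compact_between hK hU hKU
  obtain ⟨f, hf1, hf0, hf⟩ := exists_contMDiffMap_one_nhds_of_subset_interior (n := ⊤)
    (modelWithCornersSelf ℝ Plane) hK.isClosed hKt
  have hft : tsupport f ⊆ t := closure_minimal
    (fun x hx => by_contra fun h => hx (hf0 x h)) ht.isClosed
  obtain ⟨W, hWK, hW, h⟩ := eventually_nhdsSet_iff_exists.1 hf1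
  exact ⟨f, f.contMDiff.contDiff, HasCompactSupport.of_support_subset_isCompact ht
    ((subset_tsupport _).trans hft), hft.trans htU, hf, W, hWK, hW, h⟩

/-- Because `f` and `g` have compact support, a cutoff equal to one near both supports turns a
Schwartz function into an admissible test function; real and imaginary parts are treated separately.
-/
theorem HasWeakPartialDeriv.integral_schwartz {f g : Plane → ℝ} {j : Fin 2}
    (h : HasWeakPartialDeriv Set.univ j f g) (hfc : HasCompactSupport f)
    (hgc : HasCompactSupport g) (ψ : 𝓢(Plane, ℂ)) :
    ∫ x, ψ x * (g x : ℂ) = -∫ x, (∂_{coordVec j} ψ) x * (f x : ℂ) := by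
  obtain ⟨η, hη, hηc, -, -, W, hW, hKW, hη1⟩ := exists_contDiff_cutoff (hfc.isCompact.union
    hgc.isCompact) isOpen_univ (Set.subset_univ _)
  have hdψ : ∀ x, (∂_{coordVec j} ψ) x = fderiv ℝ ψ x (coordVec j) := fun x =>
    SchwartzMap.lineDerivOp_apply_eq_fderiv _ _ _
  have key : ∀ P : ℂ →L[ℝ] ℝ, ∫ x, P (ψ x) * g x = -∫ x, P ((∂_{coordVec j} ψ) x) * f x := by
    intro P
    have hPψ : ContDiff ℝ ∞ fun x => P (ψ x) := P.contDiff.comp (ψ.smooth ⊤)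
    have hc : HasCompactSupport fun x => η x * P (ψ x) := hηc.mul_right
    have h1 := h.integral_eq (hη.mul hPψ) hc (Set.subset_univ _)
    have h2 : ∀ x, f x * fderiv ℝ (fun x => η x * P (ψ x)) x (coordVec j) =
        P ((∂_{coordVec j} ψ) x) * f x := by
      intro x
      by_cases hx : x ∈ tsupport f
      · have hev : (fun x => η x * P (ψ x)) =ᶠ[𝓝 x] fun x => P (ψ x) := by
          filter_upwards [hW.mem_nhds (hKW (Or.inl hx))] with y hy
          rw [hη1 y hy, one_mul]
        have hd : HasFDerivAt (fun x => P (ψ x)) (P.comp (fderiv ℝ ψ x)) x :=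
          P.hasFDerivAt.comp x (ψ.differentiableAt.hasFDerivAt)
        rw [hev.fderiv_eq, hd.fderiv, hdψ, mul_comm]
        rfl
      · rw [image_eq_zero_of_notMem_tsupport hx, zero_mul, mul_zero]
    have h3 : ∀ x, g x * (η x * P (ψ x)) = P (ψ x) * g x := by
      intro x
      by_cases hx : x ∈ tsupport g
      · rw [hη1 x (hKW (Or.inr hx)), one_mul, mul_comm]
      · rw [image_eq_zero_of_notMem_tsupport hx, zero_mul, mul_zero]
    have h4 : ∫ x, f x * fderiv ℝ (fun x => η x * P (ψ x)) x (coordVec j) =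
      -∫ x, g x * (η x * P (ψ x)) := h1
    simp only [h2, h3] at h4
    rw [h4, neg_neg]
  have hint : ∀ (θ : 𝓢(Plane, ℂ)) {u : Plane → ℝ}, LocallyIntegrable u → HasCompactSupport u →
      Integrable fun x => θ x * (u x : ℂ) := by
    intro θ u hu huc
    have h1 : IntegrableOn (fun x => θ x * (u x : ℂ)) (tsupport u) :=
      IntegrableOn.continuousOn_mul θ.continuous.continuousOn
        ((hu.integrableOn_isCompact huc.isCompact).ofReal) huc.isCompact
    refine (integrableOn_iff_integrable_of_support_subset fun x hx => ?_).1 h1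
    refine subset_tsupport _ fun h0 => hx ?_
    simp [h0]
  have ig := hint ψ (memLpLoc_one_univ_iff.1 h.2.1) hgc
  have jf := hint (∂_{coordVec j} ψ) (memLpLoc_one_univ_iff.1 h.1) hfc
  apply Complex.ext
  · have k := key Complex.reCLM
    have e1 := integral_re ig
    have e2 := integral_re jf
    simp only [RCLike.re_to_complex, Complex.re_mul_ofReal] at e1 e2
    rw [Complex.neg_re, ← e1, ← e2]
    exact k
  · have k := key Complex.imCLM
    have e1 := integral_im ig
    have e2 := integral_im jf
    simp only [RCLike.im_to_complex, Complex.im_mul_ofReal] at e1 e2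
    rw [Complex.neg_im, ← e1, ← e2]
    exact k

/-- The Fourier transform turns weak derivatives into multiplication by the frequency. -/
theorem fourierInv_weakDeriv {f g : Plane → ℝ} (hf : MemLp f 2) (hg : MemLp g 2) {j : Fin 2}
    (h : HasWeakPartialDeriv Set.univ j f g) (hfc : HasCompactSupport f)
    (hgc : HasCompactSupport g) :
    ∀ᵐ ξ : Plane, (𝓕⁻ (toL2C g hg) : L2C) ξ =
      -(2 * Real.pi * Complex.I * ξ j) * (𝓕⁻ (toL2C f hf) : L2C) ξ := by
  have hloc : LocallyIntegrable fun ξ : Plane =>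
      -(2 * Real.pi * Complex.I * ξ j) * (𝓕⁻ (toL2C f hf) : L2C) ξ := by
    have h1 := (locallyIntegrable_coe (𝓕⁻ (toL2C f hf) : L2C)).locallyIntegrableOn Set.univ
    have hc : Continuous fun ξ : Plane => -(2 * Real.pi * Complex.I * ξ j : ℂ) := by fun_prop
    exact locallyIntegrableOn_univ.1 (h1.continuousOn_mul hc.continuousOn isOpen_univ.isLocallyClosed)
  refine ae_eq_of_integral_schwartz_mul (locallyIntegrable_coe _) hloc fun φ _ => ?_
  rw [integral_schwartz_mul_fourierInv]
  have h1 : ∫ x, (𝓕⁻ φ) x * (toL2C g hg) x = ∫ x, (𝓕⁻ φ) x * (g x : ℂ) :=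
    integral_congr_ae ((coeFn_toL2C hg).mono fun x hx => by simp only [hx])
  rw [h1, h.integral_schwartz hfc hgc, SchwartzMap.lineDerivOp_fourierInv_eq]
  set Φ : 𝓢(Plane, ℂ) :=
    (2 * Real.pi * Complex.I) • SchwartzMap.smulLeftCLM ℂ (inner ℝ · (coordVec j)) φ
  have h2 : ∫ x, (𝓕⁻ Φ) x * (f x : ℂ) = ∫ x, (𝓕⁻ Φ) x * (toL2C f hf) x :=
    integral_congr_ae ((coeFn_toL2C hf).mono fun x hx => by simp only [hx])
  rw [h2, ← integral_schwartz_mul_fourierInv, ← integral_neg]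
  refine integral_congr_ae (Eventually.of_forall fun ξ => ?_)
  have ht : (fun x : Plane => (inner ℝ x (coordVec j))).HasTemperateGrowth := by fun_prop
  have h3 : Φ ξ = 2 * Real.pi * Complex.I * (ξ j * φ ξ) := by
    simp only [Φ, smul_apply, SchwartzMap.smulLeftCLM_apply_apply ht]
    simp [coordVec, EuclideanSpace.inner_single_right]
  simp only [h3]
  ring

end FourierDerivative

/-! ### L⁴ integrability by a perturbation argument. -/

section FixedPoint

open scoped FourierTransform

variable {σ τ : Type*} [Fintype σ] [Fintype τ]

theorem coeFn_finset_sum_L2C {ι : Type*} (s : Finset ι) (f : ι → L2C) :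
    ((∑ i ∈ s, f i : L2C) : Plane → ℂ) =ᵐ[volume] fun x => ∑ i ∈ s, f i x := by
  classical
  induction s using Finset.induction_on with
  | empty =>
    simp only [Finset.sum_empty]
    exact Lp.coeFn_zero ℂ 2 volume
  | insert a s ha ih =>
    rw [Finset.sum_insert ha]
    filter_upwards [Lp.coeFn_add (f a) (∑ i ∈ s, f i), ih] with x h1 h2
    rw [h1, Pi.add_apply, h2, Finset.sum_insert ha]

theorem fourierInv_finset_sum_ae {ι : Type*} (s : Finset ι) (f : ι → L2C) :
    ((𝓕⁻ (∑ i ∈ s, f i) : L2C) : Plane → ℂ) =ᵐ[volume] fun ξ => ∑ i ∈ s, (𝓕⁻ (f i) : L2C) ξ := by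
  have h : (𝓕⁻ (∑ i ∈ s, f i) : L2C) = ∑ i ∈ s, 𝓕⁻ (f i) :=
    map_sum (Lp.fourierTransformₗᵢ Plane ℂ).symm f s
  rw [h]
  exact coeFn_finset_sum_L2C s _

theorem eLpNorm_four_finset_sum_le {ι : Type*} (s : Finset ι) (f : ι → L2C) :
    eLpNorm (∑ i ∈ s, f i : L2C) 4 volume ≤ ∑ i ∈ s, eLpNorm (f i) 4 volume := by
  rw [eLpNorm_congr_ae (coeFn_finset_sum_L2C s f)]
  have h := eLpNorm_sum_le (s := s) (f := fun i => (f i : Plane → ℂ)) (p := 4) (μ := volume)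
    (fun i _ => (Lp.memLp (f i)).1) (by norm_num)
  refine le_trans (le_of_eq (congrArg (fun u => eLpNorm u 4 volume) ?_)) h
  ext x
  simp

/-- Solutions in `L²` of a perturbation of the identity by small multiples of `L⁴` multipliers with
right-hand side in `L⁴` belong to `L⁴`. -/
theorem exists_memLp_four_of_fixedPoint {m : σ → τ → Plane → ℂ} {C : NNReal}
    (hm : ∀ s t, IsL4MultiplierWith C (m s t)) : ∃ δ : NNReal, 0 < δ ∧
      ∀ (E : τ → σ → Plane → ℂ), (∀ t s, AEStronglyMeasurable (E t s) volume) →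
      (∀ t s, ∀ᵐ x, ‖E t s x‖ ≤ δ) → ∀ (Y : σ → L2C) (H g : τ → L2C), (∀ t, MemLp (g t) 4) →
      (∀ t, ∀ᵐ x, H t x = (∑ s, E t s x * Y s x) + g t x) →
      (∀ s, ∀ᵐ ξ, (𝓕⁻ (Y s) : L2C) ξ = ∑ t, m s t ξ * (𝓕⁻ (H t) : L2C) ξ) →
      ∀ s, MemLp (Y s) 4 := by
  choose K₀ hK₀ using fun s t => (hm s t).bounded
  set K : NNReal := ∑ s, ∑ t, ‖K₀ s t‖₊
  have hK : ∀ s t, ∀ᵐ ξ, ‖m s t ξ‖ ≤ K := fun s t => by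
    have h1 : ‖K₀ s t‖₊ ≤ K :=
      (Finset.single_le_sum (f := fun t => ‖K₀ s t‖₊) (fun _ _ => zero_le) (Finset.mem_univ t)).trans
        (Finset.single_le_sum (f := fun s => ∑ t, ‖K₀ s t‖₊) (fun _ _ => zero_le)
          (Finset.mem_univ s))
    filter_upwards [hK₀ s t] with ξ hξ
    exact hξ.trans ((Real.le_norm_self _).trans (by exact_mod_cast h1))
  set N : NNReal := Fintype.card σ * Fintype.card τ
  -- One smallness condition serves two purposes: with the sup bound `K` it gives contraction in L²,
  -- and with the L⁴ norm `C` it keeps L⁴ bounds stable.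
  set δ : NNReal := (2 * (N * (K + C) + 1))⁻¹
  have hδ : N * (K + C) * δ ≤ 1 / 2 := by
    simp only [δ]
    rw [mul_inv_le_iff₀ (by positivity)]
    rw [← NNReal.coe_le_coe]; push_cast; linarith
  have hδK : N * K * δ ≤ 1 / 2 := le_trans (by gcongr; simp) hδ
  have hδC : N * C * δ ≤ 1 / 2 := le_trans (by gcongr; simp) hδ
  refine ⟨δ, by positivity, fun E hEm hE Y H g hg hH hY => ?_⟩
  choose T hT using fun s t => exists_fourierInv_eq_mul (hm s t).aestronglyMeasurable (hK s t)
  have hTsub : ∀ s t (f f' : L2C), ‖T s t f - T s t f'‖ ≤ K * ‖f - f'‖ := fun s t f f' => by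
    refine L2C.norm_le_of_fourierInv_eq_mul (hK s t) ?_
    filter_upwards [hT s t f, hT s t f', fourierInv_sub_ae (T s t f) (T s t f'),
      fourierInv_sub_ae f f'] with ξ h1 h2 h3 h4
    rw [h3, h4, h1, h2, mul_sub]
  have hEY : ∀ t s (y : L2C), MemLp (fun x => E t s x * y x) 2 := fun t s y =>
    memLp_symbol_mul (hEm t s) (hE t s) (Lp.memLp y)
  set G : (σ → L2C) → τ → L2C := fun y t => ∑ s, (hEY t s (y s)).toLp _ + g t
  have hEn : ∀ t s (y y' : L2C), ‖(hEY t s y).toLp _ - (hEY t s y').toLp _‖ ≤ δ * ‖y - y'‖ := by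
    intro t s y y'
    refine Lp.norm_le_mul_norm_of_ae_le_mul ?_
    filter_upwards [(hEY t s y).coeFn_toLp, (hEY t s y').coeFn_toLp, hE t s, Lp.coeFn_sub y y',
      Lp.coeFn_sub ((hEY t s y).toLp _) ((hEY t s y').toLp _)] with x h1 h2 h3 h4 h5
    rw [h5, h4, Pi.sub_apply, Pi.sub_apply, h1, h2, ← mul_sub, norm_mul]
    exact mul_le_mul_of_nonneg_right h3 (norm_nonneg _)
  have hE4 : ∀ t s (y : L2C), eLpNorm ((hEY t s y).toLp _ : L2C) 4 volume ≤
      δ * eLpNorm y 4 volume := by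
    intro t s y
    refine eLpNorm_le_nnreal_smul_eLpNorm_of_ae_le_mul ?_ 4
    filter_upwards [(hEY t s y).coeFn_toLp, hE t s] with x h1 h2
    rw [h1, nnnorm_mul, ← NNReal.coe_le_coe]
    push_cast
    exact mul_le_mul_of_nonneg_right h2 (norm_nonneg _)
  have hHG : ∀ t, H t = G Y t := fun t => by
    refine Lp.ext ?_
    filter_upwards [hH t, Lp.coeFn_add (∑ s, (hEY t s (Y s)).toLp _) (g t),
      coeFn_finset_sum_L2C Finset.univ fun s => ((hEY t s (Y s)).toLp _ : L2C),
      ae_all_iff.2 fun s => (hEY t s (Y s)).coeFn_toLp] with x h1 h2 h3 h4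
    rw [h1, h2, Pi.add_apply, h3]
    simp only [h4]
  set Ψ : (σ → L2C) → σ → L2C := fun y s => ∑ t, T s t (G y t)
  have hfix : ∀ s, Y s = Ψ Y s := fun s => by
    refine L2C.eq_of_fourierInv_ae_eq ?_
    filter_upwards [hY s, fourierInv_finset_sum_ae Finset.univ fun t => T s t (G Y t),
      ae_all_iff.2 fun t => hT s t (G Y t)] with ξ h1 h2 h3
    rw [h1, h2]
    simp only [h3, hHG]
  -- The solution is not known to be in L⁴, so its L⁴ norm cannot be absorbed. The iterates from
  -- zero are in L⁴, and they converge in L² to the fixed point `Y`.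
  set y : ℕ → σ → L2C := fun n => Ψ^[n] fun _ => 0
  have hy : ∀ n, y (n + 1) = Ψ (y n) := fun n => Function.iterate_succ_apply' _ _ _
  have hcontr : ∀ u v : σ → L2C, ∑ s, ‖Ψ u s - Ψ v s‖ ≤ 1 / 2 * ∑ s, ‖u s - v s‖ := by
    intro u v
    have h1 : ∀ t, ‖G u t - G v t‖ ≤ δ * ∑ s, ‖u s - v s‖ := fun t => by
      simp only [G, add_sub_add_right_eq_sub]
      rw [← Finset.sum_sub_distrib, Finset.mul_sum]
      exact (norm_sum_le _ _).trans (Finset.sum_le_sum fun s _ => hEn t s _ _)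
    have h2 : ∀ s, ‖Ψ u s - Ψ v s‖ ≤ Fintype.card τ * (K * (δ * ∑ s, ‖u s - v s‖)) := fun s => by
      simp only [Ψ]
      rw [← Finset.sum_sub_distrib]
      refine (norm_sum_le _ _).trans ?_
      refine (Finset.sum_le_card_nsmul Finset.univ _ (K * (δ * ∑ s, ‖u s - v s‖))
        fun t _ => ?_).trans (le_of_eq (by rw [nsmul_eq_mul]; rfl))
      exact (hTsub s t _ _).trans (mul_le_mul_of_nonneg_left (h1 t) K.2)
    refine (Finset.sum_le_card_nsmul Finset.univ _ _ fun s _ => h2 s).trans ?_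
    rw [nsmul_eq_mul]
    have h3 : (N : ℝ) * K * δ ≤ 1 / 2 := by exact_mod_cast hδK
    have h4 : (N : ℝ) = Fintype.card σ * Fintype.card τ := by simp [N]
    rw [h4] at h3
    refine le_trans (le_of_eq ?_) (mul_le_mul_of_nonneg_right h3
      (Finset.sum_nonneg fun s _ => norm_nonneg (u s - v s)))
    simp only [Finset.card_univ]
    ring
  have hlim : ∀ s, Tendsto (fun n => y n s) atTop (𝓝 (Y s)) := by
    have h1 : ∀ n, ∑ s, ‖y n s - Y s‖ ≤ (1 / 2) ^ n * ∑ s, ‖y 0 s - Y s‖ := by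
      intro n
      induction n with
      | zero => simp
      | succ n ih =>
        have h2 := hcontr (y n) Y
        have h3 : ∑ s, ‖y (n + 1) s - Y s‖ = ∑ s, ‖Ψ (y n) s - Ψ Y s‖ := by
          rw [hy]
          exact Finset.sum_congr rfl fun s _ => by rw [← hfix s]
        rw [h3, pow_succ', mul_assoc]
        exact h2.trans (mul_le_mul_of_nonneg_left ih (by norm_num))
    intro s
    rw [tendsto_iff_norm_sub_tendsto_zero]
    have h0 := (tendsto_pow_atTop_nhds_zero_of_lt_one (r := (1 / 2 : ℝ)) (by norm_num)
      (by norm_num)).mul_const (∑ s, ‖y 0 s - Y s‖)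
    rw [zero_mul] at h0
    exact squeeze_zero (fun _ => norm_nonneg _) (fun n => (Finset.single_le_sum
      (f := fun s => ‖y n s - Y s‖) (fun _ _ => norm_nonneg _) (Finset.mem_univ s)).trans (h1 n)) h0
  set Γ : ℝ≥0∞ := Fintype.card σ * (C * ∑ t, eLpNorm (g t) 4 volume)
  have hΓ : Γ ≠ ⊤ := ENNReal.mul_ne_top (by simp) (ENNReal.mul_ne_top (by simp)
    (ENNReal.sum_ne_top.2 fun t _ => (hg t).2.ne))
  -- The recursion is at worst `b ↦ b / 2 + Γ`, which preserves the bound `2 * Γ`.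
  have hb : ∀ n, ∑ s, eLpNorm (y n s) 4 volume ≤ 2 * Γ := by
    intro n
    induction n with
    | zero =>
      have : ∀ s, eLpNorm (y 0 s) 4 volume = 0 := fun s => by
        simp only [y, Function.iterate_zero, id_eq]
        rw [eLpNorm_congr_ae (Lp.coeFn_zero ℂ 2 volume), eLpNorm_zero]
      simp [this]
    | succ n ih =>
      have hyn : ∀ s, eLpNorm (y n s) 4 volume < ⊤ := fun s =>
        ((Finset.single_le_sum (f := fun s => eLpNorm (y n s) 4 volume) (fun _ _ => zero_le)
          (Finset.mem_univ s)).trans ih).trans_lt (ENNReal.mul_ne_top (by simp) hΓ).lt_top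
      have hG4 : ∀ t, eLpNorm (G (y n) t) 4 volume ≤
          δ * ∑ s, eLpNorm (y n s) 4 volume + eLpNorm (g t) 4 volume := fun t => by
        simp only [G]
        rw [eLpNorm_congr_ae (Lp.coeFn_add _ _)]
        refine (eLpNorm_add_le (Lp.memLp _).1 (Lp.memLp _).1 (by norm_num)).trans
          (add_le_add ((eLpNorm_four_finset_sum_le _ _).trans ?_) le_rfl)
        rw [Finset.mul_sum]
        exact Finset.sum_le_sum fun s _ => hE4 t s _
      have hG4' : ∀ t, MemLp (G (y n) t) 4 := fun t =>
        ⟨(Lp.memLp _).1, (hG4 t).trans_lt (ENNReal.add_lt_top.2 ⟨ENNReal.mul_lt_top (by simp)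
          (ENNReal.sum_lt_top.2 fun s _ => hyn s), (hg t).2⟩)⟩
      have h1 : ∀ s, eLpNorm (y (n + 1) s) 4 volume ≤
          C * (Fintype.card τ * (δ * ∑ s, eLpNorm (y n s) 4 volume)
            + ∑ t, eLpNorm (g t) 4 volume) := fun s => by
        rw [hy]
        refine (eLpNorm_four_finset_sum_le _ _).trans ?_
        refine (Finset.sum_le_sum fun t _ => ((hm s t).le _ _ (hG4' t) (hT s t _)).trans
          (mul_le_mul_right (hG4 t) _)).trans (le_of_eq ?_)
        rw [← Finset.mul_sum, Finset.sum_add_distrib, Finset.sum_const, nsmul_eq_mul]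
        rfl
      refine (Finset.sum_le_sum fun s _ => h1 s).trans ?_
      rw [Finset.sum_const, nsmul_eq_mul, Finset.card_univ]
      have h2 : (N : ℝ≥0∞) * C * δ ≤ ((1 / 2 : NNReal) : ℝ≥0∞) := by exact_mod_cast hδC
      have h3 : (N : ℝ≥0∞) = Fintype.card σ * Fintype.card τ := by simp [N]
      calc (Fintype.card σ : ℝ≥0∞) * (C * (Fintype.card τ * (δ * ∑ s, eLpNorm (y n s) 4 volume)
            + ∑ t, eLpNorm (g t) 4 volume))
          = N * C * δ * (∑ s, eLpNorm (y n s) 4 volume) + Γ := by rw [h3]; ring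
        _ ≤ ((1 / 2 : NNReal) : ℝ≥0∞) * (2 * Γ) + Γ := by gcongr
        _ = 2 * Γ := by
          rw [← mul_assoc]
          have : ((1 / 2 : NNReal) : ℝ≥0∞) * 2 = 1 := by
            rw [show (2 : ℝ≥0∞) = ((2 : NNReal) : ℝ≥0∞) from rfl, ← ENNReal.coe_mul]
            norm_num
          rw [this]; ring
  intro s
  refine ⟨(Lp.memLp (Y s)).1, lt_of_le_of_lt (eLpNorm_four_le_of_tendsto (C := 2 * Γ) (hlim s)
    (fun n => (Finset.single_le_sum (f := fun s => eLpNorm (y n s) 4 volume) (fun _ _ => zero_le)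
      (Finset.mem_univ s)).trans (hb n)) tendsto_const_nhds)
    (ENNReal.mul_ne_top (by simp) hΓ).lt_top⟩

end FixedPoint

/-! ### The system with constant coefficients. -/

section FrozenSystem

open scoped FourierTransform

theorem contDiff_matrix_det {n : Type*} [Fintype n] [DecidableEq n] {A : ℝ → Matrix n n ℝ}
    {k : ℕ∞ω} (h : ∀ i j, ContDiff ℝ k fun θ => A θ i j) : ContDiff ℝ k fun θ => (A θ).det := by
  simp only [Matrix.det_apply]
  exact ContDiff.sum fun σ _ => (contDiff_prod fun i _ => h _ _).const_smul _

theorem contDiff_matrix_inv {n : Type*} [Fintype n] [DecidableEq n] {A : ℝ → Matrix n n ℝ}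
    {k : ℕ∞ω} (h : ∀ i j, ContDiff ℝ k fun θ => A θ i j) (h0 : ∀ θ, (A θ).det ≠ 0) (i j : n) :
    ContDiff ℝ k fun θ => (A θ)⁻¹ i j := by
  simp only [Matrix.inv_def, Ring.inverse_eq_inv', Matrix.smul_apply, Matrix.adjugate_apply,
    smul_eq_mul]
  refine ((contDiff_matrix_det h).inv h0).mul (contDiff_matrix_det fun i' j' => ?_)
  by_cases hi : i' = j
  · subst hi
    simp only [Matrix.updateRow_self]
    exact contDiff_const
  · simp only [Matrix.updateRow_ne hi]
    exact h i' j'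

variable {I J : Type*} [Fintype I] [Fintype J]

/-- The rows of a linear graph over `X`. -/
def linearStack (B : J → Fin 2 → I × Fin 2 → ℝ) (X : I × Fin 2 → ℝ) : I ⊕ J → Fin 2 → ℝ :=
  Sum.elim (fun i j => X (i, j)) fun l j => ∑ s, B l j s * X s

/-- The symbol of the second order system obtained by eliminating the graph variables. -/
def eliminationSymbol (B : J → Fin 2 → I × Fin 2 → ℝ) (ξ : Plane) : Matrix J I ℝ :=
  Matrix.of fun l i => ∑ j, (ξ 0 * B l 1 (i, j) - ξ 1 * B l 0 (i, j)) * ξ j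

omit [Fintype I] [Fintype J] in
theorem eliminationSymbol_smul (B : J → Fin 2 → I × Fin 2 → ℝ) (r : ℝ) (ξ : Plane) :
    eliminationSymbol B (r • ξ) = r ^ 2 • eliminationSymbol B ξ := by
  ext l i
  simp only [eliminationSymbol, Matrix.of_apply, Matrix.smul_apply, PiLp.smul_apply, smul_eq_mul,
    Fin.sum_univ_two]
  ring

-- For the rank-one matrix `y ⊗ ξ`, the symbol expresses the curl of the lower rows of the linear
-- graph, that is, their cross product with `ξ`.
omit [Fintype J] in
theorem sum_linearStack_cross (B : J → Fin 2 → I × Fin 2 → ℝ) (X : I × Fin 2 → ℝ) (ξ : Plane)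
    (l : J) (y : I → ℝ) (hX : ∀ i j, X (i, j) = y i * ξ j) :
    ξ 0 * (∑ s, B l 1 s * X s) - ξ 1 * (∑ s, B l 0 s * X s) =
      ∑ i, eliminationSymbol B ξ l i * y i := by
  simp only [Fintype.sum_prod_type, hX, eliminationSymbol, Matrix.of_apply, Finset.mul_sum,
    Finset.sum_mul, ← Finset.sum_sub_distrib]
  refine Finset.sum_congr rfl fun i _ => Finset.sum_congr rfl fun j _ => ?_
  ring

variable {c : I ⊕ J → I ⊕ J → ℝ} {B : J → Fin 2 → I × Fin 2 → ℝ}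

/-- If the symbol annihilates `y`, every row of the graph matrix over `X = y ⊗ ξ` is parallel to
`ξ`. All minors then vanish, and coercivity forces `X = 0`. -/
theorem eliminationSymbol_injective
    (hB : ∀ X : I × Fin 2 → ℝ, ∑ s, X s ^ 2 ≤ detForm c (linearStack B X)) {ξ : Plane}
    (hξ : ξ ≠ 0) {y : I → ℝ} (hy : (eliminationSymbol B ξ).mulVec y = 0) : y = 0 := by
  set X : I × Fin 2 → ℝ := fun s => y s.1 * ξ s.2
  have hrow : ∀ a, ξ 0 * linearStack B X a 1 = ξ 1 * linearStack B X a 0 := by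
    rintro (i | l)
    · simp only [linearStack, Sum.elim_inl, X]; ring
    · have h1 := sum_linearStack_cross B X ξ l y fun _ _ => rfl
      have h2 : ∑ i, eliminationSymbol B ξ l i * y i = 0 := congrFun hy l
      rw [h2, sub_eq_zero] at h1
      simpa only [linearStack, Sum.elim_inr] using h1
  have hξ' : ξ 0 ≠ 0 ∨ ξ 1 ≠ 0 := by
    by_contra! h
    exact hξ (by ext i; fin_cases i <;> simp [h.1, h.2])
  have hdet : detForm c (linearStack B X) = 0 := by
    unfold detForm
    refine Finset.sum_eq_zero fun a _ => Finset.sum_eq_zero fun b _ => ?_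
    have ha := hrow a
    have hb := hrow b
    have : linearStack B X a 0 * linearStack B X b 1 - linearStack B X a 1 * linearStack B X b 0 =
        0 := by
      rcases hξ' with h | h
      · refine (mul_eq_zero.1 (?_ : ξ 0 * _ = 0)).resolve_left h
        linear_combination linearStack B X a 0 * hb - linearStack B X b 0 * ha
      · refine (mul_eq_zero.1 (?_ : ξ 1 * _ = 0)).resolve_left h
        linear_combination linearStack B X a 1 * hb - linearStack B X b 1 * ha
    rw [this, mul_zero]
  have hX := hB X
  rw [hdet] at hX
  have hX0 := (Finset.sum_eq_zero_iff_of_nonneg fun s _ => sq_nonneg (X s)).1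
    (le_antisymm hX (Finset.sum_nonneg fun s _ => sq_nonneg _))
  ext i
  rcases hξ' with h | h
  · exact (mul_eq_zero.1 (pow_eq_zero_iff two_ne_zero |>.1 (hX0 (i, 0) (Finset.mem_univ _)))).resolve_right h
  · exact (mul_eq_zero.1 (pow_eq_zero_iff two_ne_zero |>.1 (hX0 (i, 1) (Finset.mem_univ _)))).resolve_right h

variable [DecidableEq I]

/-- The left inverse `(LᵀL)⁻¹Lᵀ` of the elimination symbol. -/
noncomputable def eliminationInverse (B : J → Fin 2 → I × Fin 2 → ℝ) (ξ : Plane) : Matrix I J ℝ :=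
  ((eliminationSymbol B ξ).transpose * eliminationSymbol B ξ)⁻¹ * (eliminationSymbol B ξ).transpose

theorem det_gram_eliminationSymbol_ne_zero
    (hB : ∀ X : I × Fin 2 → ℝ, ∑ s, X s ^ 2 ≤ detForm c (linearStack B X)) {ξ : Plane}
    (hξ : ξ ≠ 0) : ((eliminationSymbol B ξ).transpose * eliminationSymbol B ξ).det ≠ 0 := by
  intro h
  obtain ⟨v, hv, h0⟩ := Matrix.exists_mulVec_eq_zero_iff.2 h
  refine hv (eliminationSymbol_injective hB hξ ?_)
  rw [← Matrix.mulVec_mulVec] at h0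
  have h1 : dotProduct ((eliminationSymbol B ξ).mulVec v) ((eliminationSymbol B ξ).mulVec v) = 0 := by
    have h2 : dotProduct v ((eliminationSymbol B ξ).transpose.mulVec
      ((eliminationSymbol B ξ).mulVec v)) = 0 := by rw [h0, dotProduct_zero]
    rwa [Matrix.dotProduct_mulVec, Matrix.vecMul_transpose] at h2
  exact dotProduct_self_eq_zero.1 h1

theorem eliminationInverse_mul
    (hB : ∀ X : I × Fin 2 → ℝ, ∑ s, X s ^ 2 ≤ detForm c (linearStack B X)) {ξ : Plane}
    (hξ : ξ ≠ 0) : eliminationInverse B ξ * eliminationSymbol B ξ = 1 := by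
  rw [eliminationInverse, Matrix.mul_assoc]
  exact Matrix.nonsing_inv_mul _ (isUnit_iff_ne_zero.2 (det_gram_eliminationSymbol_ne_zero hB hξ))

theorem eliminationInverse_smul (B : J → Fin 2 → I × Fin 2 → ℝ) {r : ℝ} (hr : r ≠ 0) (ξ : Plane) :
    r ^ 2 • eliminationInverse B (r • ξ) = eliminationInverse B ξ := by
  set A := (eliminationSymbol B ξ).transpose * eliminationSymbol B ξ with hA
  have hr4 : r ^ 4 ≠ 0 := pow_ne_zero 4 hr
  have h1 : (eliminationSymbol B (r • ξ)).transpose * eliminationSymbol B (r • ξ) = r ^ 4 • A := by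
    rw [eliminationSymbol_smul, Matrix.transpose_smul, Matrix.smul_mul, Matrix.mul_smul, smul_smul,
      hA]
    ring_nf
  have h2 : (r ^ 4 • A)⁻¹ = (r ^ 4)⁻¹ • A⁻¹ := by
    -- The scaling law is stated without invertibility; in the singular case both inverses have the
    -- default value zero.
    by_cases hdet : IsUnit A.det
    · have h3 := Matrix.inv_smul' A (Units.mk0 (r ^ 4) hr4) hdet
      simpa [Units.smul_def] using h3
    · have h3 : ¬ IsUnit (r ^ 4 • A).det := by
        rw [Matrix.det_smul, isUnit_iff_ne_zero] at *
        simpa [hr] using hdet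
      rw [Matrix.nonsing_inv_apply_not_isUnit _ hdet, Matrix.nonsing_inv_apply_not_isUnit _ h3,
        smul_zero]
  rw [eliminationInverse, h1, h2, eliminationSymbol_smul, Matrix.transpose_smul, Matrix.smul_mul,
    Matrix.mul_smul, smul_smul, smul_smul, eliminationInverse, ← hA]
  have h5 : r ^ 2 * (r ^ 4)⁻¹ * r ^ 2 = 1 := by field_simp
  have h6 : r ^ 2 * ((r ^ 4)⁻¹ * r ^ 2) = 1 := by rw [← mul_assoc, h5]
  first | rw [h6, one_smul] | rw [h5, one_smul]

/-- The multipliers which recover the gradient from the defect of the frozen graph equation. -/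
noncomputable def recoverySymbol (B : J → Fin 2 → I × Fin 2 → ℝ) (s : I × Fin 2) (t : J × Fin 2)
    (ξ : Plane) : ℝ :=
  eliminationInverse B ξ s.1 t.1 * (ξ s.2 * (if t.2 = 0 then ξ 1 else -ξ 0))

/-- The left inverse has degree -2 and is multiplied by a quadratic polynomial in the frequency, so
the product has degree zero. It is smooth on the circle because the Gram determinant never vanishes
there. -/
theorem exists_isL4MultiplierWith_recoverySymbol
    (hB : ∀ X : I × Fin 2 → ℝ, ∑ s, X s ^ 2 ≤ detForm c (linearStack B X)) :
    ∃ C, ∀ s t, IsL4MultiplierWith C fun ξ => (recoverySymbol B s t ξ : ℂ) := by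
  have h : ∀ s t, ∃ C, IsL4MultiplierWith C fun ξ => (recoverySymbol B s t ξ : ℂ) := by
    intro s t
    refine exists_isL4MultiplierWith_of_homogeneous (fun ξ r hr => ?_) ?_
    · simp only [recoverySymbol]
      rw [← eliminationInverse_smul B hr ξ]
      simp only [Matrix.smul_apply, PiLp.smul_apply, smul_eq_mul]
      split_ifs <;> ring
    · have hL : ∀ l i, ContDiff ℝ 1 fun θ : ℝ =>
          eliminationSymbol B !₂[Real.cos θ, Real.sin θ] l i := fun l i => by
        simp only [eliminationSymbol, Matrix.of_apply, Fin.sum_univ_two]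
        simp
        fun_prop
      have hG : ∀ i i', ContDiff ℝ 1 fun θ : ℝ =>
          ((eliminationSymbol B !₂[Real.cos θ, Real.sin θ]).transpose *
            eliminationSymbol B !₂[Real.cos θ, Real.sin θ]) i i' := fun i i' => by
        simp only [Matrix.mul_apply, Matrix.transpose_apply]
        exact ContDiff.sum fun l _ => (hL l i).mul (hL l i')
      have hne : ∀ θ : ℝ, !₂[Real.cos θ, Real.sin θ] ≠ (0 : Plane) := fun θ h => by
        have h0 : Real.cos θ = 0 := by simpa using congrArg (fun x : Plane => x 0) h
        have h1 : Real.sin θ = 0 := by simpa using congrArg (fun x : Plane => x 1) h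
        have := Real.sin_sq_add_cos_sq θ
        rw [h0, h1] at this
        norm_num at this
      have hS : ContDiff ℝ 1 fun θ : ℝ =>
          eliminationInverse B !₂[Real.cos θ, Real.sin θ] s.1 t.1 := by
        simp only [eliminationInverse, Matrix.mul_apply (N := Matrix.transpose _),
          Matrix.transpose_apply]
        exact ContDiff.sum fun i _ => (contDiff_matrix_inv hG
          (fun θ => det_gram_eliminationSymbol_ne_zero hB (hne θ)) s.1 i).mul (hL t.1 i)
      have hco : ∀ j : Fin 2, ContDiff ℝ 1 fun θ : ℝ => (!₂[Real.cos θ, Real.sin θ] : Plane) j :=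
        fun j => by
          fin_cases j
          · simpa using Real.contDiff_cos
          · simpa using Real.contDiff_sin
      simp only [recoverySymbol]
      refine hS.mul ((hco s.2).mul ?_)
      split_ifs
      · exact hco 1
      · exact (hco 0).neg
  choose C hC using h
  exact ⟨∑ s, ∑ t, C s t, fun s t => (hC s t).mono
    ((Finset.single_le_sum (f := fun t => C s t) (fun _ _ => zero_le) (Finset.mem_univ t)).trans
      (Finset.single_le_sum (f := fun s => ∑ t, C s t) (fun _ _ => zero_le) (Finset.mem_univ s)))⟩

/-- The gradient of `a` is recovered from the defect `Db - B Da`. -/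
theorem fourierInv_eq_sum_recoverySymbol
    (hB : ∀ X : I × Fin 2 → ℝ, ∑ s, X s ^ 2 ≤ detForm c (linearStack B X))
    {w : I ⊕ J → Plane → ℝ} {D : I ⊕ J → Fin 2 → Plane → ℝ} (hw : ∀ a, MemLp (w a) 2)
    (hD : ∀ a j, MemLp (D a j) 2) (hwD : ∀ a j, HasWeakPartialDeriv Set.univ j (w a) (D a j))
    (hwc : ∀ a, HasCompactSupport (w a)) (hDc : ∀ a j, HasCompactSupport (D a j))
    {H : J × Fin 2 → L2C} (hH : ∀ t, ∀ᵐ x, H t x =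
      ((D (Sum.inr t.1) t.2 x - ∑ s : I × Fin 2, B t.1 t.2 s * D (Sum.inl s.1) s.2 x : ℝ) : ℂ))
    (s : I × Fin 2) :
    ∀ᵐ ξ, (𝓕⁻ (toL2C (D (Sum.inl s.1) s.2) (hD _ _)) : L2C) ξ =
      ∑ t, (recoverySymbol B s t ξ : ℂ) * (𝓕⁻ (H t) : L2C) ξ := by
  have hH' : ∀ t, H t = toL2C (D (Sum.inr t.1) t.2) (hD _ _) -
      ∑ s : I × Fin 2, (B t.1 t.2 s : ℂ) • toL2C (D (Sum.inl s.1) s.2) (hD _ _) := fun t => by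
    refine Lp.ext ?_
    filter_upwards [hH t, Lp.coeFn_sub (toL2C (D (Sum.inr t.1) t.2) (hD _ _))
      (∑ s : I × Fin 2, (B t.1 t.2 s : ℂ) • toL2C (D (Sum.inl s.1) s.2) (hD _ _)),
      coeFn_finset_sum_L2C Finset.univ fun s : I × Fin 2 =>
        (B t.1 t.2 s : ℂ) • toL2C (D (Sum.inl s.1) s.2) (hD _ _),
      ae_all_iff.2 fun s : I × Fin 2 => Lp.coeFn_smul (B t.1 t.2 s : ℂ)
        (toL2C (D (Sum.inl s.1) s.2) (hD _ _)),
      ae_all_iff.2 fun s : I × Fin 2 => coeFn_toL2C (hD (Sum.inl s.1) s.2),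
      coeFn_toL2C (hD (Sum.inr t.1) t.2)] with x h1 h2 h3 h4 h5 h6
    rw [h1, h2, Pi.sub_apply, h3, h6]
    simp only [h4, Pi.smul_apply, h5, smul_eq_mul]
    push_cast
    rfl
  have hF : ∀ t, ∀ᵐ ξ, (𝓕⁻ (H t) : L2C) ξ = (𝓕⁻ (toL2C (D (Sum.inr t.1) t.2) (hD _ _)) : L2C) ξ -
      ∑ s : I × Fin 2, (B t.1 t.2 s : ℂ) *
        (𝓕⁻ (toL2C (D (Sum.inl s.1) s.2) (hD _ _)) : L2C) ξ := fun t => by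
    rw [hH']
    filter_upwards [fourierInv_sub_ae (toL2C (D (Sum.inr t.1) t.2) (hD _ _))
      (∑ s : I × Fin 2, (B t.1 t.2 s : ℂ) • toL2C (D (Sum.inl s.1) s.2) (hD _ _)),
      fourierInv_finset_sum_ae Finset.univ fun s : I × Fin 2 =>
        (B t.1 t.2 s : ℂ) • toL2C (D (Sum.inl s.1) s.2) (hD _ _),
      ae_all_iff.2 fun s : I × Fin 2 => fourierInv_const_smul_ae (B t.1 t.2 s : ℂ)
        (toL2C (D (Sum.inl s.1) s.2) (hD _ _))] with ξ h1 h2 h3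
    rw [h1, h2]
    simp only [h3]
  have hder := ae_all_iff.2 fun a => ae_all_iff.2 fun j =>
    fourierInv_weakDeriv (hw a) (hD a j) (hwD a j) (hwc a) (hDc a j)
  filter_upwards [ae_all_iff.2 hF, hder, ae_coord_zero_ne_zero] with ξ h1 h2 h3
  have hξ : ξ ≠ 0 := fun h => h3 (by simp [h])
  set κ : ℂ := -(2 * Real.pi * Complex.I)
  set y : I → ℂ := fun i => κ * (𝓕⁻ (toL2C (w (Sum.inl i)) (hw _)) : L2C) ξ
  have hX : ∀ i j, (𝓕⁻ (toL2C (D (Sum.inl i) j) (hD _ _)) : L2C) ξ = y i * ξ j := fun i j => by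
    rw [h2]; simp only [y, κ]; ring
  -- Taking the curl of the defect cancels the lower-row gradients, whose curl is zero, and leaves
  -- the symbol applied to `y`.
  have hcross : ∀ l, (𝓕⁻ (H (l, 0)) : L2C) ξ * ξ 1 - (𝓕⁻ (H (l, 1)) : L2C) ξ * ξ 0 =
      ∑ i, (eliminationSymbol B ξ l i : ℂ) * y i := fun l => by
    rw [h1, h1, h2, h2]
    simp only [Fintype.sum_prod_type, hX, eliminationSymbol, Matrix.of_apply, sub_mul,
      Finset.sum_mul, Complex.ofReal_sum, Complex.ofReal_mul, Complex.ofReal_sub]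
    rw [sub_sub_sub_comm, show ∀ u : ℂ, -(2 * Real.pi * Complex.I * ξ 0) * u * ξ 1 -
      -(2 * Real.pi * Complex.I * ξ 1) * u * ξ 0 = 0 from fun u => by ring, zero_sub, neg_sub]
    rw [← Finset.sum_sub_distrib]
    refine Finset.sum_congr rfl fun i _ => ?_
    rw [← Finset.sum_sub_distrib]
    refine Finset.sum_congr rfl fun j _ => ?_
    ring
  have hinv : ∀ i, y i = ∑ l, (eliminationInverse B ξ i l : ℂ) *
      ((𝓕⁻ (H (l, 0)) : L2C) ξ * ξ 1 - (𝓕⁻ (H (l, 1)) : L2C) ξ * ξ 0) := fun i => by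
    have h4 : ∀ i', ∑ l, (eliminationInverse B ξ i l : ℂ) * (eliminationSymbol B ξ l i' : ℂ) =
        if i = i' then 1 else 0 := fun i' => by
      have := congrFun (congrFun (eliminationInverse_mul hB hξ) i) i'
      rw [Matrix.mul_apply, Matrix.one_apply] at this
      have h5 := congrArg (fun r : ℝ => (r : ℂ)) this
      simp only [Complex.ofReal_sum, Complex.ofReal_mul] at h5
      rw [h5]
      split_ifs <;> simp
    simp only [hcross, Finset.mul_sum]
    rw [Finset.sum_comm]
    simp only [← mul_assoc, ← Finset.sum_mul, h4]
    simp
  obtain ⟨i, j⟩ := s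
  rw [hX, hinv, Finset.sum_mul, Fintype.sum_prod_type]
  refine Finset.sum_congr rfl fun l _ => ?_
  simp only [Fin.sum_univ_two, recoverySymbol]
  simp
  ring

end FrozenSystem

/-! ### Differentiating the inclusion and continuity of the gradient. -/

section DifferentiatedSystem

/-- Symmetry of second weak derivatives. -/
theorem HasWeakPartialDeriv.swap {U : Set Plane} {j k : Fin 2} {v gj gk h : Plane → ℝ}
    (hj : HasWeakPartialDeriv U j v gj) (hk : HasWeakPartialDeriv U k v gk)
    (hjk : HasWeakPartialDeriv U k gj h) : HasWeakPartialDeriv U j gk h := by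
  refine hasWeakPartialDeriv_of_integral_eq hk.2.1 hjk.2.1 fun φ hφ hc hs => ?_
  have h1 := hk.integral_eq (contDiff_fderiv_coord hφ j) (hasCompactSupport_fderiv_coord hc j)
    ((tsupport_fderiv_coord_subset φ j).trans hs)
  have h2 := hj.integral_eq (contDiff_fderiv_coord hφ k) (hasCompactSupport_fderiv_coord hc k)
    ((tsupport_fderiv_coord_subset φ k).trans hs)
  have h3 := hjk.integral_eq hφ hc hs
  simp_rw [fderiv_fderiv_coord_comm hφ j k] at h1
  linarith

theorem memLp_bdd_mul {f g : Plane → ℝ} {p : ℝ≥0∞} {C : ℝ} {μ : Measure Plane}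
    (hf : AEStronglyMeasurable f μ) (hC : ∀ᵐ x ∂μ, |f x| ≤ C) (hg : MemLp g p μ) :
    MemLp (fun x => f x * g x) p μ := by
  refine MemLp.of_le_mul (c := C) hg (hf.mul hg.1) (hC.mono fun x hx => ?_)
  rw [norm_mul]
  exact mul_le_mul_of_nonneg_right hx (norm_nonneg _)

variable {I J : Type*} [Fintype I] [Fintype J]

omit [Fintype J] in
theorem aestronglyMeasurable_stackDeriv {Φ : J → Fin 2 → (I × Fin 2 → ℝ) → ℝ}
    (hΦ : ∀ l j, ContDiff ℝ 1 (Φ l j)) {p X : I × Fin 2 → Plane → ℝ}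
    (hp : ∀ s, AEStronglyMeasurable (p s) volume) (hX : ∀ s, AEStronglyMeasurable (X s) volume)
    (a : I ⊕ J) (j : Fin 2) :
    AEStronglyMeasurable (fun x => stackDeriv Φ (fun s => p s x) (fun s => X s x) a j) volume := by
  cases a with
  | inl i => exact hX (i, j)
  | inr l =>
    have h1 : ∀ {p : I × Fin 2 → Plane → ℝ}, (∀ s, AEStronglyMeasurable (p s) volume) →
        AEStronglyMeasurable (fun x s => p s x) (volume : Measure Plane) := fun hp =>
      (aemeasurable_pi_lambda _ fun i => (hp i).aemeasurable).aestronglyMeasurable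
    have h2 := ((hΦ l j).continuous_fderiv (by simp)).comp_aestronglyMeasurable (h1 hp)
    exact isBoundedBilinearMap_apply.continuous.comp_aestronglyMeasurable (h2.prodMk (h1 hX))

theorem memLp_stackDeriv {Φ : J → Fin 2 → (I × Fin 2 → ℝ) → ℝ}
    (hΦ : ∀ l j, ContDiff ℝ 1 (Φ l j)) {p X : I × Fin 2 → Plane → ℝ} {C : ℝ}
    (hp : ∀ s, AEStronglyMeasurable (p s) volume) (hpC : ∀ᵐ x, ‖fun s => p s x‖ ≤ C)
    (hX : ∀ s, MemLp (X s) 2) (a : I ⊕ J) (j : Fin 2) :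
    MemLp (fun x => stackDeriv Φ (fun s => p s x) (fun s => X s x) a j) 2 := by
  obtain ⟨L, hL0, hL⟩ := exists_stackDeriv_bound hΦ C
  have hsum : MemLp (fun x => ∑ s, |X s x|) 2 := memLp_finsetSum _ fun s _ => (hX s).abs
  refine MemLp.of_le_mul (c := L) hsum
    (aestronglyMeasurable_stackDeriv hΦ hp (fun s => (hX s).1) a j) (hpC.mono fun x hx => ?_)
  have h1 := hL _ (fun s => X s x) hx
  have h2 : |stackDeriv Φ (fun s => p s x) (fun s => X s x) a j| ≤
      ∑ a, ∑ j, |stackDeriv Φ (fun s => p s x) (fun s => X s x) a j| :=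
    (Finset.single_le_sum (f := fun j => |stackDeriv Φ (fun s => p s x) (fun s => X s x) a j|)
      (fun _ _ => abs_nonneg _) (Finset.mem_univ j)).trans
    (Finset.single_le_sum
      (f := fun a => ∑ j, |stackDeriv Φ (fun s => p s x) (fun s => X s x) a j|)
      (fun _ _ => Finset.sum_nonneg fun _ _ => abs_nonneg _) (Finset.mem_univ a))
  have h3 : Real.sqrt (∑ s, X s x ^ 2) ≤ ∑ s, |X s x| := by
    refine Real.sqrt_le_iff.2 ⟨Finset.sum_nonneg fun _ _ => abs_nonneg _, ?_⟩
    simpa using Finset.sum_sq_le_sq_sum_of_nonneg (s := Finset.univ) (f := fun s => |X s x|)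
      fun _ _ => abs_nonneg _
  have h4 : ‖∑ s, |X s x|‖ = ∑ s, |X s x| :=
    Real.norm_of_nonneg (Finset.sum_nonneg fun _ _ => abs_nonneg _)
  rw [Real.norm_eq_abs, h4]
  exact h2.trans (h1.trans (mul_le_mul_of_nonneg_left h3 hL0))

/-- The differential inclusion can be differentiated: all second weak derivatives exist locally in
`L²` and are tangent to the graph. -/
theorem exists_weakDeriv_stackDeriv {c : I ⊕ J → I ⊕ J → ℝ}
    {Φ : J → Fin 2 → (I × Fin 2 → ℝ) → ℝ} (hcoer : IsCoerciveGraph c Φ)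
    (hΦ : ∀ l j, ContDiff ℝ 1 (Φ l j))
    {V : I ⊕ J → Plane → ℝ} {G : I ⊕ J → Fin 2 → Plane → ℝ}
    (hV : ∀ a, MemLp (V a) 2) (hG : ∀ a j, MemLp (G a j) 2)
    (hVG : ∀ a j, HasWeakPartialDeriv Set.univ j (V a) (G a j)) {C : ℝ}
    (hGC : ∀ᵐ x, ‖fun s : I × Fin 2 => G (Sum.inl s.1) s.2 x‖ ≤ C)
    {U : Set Plane} (hUo : IsOpen U)
    (hU : ∀ᵐ x, x ∈ U → ∀ a j, G a j x = stackMap Φ (fun s => G (Sum.inl s.1) s.2 x) a j)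
    {K : Set Plane} (hK : IsCompact K) (hKU : K ⊆ U) :
    ∃ W, IsOpen W ∧ K ⊆ W ∧ ∃ X : Fin 2 → I × Fin 2 → Plane → ℝ, (∀ k s, MemLp (X k s) 2) ∧
      ∀ k a j, HasWeakPartialDeriv W k (G a j) fun x =>
        stackDeriv Φ (fun s => G (Sum.inl s.1) s.2 x) (fun s => X k s x) a j := by
  obtain ⟨η, hη, hηc, hηU, hη01, W, hW, hKW, hη1⟩ := exists_contDiff_cutoff hK hUo hKU
  choose X hX hXd using exists_weakDeriv_cutoff_gradient hcoer hΦ hV hG hVG hGC hUo hU hη hηc hηU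
  refine ⟨W, hW, hKW, X, hX, fun k a j => ?_⟩
  cases a with
  | inl i =>
    refine ((hXd k (i, j)).mono (Set.subset_univ W)).congr_ae
      (Eventually.of_forall fun x hx => ?_) (Eventually.of_forall fun x _ => rfl)
    simp [hη1 x hx]
  | inr l =>
    have hC0 : 0 ≤ C := by
      obtain ⟨x, hx⟩ := hGC.exists
      exact (norm_nonneg _).trans hx
    -- The chain rule is applied to the upper block multiplied by `η`, which stays bounded by `C`
    -- because `0 ≤ η ≤ 1` and agrees with the original block on `W`.
    have hchain := HasWeakPartialDeriv.comp_contDiff (hΦ l j)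
      (p := fun s x => η x * G (Sum.inl s.1) s.2 x) (X := X k) hC0 (fun s => ?_) (hX k) (hXd k)
    · refine (hchain.mono (Set.subset_univ W)).congr_ae ?_ ?_
      · filter_upwards [hU] with x hx hxW
        have hxU : x ∈ U := hηU (subset_tsupport _ (by simp [hη1 x hxW]))
        rw [hx hxU (Sum.inr l) j]
        simp [hη1 x hxW, stackMap]
      · refine Eventually.of_forall fun x hx => ?_
        simp [hη1 x hx, stackDeriv]
    · filter_upwards [hGC] with x hx
      rw [norm_mul]
      have h1 := norm_le_pi_norm (fun s : I × Fin 2 => G (Sum.inl s.1) s.2 x) s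
      have h2 : ‖η x‖ ≤ 1 := by
        rw [Real.norm_of_nonneg (hη01 x).1]; exact (hη01 x).2
      calc _ ≤ 1 * ‖G (Sum.inl s.1) s.2 x‖ := mul_le_mul_of_nonneg_right h2 (norm_nonneg _)
        _ ≤ C := by rw [one_mul]; exact h1.trans hx

/-- A function that is one on an open set has vanishing derivative there. -/
theorem fderiv_eq_zero_of_eq_one {ζ : Plane → ℝ} {W : Set Plane} (hW : IsOpen W)
    (h : ∀ x ∈ W, ζ x = 1) {x : Plane} (hx : x ∈ W) : fderiv ℝ ζ x = 0 := by
  have : ζ =ᶠ[𝓝 x] fun _ => (1 : ℝ) := by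
    filter_upwards [hW.mem_nhds hx] with y hy using h y hy
  rw [this.fderiv_eq]
  simp

theorem memLp_mul_cutoff {f η : Plane → ℝ} {p : ℝ≥0∞} (hf : MemLp f p) (hη : Continuous η)
    (hc : HasCompactSupport η) : MemLp (fun x => η x * f x) p := by
  obtain ⟨H, hH⟩ := hc.exists_bound_of_continuous hη
  exact memLp_bdd_mul hη.aestronglyMeasurable (Eventually.of_forall hH) hf

variable {c : I ⊕ J → I ⊕ J → ℝ} {Φ : J → Fin 2 → (I × Fin 2 → ℝ) → ℝ}
  {G : I ⊕ J → Fin 2 → Plane → ℝ} {C : ℝ} {W : Set Plane} {X : Fin 2 → I × Fin 2 → Plane → ℝ}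

/-- The gradient of a solution is essentially continuous. -/
theorem exists_essential_limit_gradient (hcoer : IsCoerciveGraph c Φ)
    (hΦ : ∀ l j, ContDiff ℝ 1 (Φ l j)) (hG : ∀ a j, MemLp (G a j) 2)
    (hGC : ∀ᵐ x, ‖fun s : I × Fin 2 => G (Sum.inl s.1) s.2 x‖ ≤ C) (hW : IsOpen W)
    (hX : ∀ k s, MemLp (X k s) 2)
    (hGX : ∀ k a j, HasWeakPartialDeriv W j (G a k) fun x =>
        stackDeriv Φ (fun s => G (Sum.inl s.1) s.2 x) (fun s => X k s x) a j)
    {x₀ : Plane} (hx₀ : x₀ ∈ W) (a : I ⊕ J) (k : Fin 2) :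
    ∃ w, ∀ δ > 0, ∃ r > 0, ∀ᵐ x, x ∈ Metric.ball x₀ r → |G a k x - w| ≤ δ := by
  obtain ⟨L, hL0, hL⟩ := exists_stackDeriv_bound hΦ C
  obtain ⟨ζ, hζ, hζc, hζW, -, O, hO, hxO, hζ1⟩ :=
    exists_contDiff_cutoff (isCompact_singleton (x := x₀)) hW (by simpa using hx₀)
  obtain ⟨R, hR, hRO⟩ := Metric.isOpen_iff.1 hO x₀ (hxO rfl)
  have hsub : Metric.ball x₀ (2 * (R / 2)) ⊆ O := by
    rwa [mul_div_cancel₀ R (two_ne_zero)]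
  have hM : ∀ a j, MemLp (fun x =>
      stackDeriv Φ (fun s => G (Sum.inl s.1) s.2 x) (fun s => X k s x) a j) 2 := fun a j =>
    memLp_stackDeriv hΦ (fun s => (hG _ _).1) hGC (hX k) a j
  have hd0 : ∀ x ∈ O, ∀ j, fderiv ℝ ζ x (coordVec j) = 0 := fun x hx j => by
    rw [fderiv_eq_zero_of_eq_one hO hζ1 hx]; rfl
  -- The function is `ζ ∂_k V`, with the squared norm of `X k` as energy density. Where `ζ = 1` its
  -- gradient is tangent to the graph, so linearised coercivity and the tangent bound supply the two
  -- conditions.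
  obtain ⟨w, hw⟩ := exists_essential_limit c hL0
    (W := fun a x => ζ x * G a k x)
    (M := fun a j x => ζ x *
      stackDeriv Φ (fun s => G (Sum.inl s.1) s.2 x) (fun s => X k s x) a j +
      G a k x * fderiv ℝ ζ x (coordVec j))
    (fun a => memLp_mul_cutoff (hG a k) hζ.continuous hζc)
    (fun a j => (memLp_mul_cutoff (hM a j) hζ.continuous hζc).add (by
      simpa only [mul_comm] using memLp_mul_cutoff (hG a k) (continuous_fderiv_coord hζ j)
        (hasCompactSupport_fderiv_coord hζc j)))
    (fun a j => (hGX k a j).mul_cutoff hζ hζc hζW)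
    (e := fun x => ∑ s, X k s x ^ 2)
    (integrable_finsetSum _ fun s _ => (hX k s).integrable_sq)
    (fun x => Finset.sum_nonneg fun _ _ => sq_nonneg _) (x₀ := x₀) (half_pos hR)
    (Eventually.of_forall fun x hx => by
      simp only [hζ1 x (hsub hx), hd0 x (hsub hx), one_mul, mul_zero, add_zero]
      exact hcoer.sum_sq_le_stackDeriv hΦ _ fun s => X k s x)
    (hGC.mono fun x hx1 hx => by
      simp only [hζ1 x (hsub hx), hd0 x (hsub hx), one_mul, mul_zero, add_zero]
      exact hL _ (fun s => X k s x) hx1) a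
  refine ⟨w, fun δ hδ => ?_⟩
  obtain ⟨r, hr, hwr⟩ := hw δ hδ
  refine ⟨min r R, lt_min hr hR, ?_⟩
  filter_upwards [hwr] with x hx hxb
  have h1 := hx (Metric.ball_subset_ball (min_le_left _ _) hxb)
  rwa [hζ1 x (hRO (Metric.ball_subset_ball (min_le_right _ _) hxb)), one_mul] at h1

end DifferentiatedSystem

/-! ### Freezing the coefficients: L⁴ near a point. -/

section HigherIntegrability

open scoped FourierTransform

variable {I J : Type*} [Fintype I] [Fintype J]
variable {c : I ⊕ J → I ⊕ J → ℝ} {Φ : J → Fin 2 → (I × Fin 2 → ℝ) → ℝ}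
  {G : I ⊕ J → Fin 2 → Plane → ℝ} {C : ℝ} {W : Set Plane} {X : Fin 2 → I × Fin 2 → Plane → ℝ}

/-- The partial derivatives of the lower block of the graph. -/
noncomputable def graphCoeff [DecidableEq I] (Φ : J → Fin 2 → (I × Fin 2 → ℝ) → ℝ) (l : J)
    (j : Fin 2) (s : I × Fin 2) (q : I × Fin 2 → ℝ) : ℝ :=
  fderiv ℝ (Φ l j) q (Pi.single s 1)

omit [Fintype J] in
theorem fderiv_eq_sum_graphCoeff [DecidableEq I] (l : J) (j : Fin 2) (q Y : I × Fin 2 → ℝ) :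
    fderiv ℝ (Φ l j) q Y = ∑ s, graphCoeff Φ l j s q * Y s := by
  conv_lhs => rw [← Finset.univ_sum_single Y, map_sum]
  refine Finset.sum_congr rfl fun s _ => ?_
  have : (Pi.single s (Y s) : I × Fin 2 → ℝ) = Y s • Pi.single s 1 := by
    rw [← Pi.single_smul, smul_eq_mul, mul_one]
  rw [this, map_smul, smul_eq_mul, mul_comm, graphCoeff]

omit [Fintype J] in
theorem continuous_graphCoeff [DecidableEq I] (hΦ : ∀ l j, ContDiff ℝ 1 (Φ l j)) (l : J)
    (j : Fin 2) (s : I × Fin 2) : Continuous (graphCoeff Φ l j s) :=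
  ((hΦ l j).continuous_fderiv (by simp)).clm_apply continuous_const

omit [Fintype J] in
theorem stackDeriv_eq_linearStack [DecidableEq I] (q Y : I × Fin 2 → ℝ) :
    stackDeriv Φ q Y = linearStack (fun l j s => graphCoeff Φ l j s q) Y := by
  funext a j
  cases a with
  | inl i => rfl
  | inr l => exact fderiv_eq_sum_graphCoeff l j q Y

/-- The coefficients of the differentiated system oscillate little on small balls. -/
theorem exists_ball_graphCoeff_sub_le [DecidableEq I] (hΦ : ∀ l j, ContDiff ℝ 1 (Φ l j))
    {p : I × Fin 2 → Plane → ℝ} {x₀ : Plane} {q₀ : I × Fin 2 → ℝ}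
    (hq : ∀ s, ∀ δ > 0, ∃ r > 0, ∀ᵐ x, x ∈ Metric.ball x₀ r → |p s x - q₀ s| ≤ δ)
    {δ : ℝ} (hδ : 0 < δ) : ∃ r > 0, ∀ᵐ x, x ∈ Metric.ball x₀ r →
      ∀ l j s, |graphCoeff Φ l j s (fun s => p s x) - graphCoeff Φ l j s q₀| ≤ δ := by
  have hev : ∀ᶠ q in 𝓝 q₀, ∀ l j s, |graphCoeff Φ l j s q - graphCoeff Φ l j s q₀| < δ := by
    refine eventually_all.2 fun l => eventually_all.2 fun j => eventually_all.2 fun s => ?_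
    exact (Metric.tendsto_nhds.1 ((continuous_graphCoeff hΦ l j s).tendsto q₀)) δ hδ
  obtain ⟨ε, hε, hball⟩ := Metric.eventually_nhds_iff.1 hev
  choose r hr hpr using fun s => hq s (ε / 2) (half_pos hε)
  have hfin : ∃ r₀ > 0, ∀ s, r₀ ≤ r s := by
    rcases isEmpty_or_nonempty (I × Fin 2) with h | h
    · exact ⟨1, one_pos, fun s => h.elim s⟩
    · exact ⟨Finset.univ.inf' Finset.univ_nonempty r,
        (Finset.lt_inf'_iff _).2 fun s _ => hr s, fun s => Finset.inf'_le _ (Finset.mem_univ s)⟩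
  obtain ⟨r₀, hr₀, hle⟩ := hfin
  refine ⟨r₀, hr₀, ?_⟩
  filter_upwards [ae_all_iff.2 hpr] with x hx hxb l j s
  refine (hball ?_ l j s).le
  refine lt_of_le_of_lt ((dist_pi_le_iff (half_pos hε).le).2 fun s => ?_) (half_lt_self hε)
  exact hx s (Metric.ball_subset_ball (hle s) hxb)

/-- The second derivatives of a solution are in `L⁴` near every point. -/
theorem exists_memLp_four_restrict (hcoer : IsCoerciveGraph c Φ)
    (hΦ : ∀ l j, ContDiff ℝ 1 (Φ l j)) (hG : ∀ a j, MemLp (G a j) 2)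
    (hGC : ∀ a j, ∀ᵐ x, |G a j x| ≤ C) (hW : IsOpen W) (hX : ∀ k s, MemLp (X k s) 2)
    (hGX : ∀ k a j, HasWeakPartialDeriv W j (G a k) fun x =>
        stackDeriv Φ (fun s => G (Sum.inl s.1) s.2 x) (fun s => X k s x) a j)
    {x₀ : Plane} (hx₀ : x₀ ∈ W) (k : Fin 2) :
    ∃ O, IsOpen O ∧ x₀ ∈ O ∧ ∀ s, MemLp (X k s) 4 (volume.restrict O) := by
  classical
  have hGp : ∀ᵐ x, ‖fun s : I × Fin 2 => G (Sum.inl s.1) s.2 x‖ ≤ |C| := by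
    filter_upwards [ae_all_iff.2 fun s : I × Fin 2 => hGC (Sum.inl s.1) s.2] with x hx
    exact (pi_norm_le_iff_of_nonneg (abs_nonneg C)).2 fun s => (hx s).trans (le_abs_self C)
  choose q₀ hq₀ using fun s : I × Fin 2 =>
    exists_essential_limit_gradient hcoer hΦ hG hGp hW hX hGX hx₀ (Sum.inl s.1) s.2
  set B : J → Fin 2 → I × Fin 2 → ℝ := fun l j s => graphCoeff Φ l j s q₀
  -- Tangential coercivity holds at every base point, in particular at the essential limit `q₀`.
  have hB : ∀ Y : I × Fin 2 → ℝ, ∑ s, Y s ^ 2 ≤ detForm c (linearStack B Y) := fun Y => by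
    rw [← stackDeriv_eq_linearStack]
    exact hcoer.sum_sq_le_stackDeriv hΦ q₀ Y
  obtain ⟨Cm, hCm⟩ := exists_isL4MultiplierWith_recoverySymbol hB
  obtain ⟨δ, hδ, hfix⟩ := exists_memLp_four_of_fixedPoint hCm
  obtain ⟨r, hr, hosc⟩ := exists_ball_graphCoeff_sub_le hΦ hq₀ (δ := δ) (by exact_mod_cast hδ)
  obtain ⟨ζ, hζ, hζc, hζW, -, O, hO, hxO, hζ1⟩ :=
    exists_contDiff_cutoff (isCompact_singleton (x := x₀)) (hW.inter Metric.isOpen_ball)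
      (by simpa using ⟨hx₀, hr⟩ : {x₀} ⊆ W ∩ Metric.ball x₀ r)
  refine ⟨O, hO, hxO rfl, fun s => ?_⟩
  set p : Plane → I × Fin 2 → ℝ := fun x s => G (Sum.inl s.1) s.2 x
  set M : I ⊕ J → Fin 2 → Plane → ℝ := fun a j x => stackDeriv Φ (p x) (fun s => X k s x) a j
  have hM : ∀ a j, MemLp (M a j) 2 := fun a j =>
    memLp_stackDeriv hΦ (fun s => (hG _ _).1) hGp (hX k) a j
  -- The cutoff errors are bounded with compact support, hence in every L^q; they make up the
  -- right-hand side of the fixed-point equation.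
  set T : I ⊕ J → Fin 2 → Plane → ℝ := fun a j x => G a k x * fderiv ℝ ζ x (coordVec j)
  have hT : ∀ a j (q : ℝ≥0∞), MemLp (T a j) q := fun a j q =>
    memLp_bdd_mul (hG a k).1 (hGC a k) ((continuous_fderiv_coord hζ j).memLp_of_hasCompactSupport
      (hasCompactSupport_fderiv_coord hζc j))
  set D : I ⊕ J → Fin 2 → Plane → ℝ := fun a j x => ζ x * M a j x + T a j x
  have hD : ∀ a j, MemLp (D a j) 2 := fun a j =>
    (memLp_mul_cutoff (hM a j) hζ.continuous hζc).add (hT a j 2)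
  have hwD : ∀ a j, HasWeakPartialDeriv Set.univ j (fun x => ζ x * G a k x) (D a j) :=
    fun a j => (hGX k a j).mul_cutoff hζ hζc (hζW.trans Set.inter_subset_left)
  -- Truncating the coefficient error to the ball makes it globally at most `δ`, and changes nothing
  -- because `ζ` is supported in the ball.
  set A : J × Fin 2 → I × Fin 2 → Plane → ℝ := fun t s => (Metric.ball x₀ r).indicator fun x =>
    graphCoeff Φ t.1 t.2 s (p x) - B t.1 t.2 s
  have hpm : AEStronglyMeasurable p volume :=
    (aemeasurable_pi_lambda _ fun s => (hG _ _).1.aemeasurable).aestronglyMeasurable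
  have hAm : ∀ t s, AEStronglyMeasurable (A t s) volume := fun t s =>
    (((continuous_graphCoeff hΦ t.1 t.2 s).comp_aestronglyMeasurable hpm).sub
      aestronglyMeasurable_const).indicator Metric.isOpen_ball.measurableSet
  have hAδ : ∀ t s, ∀ᵐ x, |A t s x| ≤ δ := fun t s => by
    filter_upwards [hosc] with x hx
    by_cases hxb : x ∈ Metric.ball x₀ r
    · simp only [A, Set.indicator_of_mem hxb]
      exact hx hxb t.1 t.2 s
    · simp [A, Set.indicator_of_notMem hxb]
  set H : J × Fin 2 → Plane → ℝ := fun t x =>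
    D (Sum.inr t.1) t.2 x - ∑ s, B t.1 t.2 s * D (Sum.inl s.1) s.2 x
  have hH : ∀ t, MemLp (H t) 2 := fun t =>
    (hD _ _).sub (memLp_finsetSum _ fun s _ => (hD _ _).const_mul _)
  set g : J × Fin 2 → Plane → ℝ := fun t x => T (Sum.inr t.1) t.2 x -
    ((∑ s, B t.1 t.2 s * T (Sum.inl s.1) s.2 x) + ∑ s, A t s x * T (Sum.inl s.1) s.2 x)
  have hg : ∀ t (q : ℝ≥0∞), MemLp (g t) q := fun t q =>
    (hT _ _ q).sub ((memLp_finsetSum _ fun s _ => (hT _ _ q).const_mul _).add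
      (memLp_finsetSum _ fun s _ => memLp_bdd_mul (hAm t s) (hAδ t s) (hT _ _ q)))
  have hHg : ∀ t x, H t x = (∑ s, A t s x * D (Sum.inl s.1) s.2 x) + g t x := fun t x => by
    have key : ζ x * M (Sum.inr t.1) t.2 x - ∑ s, B t.1 t.2 s * (ζ x * X k s x) =
        ∑ s, A t s x * (ζ x * X k s x) := by
      by_cases hxb : x ∈ Metric.ball x₀ r
      · have h1 : M (Sum.inr t.1) t.2 x = ∑ s, graphCoeff Φ t.1 t.2 s (p x) * X k s x :=
          fderiv_eq_sum_graphCoeff _ _ _ _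
        rw [h1, Finset.mul_sum, ← Finset.sum_sub_distrib]
        refine Finset.sum_congr rfl fun s _ => ?_
        simp only [A, Set.indicator_of_mem hxb]
        ring
      · have h0 : ζ x = 0 := image_eq_zero_of_notMem_tsupport fun h => hxb (hζW h).2
        simp [h0]
    have h2 : ∀ s : I × Fin 2, D (Sum.inl s.1) s.2 x = ζ x * X k s x + T (Sum.inl s.1) s.2 x :=
      fun s => rfl
    have h3 : D (Sum.inr t.1) t.2 x = ζ x * M (Sum.inr t.1) t.2 x + T (Sum.inr t.1) t.2 x := rfl
    simp only [H, g, h2, h3, mul_add, Finset.sum_add_distrib]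
    linarith
  have hwc : ∀ a, HasCompactSupport fun x => ζ x * G a k x := fun a => hζc.mul_right
  have hDc : ∀ a j, HasCompactSupport (D a j) := fun a j =>
    hζc.mul_right.add (hasCompactSupport_fderiv_coord hζc j).mul_left
  have hY := hfix (fun t s x => (A t s x : ℂ))
    (fun t s => Complex.continuous_ofReal.comp_aestronglyMeasurable (hAm t s))
    (fun t s => (hAδ t s).mono fun x hx => by simpa using hx)
    (fun s => toL2C (D (Sum.inl s.1) s.2) (hD _ _)) (fun t => toL2C (H t) (hH t))
    (fun t => toL2C (g t) (hg t 2))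
    (fun t => (memLp_congr_ae (coeFn_toL2C (hg t 2))).2 ((hg t 4).ofReal (K := ℂ)))
    (fun t => by
      filter_upwards [coeFn_toL2C (hH t), coeFn_toL2C (hg t 2),
        ae_all_iff.2 fun s : I × Fin 2 => coeFn_toL2C (hD (Sum.inl s.1) s.2)] with x h1 h2 h3
      rw [h1, h2, hHg]
      simp [h3])
    (fun s => fourierInv_eq_sum_recoverySymbol hB
      (fun a => memLp_mul_cutoff (hG a k) hζ.continuous hζc) hD hwD hwc hDc
      (fun t => coeFn_toL2C (hH t)) s) s
  have hD4 : MemLp (D (Sum.inl s.1) s.2) 4 := by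
    have := ((memLp_congr_ae (coeFn_toL2C (hD (Sum.inl s.1) s.2))).1 hY).re
    simpa using this
  refine (memLp_congr_ae ?_).1 (hD4.restrict O)
  filter_upwards [ae_restrict_mem hO.measurableSet] with x hx
  have h1 : D (Sum.inl s.1) s.2 x = ζ x * X k s x + G (Sum.inl s.1) k x *
    fderiv ℝ ζ x (coordVec s.2) := rfl
  rw [h1, hζ1 x hx, fderiv_eq_zero_of_eq_one hO hζ1 hx]
  simp

end HigherIntegrability

/-! ### Locality and gluing of weak derivatives. -/

section Gluing

variable {f g : Plane → ℝ} {k : Fin 2} {U U' : Set Plane} {p : ℝ≥0∞}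

theorem memLp_restrict_union {K K' : Set Plane} (hK : MeasurableSet K) (hK' : MeasurableSet K')
    (h : MemLp f p (volume.restrict K)) (h' : MemLp f p (volume.restrict K')) :
    MemLp f p (volume.restrict (K ∪ K')) := by
  rw [← memLp_indicator_iff_restrict (hK.union hK'), ← Set.union_sdiff_self,
    Set.indicator_union_of_disjoint Set.disjoint_sdiff_right]
  exact ((memLp_indicator_iff_restrict hK).2 h).add ((memLp_indicator_iff_restrict
    (hK'.diff hK)).2 (h'.mono_measure (Measure.restrict_mono Set.sdiff_subset le_rfl)))

theorem MemLpLoc.union (hU : IsOpen U) (hU' : IsOpen U') (h : MemLpLoc U p f)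
    (h' : MemLpLoc U' p f) : MemLpLoc (U ∪ U') p f := by
  intro K hK hKU
  obtain ⟨K₁, K₂, h1, h2, h1U, h2U, rfl⟩ := hK.binary_compact_cover hU hU' hKU
  exact memLp_restrict_union h1.measurableSet h2.measurableSet (h K₁ h1 h1U) (h' K₂ h2 h2U)

/-- Each test function on the union is split as `η φ + (1 - η) φ` with the two supports in `U` and
`U'`. -/
theorem HasWeakPartialDeriv.union (hU : IsOpen U) (hU' : IsOpen U')
    (h : HasWeakPartialDeriv U k f g) (h' : HasWeakPartialDeriv U' k f g) :
    HasWeakPartialDeriv (U ∪ U') k f g := by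
  have hf := h.1.union hU hU' h'.1
  have hg := h.2.1.union hU hU' h'.2.1
  refine hasWeakPartialDeriv_of_integral_eq hf hg fun φ hφ hc hs => ?_
  obtain ⟨η, hη, hηc, hηU, -, W, hW, hKW, hη1⟩ := exists_contDiff_cutoff
    (hc.isCompact.diff hU') hU fun x hx => (hs hx.1).resolve_right hx.2
  have s1 : tsupport (fun x => η x * φ x) ⊆ U := tsupport_mul_subset_left.trans hηU
  -- Points of the support of `φ` outside `U'` have a neighbourhood where `η = 1`, so the second
  -- piece vanishes near them.
  have s2 : tsupport (fun x => (1 - η x) * φ x) ⊆ U' := by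
    intro x hx
    by_contra hxU
    have hxφ : x ∈ tsupport φ := tsupport_mul_subset_right hx
    have : x ∉ tsupport (fun x => (1 - η x) * φ x) := by
      rw [notMem_tsupport_iff_eventuallyEq]
      filter_upwards [hW.mem_nhds (hKW ⟨hxφ, hxU⟩)] with y hy
      simp [hη1 y hy]
    exact this hx
  have c1 : ContDiff ℝ ∞ fun x => η x * φ x := hη.mul hφ
  have c2 : ContDiff ℝ ∞ fun x => (1 - η x) * φ x := (contDiff_const.sub hη).mul hφ
  have e1 := h.integral_eq c1 hc.mul_left s1
  have e2 := h'.integral_eq c2 hc.mul_left s2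
  have hsplit : φ = (fun x => η x * φ x) + fun x => (1 - η x) * φ x := by
    funext x; simp only [Pi.add_apply]; ring
  have i1 := LocallyIntegrableOn.integrable_mul_test h.1 (continuous_fderiv_coord c1 k)
    (hasCompactSupport_fderiv_coord hc.mul_left k) ((tsupport_fderiv_coord_subset _ k).trans s1)
  have i2 := LocallyIntegrableOn.integrable_mul_test h'.1 (continuous_fderiv_coord c2 k)
    (hasCompactSupport_fderiv_coord hc.mul_left k) ((tsupport_fderiv_coord_subset _ k).trans s2)
  have i3 := LocallyIntegrableOn.integrable_mul_test h.2.1 c1.continuous hc.mul_left s1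
  have i4 := LocallyIntegrableOn.integrable_mul_test h'.2.1 c2.continuous hc.mul_left s2
  have l1 : ∫ x, f x * fderiv ℝ φ x (coordVec k) =
      (∫ x, f x * fderiv ℝ (fun x => η x * φ x) x (coordVec k)) +
        ∫ x, f x * fderiv ℝ (fun x => (1 - η x) * φ x) x (coordVec k) := by
    rw [← integral_add i1 i2]
    refine integral_congr_ae (Eventually.of_forall fun x => ?_)
    have hx : fderiv ℝ φ x = fderiv ℝ (fun x => η x * φ x) x +
        fderiv ℝ (fun x => (1 - η x) * φ x) x := by
      conv_lhs => rw [hsplit]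
      exact fderiv_add (c1.differentiable (by simp) x) (c2.differentiable (by simp) x)
    simp only [hx, add_apply]
    ring
  have l2 : ∫ x, g x * φ x = (∫ x, g x * (η x * φ x)) + ∫ x, g x * ((1 - η x) * φ x) := by
    rw [← integral_add i3 i4]
    refine integral_congr_ae (Eventually.of_forall fun x => ?_)
    simp only
    ring
  rw [l1, l2, e1, e2]
  ring

/-- Locality of weak derivatives: it suffices to check the definition near every point. -/
theorem hasWeakPartialDeriv_of_locally (hp : 1 ≤ p)
    (h : ∀ x ∈ U, ∃ O, IsOpen O ∧ x ∈ O ∧ MemLpLoc O p g ∧ HasWeakPartialDeriv O k f g) :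
    MemLpLoc U p g ∧ HasWeakPartialDeriv U k f g := by
  have key : ∀ K, IsCompact K → K ⊆ U →
      ∃ O, IsOpen O ∧ K ⊆ O ∧ MemLpLoc O p g ∧ HasWeakPartialDeriv O k f g := by
    intro K hK hKU
    refine hK.induction_on
      (p := fun S => ∃ O, IsOpen O ∧ S ⊆ O ∧ MemLpLoc O p g ∧ HasWeakPartialDeriv O k f g)
      ?_ ?_ ?_ ?_
    · have h0 : ∀ {q : ℝ≥0∞} {u : Plane → ℝ}, MemLpLoc ∅ q u := fun K _ hK0 => by
        rw [Set.subset_empty_iff.1 hK0, Measure.restrict_empty]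
        exact memLp_measure_zero
      refine ⟨∅, isOpen_empty, le_rfl, h0, h0, h0, fun φ _ _ _ => by simp⟩
    · rintro S T hST ⟨O, hO, hTO, hh⟩
      exact ⟨O, hO, hST.trans hTO, hh⟩
    · rintro S T ⟨O, hO, hSO, h1, h2⟩ ⟨O', hO', hTO, h1', h2'⟩
      exact ⟨O ∪ O', hO.union hO', Set.union_subset_union hSO hTO, h1.union hO hO' h1',
        h2.union hO hO' h2'⟩
    · intro x hx
      obtain ⟨O, hO, hxO, hh⟩ := h x (hKU hx)
      exact ⟨O, mem_nhdsWithin_of_mem_nhds (hO.mem_nhds hxO), O, hO, le_rfl, hh⟩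
  have hgp : MemLpLoc U p g := fun K hK hKU => by
    obtain ⟨O, -, hKO, h1, -⟩ := key K hK hKU
    exact h1 K hK hKO
  refine ⟨hgp, hasWeakPartialDeriv_of_integral_eq (fun K hK hKU => ?_) (hgp.mono_exponent hp)
    fun φ hφ hc hs => ?_⟩
  · obtain ⟨O, -, hKO, -, h2⟩ := key K hK hKU
    exact h2.1 K hK hKO
  · obtain ⟨O, -, hKO, -, h2⟩ := key _ hc hs
    exact h2.integral_eq hφ hc hKO

/-- Local weak derivatives glue to a weak derivative. -/
theorem exists_hasWeakPartialDeriv_of_locally (hU : IsOpen U) (hp : 1 ≤ p)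
    (h : ∀ x ∈ U, ∃ O, IsOpen O ∧ x ∈ O ∧ ∃ g, MemLpLoc O p g ∧ HasWeakPartialDeriv O k f g) :
    ∃ g, MemLpLoc U p g ∧ HasWeakPartialDeriv U k f g := by
  classical
  choose! O hO hxO g hgp hg using h
  -- A countable subcover keeps the exceptional sets on the overlaps jointly null, so the pieces can
  -- be selected pointwise.
  obtain ⟨T, hTU, hTc, hT⟩ := TopologicalSpace.countable_cover_nhdsWithin
    (s := U) (f := fun x => if x ∈ U then O x else Set.univ) fun x hx => by
      simp only [hx, if_true]
      exact mem_nhdsWithin_of_mem_nhds ((hO x hx).mem_nhds (hxO x hx))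
  have hTO : ∀ x ∈ U, ∃ t ∈ T, x ∈ O t := fun x hx => by
    obtain ⟨t, ht, hxt⟩ := Set.mem_iUnion₂.1 (hT hx)
    exact ⟨t, ht, by simpa only [hTU ht, if_true] using hxt⟩
  choose! τ hτT hτO using hTO
  have hagree : ∀ᵐ x, ∀ t ∈ T, ∀ t' ∈ T, x ∈ O t ∩ O t' → g t x = g t' x := by
    refine (ae_ball_iff hTc).2 fun t ht => (ae_ball_iff hTc).2 fun t' ht' => ?_
    exact ((hg t (hTU ht)).mono Set.inter_subset_left).unique
      ((hO t (hTU ht)).inter (hO t' (hTU ht'))) ((hg t' (hTU ht')).mono Set.inter_subset_right)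
  refine ⟨fun x => g (τ x) x, hasWeakPartialDeriv_of_locally hp fun x hx => ?_⟩
  have ht := hTU (hτT x hx)
  have hae : ∀ᵐ y, y ∈ O (τ x) ∩ U → g (τ x) y = g (τ y) y := by
    filter_upwards [hagree] with y hy hyO
    exact hy _ (hτT x hx) _ (hτT y hyO.2) ⟨hyO.1, hτO y hyO.2⟩
  exact ⟨O (τ x) ∩ U, (hO _ ht).inter hU, ⟨hτO x hx, hx⟩,
    ((hgp _ ht).mono_set Set.inter_subset_left).congr_ae hae,
    ((hg _ ht).mono Set.inter_subset_left).congr_ae (Eventually.of_forall fun _ _ => rfl) hae⟩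

end Gluing

/-! ### From local solutions to second derivatives in L⁴. -/

section DifferentialInclusion

theorem MemLpLoc.mul_cutoff_top {f η : Plane → ℝ} {U : Set Plane} (hf : MemLpLoc U ⊤ f)
    (hη : Continuous η) (hc : HasCompactSupport η) (hs : tsupport η ⊆ U) :
    (∀ q : ℝ≥0∞, MemLp (fun x => η x * f x) q) ∧ ∃ C, ∀ᵐ x, |η x * f x| ≤ C := by
  have hf' : MemLp ((tsupport η).indicator f) ⊤ :=
    (memLp_indicator_iff_restrict (isClosed_tsupport η).measurableSet).2 (hf _ hc hs)
  have he : ∀ x, η x * f x = (tsupport η).indicator f x * η x := fun x => by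
    by_cases hx : x ∈ tsupport η
    · rw [Set.indicator_of_mem hx, mul_comm]
    · rw [image_eq_zero_of_notMem_tsupport hx, zero_mul, mul_zero]
  have hbd : ∀ᵐ x, |(tsupport η).indicator f x| ≤ (eLpNorm ((tsupport η).indicator f) ⊤).toReal := by
    have hlt := hf'.2
    rw [eLpNorm_exponent_top] at hlt ⊢
    filter_upwards [ae_le_eLpNormEssSup (f := (tsupport η).indicator f) (μ := volume)] with x hx
    have := ENNReal.toReal_mono hlt.ne hx
    rwa [toReal_enorm] at this
  simp_rw [he]
  refine ⟨fun q => memLp_bdd_mul hf'.1 hbd (hη.memLp_of_hasCompactSupport hc), ?_⟩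
  obtain ⟨H, hH⟩ := hc.exists_bound_of_continuous hη
  refine ⟨(eLpNorm ((tsupport η).indicator f) ⊤).toReal * H, hbd.mono fun x hx => ?_⟩
  rw [abs_mul]
  exact mul_le_mul hx (hH x) (abs_nonneg _) ENNReal.toReal_nonneg

variable {I J : Type*} [Fintype I] [Fintype J]

/-- Solutions of a strongly monotone first order inclusion have second derivatives in `L⁴`. -/
theorem exists_hasWeakPartialDeriv_memLpLoc_four {c : I ⊕ J → I ⊕ J → ℝ}
    {Φ : J → Fin 2 → (I × Fin 2 → ℝ) → ℝ} (hcoer : IsCoerciveGraph c Φ)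
    (hΦ : ∀ l j, ContDiff ℝ 1 (Φ l j)) {Ω : Set Plane} (hΩ : IsOpen Ω)
    {V : I ⊕ J → Plane → ℝ} {G : I ⊕ J → Fin 2 → Plane → ℝ}
    (hV : ∀ a, MemLpLoc Ω ⊤ (V a)) (hG : ∀ a j, MemLpLoc Ω ⊤ (G a j))
    (hVG : ∀ a j, HasWeakPartialDeriv Ω j (V a) (G a j))
    (hincl : ∀ᵐ x, x ∈ Ω → ∀ a j, G a j x = stackMap Φ (fun s => G (Sum.inl s.1) s.2 x) a j)
    (k : Fin 2) (i : I) (j : Fin 2) :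
    ∃ g, MemLpLoc Ω 4 g ∧ HasWeakPartialDeriv Ω k (G (Sum.inl i) j) g := by
  refine exists_hasWeakPartialDeriv_of_locally hΩ (by norm_num) fun x₀ hx₀ => ?_
  obtain ⟨χ, hχ, hχc, hχΩ, -, U, hU, hxU, hχ1⟩ :=
    exists_contDiff_cutoff (isCompact_singleton (x := x₀)) hΩ (by simpa using hx₀)
  have hUΩ : U ⊆ Ω := fun x hx => hχΩ (subset_tsupport _ (by simp [hχ1 x hx]))
  -- The gradient of the globally defined, compactly supported map `χ V`. It satisfies the inclusion
  -- only on `U`, where `χ = 1`, which is all the local arguments ask for.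
  set G' : I ⊕ J → Fin 2 → Plane → ℝ := fun a j x =>
    χ x * G a j x + V a x * fderiv ℝ χ x (coordVec j)
  have hGG' : ∀ x ∈ U, ∀ a j, G' a j x = G a j x := fun x hx a j => by
    simp [G', hχ1 x hx, fderiv_eq_zero_of_eq_one hU hχ1 hx]
  have h1 := fun a j => (hG a j).mul_cutoff_top hχ.continuous hχc hχΩ
  have h2 := fun a j => (hV a).mul_cutoff_top (continuous_fderiv_coord hχ j)
    (hasCompactSupport_fderiv_coord hχc j) ((tsupport_fderiv_coord_subset χ j).trans hχΩ)
  have hG' : ∀ a j, MemLp (G' a j) 2 := fun a j => by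
    refine ((h1 a j).1 2).add ?_
    simpa only [mul_comm] using (h2 a j).1 2
  have hbd : ∀ a j, ∃ C, ∀ᵐ x, |G' a j x| ≤ C := fun a j => by
    obtain ⟨C₁, hC₁⟩ := (h1 a j).2
    obtain ⟨C₂, hC₂⟩ := (h2 a j).2
    refine ⟨C₁ + C₂, ?_⟩
    filter_upwards [hC₁, hC₂] with x hx1 hx2
    rw [mul_comm] at hx2
    exact (abs_add_le _ _).trans (add_le_add hx1 hx2)
  choose C hC using hbd
  set C₀ := ∑ a, ∑ j, |C a j|
  have hCC : ∀ a j, C a j ≤ C₀ := fun a j => (le_abs_self _).trans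
    ((Finset.single_le_sum (f := fun j => |C a j|) (fun _ _ => abs_nonneg _)
      (Finset.mem_univ j)).trans (Finset.single_le_sum (f := fun a => ∑ j, |C a j|)
      (fun _ _ => Finset.sum_nonneg fun _ _ => abs_nonneg _) (Finset.mem_univ a)))
  have hC₀ : ∀ a j, ∀ᵐ x, |G' a j x| ≤ C₀ := fun a j =>
    (hC a j).mono fun x hx => hx.trans (hCC a j)
  have hGp : ∀ᵐ x, ‖fun s : I × Fin 2 => G' (Sum.inl s.1) s.2 x‖ ≤ C₀ := by
    filter_upwards [ae_all_iff.2 fun s : I × Fin 2 => hC₀ (Sum.inl s.1) s.2] with x hx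
    exact (pi_norm_le_iff_of_nonneg
      (Finset.sum_nonneg fun _ _ => Finset.sum_nonneg fun _ _ => abs_nonneg _)).2 hx
  have hVG' : ∀ a j, HasWeakPartialDeriv Set.univ j (fun x => χ x * V a x) (G' a j) :=
    fun a j => (hVG a j).mul_cutoff hχ hχc hχΩ
  have hincl' : ∀ᵐ x, x ∈ U → ∀ a j,
      G' a j x = stackMap Φ (fun s => G' (Sum.inl s.1) s.2 x) a j := by
    filter_upwards [hincl] with x hx hxU a j
    simp_rw [hGG' x hxU]
    exact hx (hUΩ hxU) a j
  obtain ⟨W, hW, hxW, X, hX, hGX⟩ := exists_weakDeriv_stackDeriv hcoer hΦ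
    (fun a => ((hV a).mul_cutoff_top hχ.continuous hχc hχΩ).1 2) hG' hVG' hGp hU hincl'
    isCompact_singleton hxU
  -- So far `X k` gives the `k`-th derivatives of the gradient entries. Symmetry of second
  -- derivatives turns it into the full gradient of `∂_k V`, the form the linear system requires.
  obtain ⟨O, hO, hxO, hX4⟩ := exists_memLp_four_restrict hcoer hΦ hG' hC₀ hW hX
    (fun k a j => ((hVG' a j).mono (Set.subset_univ W)).swap
      ((hVG' a k).mono (Set.subset_univ W)) (hGX k a j)) (hxW rfl) k
  refine ⟨O ∩ (W ∩ U), hO.inter (hW.inter hU), ⟨hxO, hxW rfl, hxU rfl⟩, X k (i, j),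
    fun K _ hKO => (hX4 (i, j)).mono_measure
      (Measure.restrict_mono (hKO.trans Set.inter_subset_left) le_rfl), ?_⟩
  refine ((hGX k (Sum.inl i) j).mono (Set.inter_subset_right.trans
    Set.inter_subset_left)).congr_ae (Eventually.of_forall fun x hx => hGG' x hx.2.2 _ _)
    (Eventually.of_forall fun x _ => rfl)

end DifferentialInclusion

/-! ### Translation from matrices to indexed families. -/

section MatrixGraphs

variable {r m : ℕ}

/-- The entries of a matrix map as functions of the entries of its argument. -/
def entryMap (F : Matrix (Fin r) (Fin 2) ℝ → Matrix (Fin m) (Fin 2) ℝ) (l : Fin m) (j : Fin 2)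
    (q : Fin r × Fin 2 → ℝ) : ℝ :=
  F (Matrix.of fun i j => q (i, j)) l j

theorem contDiff_entryMap {F : Matrix (Fin r) (Fin 2) ℝ → Matrix (Fin m) (Fin 2) ℝ} {n : ℕ∞ω}
    (hF : ContDiff ℝ n F) (l : Fin m) (j : Fin 2) : ContDiff ℝ n (entryMap F l j) := by
  let A : (Fin r × Fin 2 → ℝ) →ₗ[ℝ] Matrix (Fin r) (Fin 2) ℝ :=
    { toFun := fun q => Matrix.of fun i j => q (i, j)
      map_add' := fun _ _ => rfl
      map_smul' := fun _ _ => rfl }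
  let B : Matrix (Fin m) (Fin 2) ℝ →ₗ[ℝ] ℝ :=
    { toFun := fun Z => Z l j
      map_add' := fun _ _ => rfl
      map_smul' := fun _ _ => rfl }
  have hA : ContDiff ℝ n A := (LinearMap.toContinuousLinearMap A).contDiff
  have hB : ContDiff ℝ n B := (LinearMap.toContinuousLinearMap B).contDiff
  exact hB.comp (hF.comp hA)

theorem stackRows_finSumFinEquiv (F : Matrix (Fin r) (Fin 2) ℝ → Matrix (Fin m) (Fin 2) ℝ)
    (q : Fin r × Fin 2 → ℝ) (a : Fin r ⊕ Fin m) (j : Fin 2) :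
    stackRows (Matrix.of fun i j => q (i, j)) (F (Matrix.of fun i j => q (i, j)))
      (finSumFinEquiv a) j = stackMap (entryMap F) q a j := by
  cases a <;> simp [stackRows, stackMap, entryMap]

theorem frobenius_norm_sq (X : Matrix (Fin r) (Fin 2) ℝ) :
    ‖X‖ ^ 2 = ∑ s : Fin r × Fin 2, X s.1 s.2 ^ 2 := by
  have h0 : 0 ≤ ∑ i, ∑ j, X i j ^ 2 :=
    Finset.sum_nonneg fun _ _ => Finset.sum_nonneg fun _ _ => sq_nonneg _
  rw [Matrix.frobenius_norm_def, Fintype.sum_prod_type, ← Real.sqrt_eq_rpow]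
  simp only [Real.norm_eq_abs, Real.rpow_two, sq_abs]
  exact Real.sq_sqrt h0

/-- The determinant form sums over all ordered pairs of rows; coefficients are set to zero for pairs
out of order, which reproduces the sum over `a ≤ b`. -/
theorem isCoerciveGraph_entryMap {F : Matrix (Fin r) (Fin 2) ℝ → Matrix (Fin m) (Fin 2) ℝ}
    {c : Fin (r + m) → Fin (r + m) → ℝ}
    (hreg : ∀ X Y : Matrix (Fin r) (Fin 2) ℝ,
      ‖X - Y‖ ^ 2 ≤ ∑ a : Fin (r + m), ∑ b ∈ Finset.Ici a,
        c a b * (rowPair (stackRows X (F X)) a b - rowPair (stackRows Y (F Y)) a b).det) :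
    IsCoerciveGraph (fun a b => if finSumFinEquiv a ≤ finSumFinEquiv b then
      c (finSumFinEquiv a) (finSumFinEquiv b) else 0) (entryMap F) := by
  intro q q'
  have h := hreg (Matrix.of fun i j => q (i, j)) (Matrix.of fun i j => q' (i, j))
  rw [frobenius_norm_sq] at h
  refine h.trans (le_of_eq ?_)
  rw [detForm, ← finSumFinEquiv.sum_comp]
  refine Finset.sum_congr rfl fun a _ => ?_
  rw [← Finset.filter_le_eq_Ici, Finset.sum_filter, ← finSumFinEquiv.sum_comp]
  refine Finset.sum_congr rfl fun b _ => ?_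
  split_ifs
  · simp only [Matrix.det_fin_two, Matrix.sub_apply, rowPair, Matrix.submatrix_apply, id,
      Matrix.cons_val_zero, Matrix.cons_val_one, stackRows_finSumFinEquiv]
  · ring

end MatrixGraphs

/-! ### Assembly of the theorem. -/

theorem mainTheorem7 (r m k : ℕ) (hk : 1 ≤ k)
    (Ω : Set (EuclideanSpace ℝ (Fin 2))) (hΩ : IsOpen Ω)
    (F : Matrix (Fin r) (Fin 2) ℝ → Matrix (Fin m) (Fin 2) ℝ) (hF : ContDiff ℝ k F)
    (c : Fin (r + m) → Fin (r + m) → ℝ)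
    (hreg : ∀ X Y : Matrix (Fin r) (Fin 2) ℝ,
      ‖X - Y‖ ^ 2 ≤ ∑ a : Fin (r + m), ∑ b ∈ Finset.Ici a,
        c a b * (rowPair (stackRows X (F X)) a b - rowPair (stackRows Y (F Y)) a b).det)
    (V : EuclideanSpace ℝ (Fin 2) → EuclideanSpace ℝ (Fin (r + m)))
    (hV : MemSobolevLocVec Ω ∞ 1 V)
    (DV : EuclideanSpace ℝ (Fin 2) → Matrix (Fin (r + m)) (Fin 2) ℝ)
    (hDV : IsWeakDifferential Ω V DV)
    (hincl : ∀ᵐ x ∂(volume.restrict Ω), DV x ∈ graphSet F) :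
    ∃ ρ : ℝ, 0 < ρ ∧ MemSobolevLocVec Ω (ENNReal.ofReal (2 + ρ)) 2 (upperPart V) := by
  -- The Sobolev hypothesis only provides some bounded weak derivative; uniqueness carries the bound
  -- over to the given `DV`.
  have hDVtop : ∀ a j, MemLpLoc Ω ⊤ fun x => DV x a j := fun a j => by
    obtain ⟨g, hg, hg'⟩ := (hV a).2 j
    exact MemLpLoc.congr_ae hg' (hg.unique hΩ (hDV a j))
  have hΦ : ∀ l j, ContDiff ℝ 1 (entryMap F l j) := fun l j =>
    contDiff_entryMap (hF.of_le (by exact_mod_cast hk)) l j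
  have hG : ∀ᵐ x, x ∈ Ω → ∀ (a : Fin r ⊕ Fin m) j, DV x (finSumFinEquiv a) j =
      stackMap (entryMap F) (fun s => DV x (finSumFinEquiv (Sum.inl s.1)) s.2) a j := by
    filter_upwards [(ae_restrict_iff' hΩ.measurableSet).1 hincl] with x hx hxΩ a j
    obtain ⟨X, hX⟩ := hx hxΩ
    have hXq : X = Matrix.of fun i j => DV x (finSumFinEquiv (Sum.inl i : Fin r ⊕ Fin m)) j := by
      ext i j
      simp [hX, stackRows]
    rw [← stackRows_finSumFinEquiv]
    conv_lhs => rw [hX, hXq]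
  have h4 : ENNReal.ofReal (2 + 2) = 4 := by norm_num
  -- The second derivatives are in L⁴, so `2 + ρ = 4`; the lower derivatives are even locally
  -- bounded.
  refine ⟨2, two_pos, fun i => ?_⟩
  rw [h4]
  refine ⟨(hV (Fin.castAdd m i)).1.mono_exponent le_top, fun j =>
    ⟨fun x => DV x (Fin.castAdd m i) j, hDV _ _, (hDVtop _ _).mono_exponent le_top, fun l => ?_⟩⟩
  obtain ⟨g, hg, hgd⟩ := exists_hasWeakPartialDeriv_memLpLoc_four (isCoerciveGraph_entryMap hreg)
    hΦ hΩ (V := fun a x => V x (finSumFinEquiv a)) (G := fun a j x => DV x (finSumFinEquiv a) j)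
    (fun a => (hV (finSumFinEquiv a)).1) (fun a j => hDVtop _ _) (fun a j => hDV _ _) hG l i j
  exact ⟨g, hgd, hg⟩
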